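/- **Setting.** Let $\mathcal M=\langle S,\bar s,A,E,\Delta\rangle$ be a finite Markov decision process: finite sets $S$ of states and $A$ of actions, an initial state $\bar s\in S$, a non-empty set $E(s)\subseteq A$ of enabled actions for every $s$ (with $E(s)\cap E(t)=\emptyset$ for $s\neq t$), and a probability distribution $\Delta(s,a)$ on $S$ for $a\in E(s)$. Let $S$ contain two distinct distinguished terminal states $1$ and $0$ (all their enabled actions are self-loops), and let $F\subseteq S$ be a set of target states with $1\in F$, $0\notin F$. For $s\in S$ let $V(s)=\sup_\sigma \Pr^\sigma_s(\text{reach }F)$, over all history-dependent randomised strategies $\sigma$, and $V(s,a)=\sum_{t}\Delta(s,a)(t)V(t)$. Assume that every $f\in F$ has an action $a\in E(f)$ with $V(f,a)=1$, i.e. that $V(s)=\max_{a\in E(s)}V(s,a)$ holds at target states too (this is automatic if $F=\{1\}$, or if all target states are absorbing or lie in end components). There is no restriction on end components. An *end component* (EC) is a pair $(R,B)$, $R\subseteq S$, $\emptyset\ne B\subseteq\bigcup_{s\in R}E(s)$, such that the actions of $B$ taken in $R$ never leave $R$, and any state of $R$ is reachable from any other one by actions of $B$. A *MEC* is an EC that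 is maximal for componentwise inclusion. *Collapsing* $(R,B)$ replaces the states of $R$ by one state $s_{(R,B)}$, which is initial if $\bar s\in R$, whose enabled actions are those of the states of $R$ except $B$, each with its former transition distribution; all transitions into $R$ are redirected to $s_{(R,B)}$. $\textsc{MakeTerminal}(s,z)$, for $z\in\{0,1\}$, collapses $(\{s,z\},E(s))$ and calls the new state $z$. **Algorithm OBRTDP** (parameters: $\varepsilon>0$ and integers $k_0,k_1,k_2,\dots$). It keeps a current MDP, initially $\mathcal M$, whose components are again denoted by $S,\bar s,E,\Delta$, and functions $U,L$ on state-action pairs. Initially $U=1$, $L=0$, except $U(0,\cdot)=0$ and $L(1,\cdot)=1$. Write $U(s)=\max_{a\in E(s)}U(s,a)$ and $L(s)=\max_{a\in E(s)}L(s,a)$. In iteration $i=0,1,2,\dots$: 1. *Explore.* Let $\omega=\bar s$. Repeat: choose $a$ uniformly from $\arg\max_{a\in E(\mathrm{last}(\omega))}U(\mathrm{last}(\omega),a)$, sample $s$ from $\Delta(\mathrm{last}(\omega),a)$, and append $a\,s$ to $\omega$; if $\omega$ now has $k_i$ states, carry out step 3 and go to iteration $i+1$ (without step 2); otherwise, if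 $s\in\{0,1\}$, go to step 2. 2. *Update.* For the state-action pairs $(s,a)$ along $\omega$, from the last to the first, set $U(s,a)\leftarrow\sum_t\Delta(s,a)(t)U(t)$ and $L(s,a)\leftarrow\sum_t\Delta(s,a)(t)L(t)$. Then terminate if $U(\bar s)-L(\bar s)<\varepsilon$; otherwise go to iteration $i+1$. 3. *On-the-fly ECs.* Let $T$ be the set of states $s$ of the pairs $(s,a)$ that occur in $\omega$. Let $\mathcal M^T$ be the MDP with the states of $T$ and their one-step successors, in which the states of $T$ behave as in the current MDP and every other state has a self-loop as its only action. For each MEC $(R,B)$ of $\mathcal M^T$ with $R\subseteq T$: collapse $(R,B)$ in the current MDP and set $U(s_{(R,B)},a)\leftarrow U(s,a)$, $L(s_{(R,B)},a)\leftarrow L(s,a)$ for $s\in R$, $a\in E(s)\setminus B$; if $R\cap F\neq\emptyset$, apply $\textsc{MakeTerminal}(s_{(R,B)},1)$; otherwise, if $s_{(R,B)}$ has no enabled action, apply $\textsc{MakeTerminal}(s_{(R,B)},0)$. **Theorem.** Suppose that $k_i\ge 3$ for all $i$ and $k_i\ge|S|^2$ for all sufficiently large $i$, where $|S|$ is the number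 of states of $\mathcal M$ (so any sequence of integers $k_i\geq 3$ with $k_i\to\infty$ is allowed). Then OBRTDP converges almost surely: for every $\varepsilon>0$ it terminates with probability $1$, and at termination, with $\bar s'$ and $E'$ the initial state and the enabled actions of the final MDP, * $\max_{a\in E'(\bar s')}L(\bar s',a)\le V(\bar s)\le\max_{a\in E'(\bar s')}U(\bar s',a)$; * for every $a\in E'(\bar s')$, $L(\bar s',a)\le V(s,a)\le U(\bar s',a)$, where $s$ is the state of $\mathcal M$ in which $a$ is enabled; * $\max_{a\in E'(\bar s')}U(\bar s',a)-\max_{a\in E'(\bar s')}L(\bar s',a)<\varepsilon$; here $V$ is the value function of the original MDP $\mathcal M$. -/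

import Mathlib

namespace OBRTDP

open MeasureTheory ProbabilityTheory

noncomputable section

open scoped Classical

universe u v

/-! ### Markov decision processes, strategies, reachability values -/

/-- The data of a finite MDP whose states and actions are taken from the types `S` and `A`. Values
of `enabled` and `trans` outside `states` and at actions that are not enabled carry no meaning. -/
structure MDP (S : Type u) (A : Type v) where
  states : Finset S
  start : S
  enabled : S → Finset A
  trans : S → A → PMF S

variable {S : Type u} {A : Type v}

/-- The laws of an MDP, including the convention that an action is enabled in at most one state. -/
structure MDP.IsValid (M : MDP S A) : Prop where
  start_mem : M.start ∈ M.states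
  enabled_nonempty : ∀ s ∈ M.states, (M.enabled s).Nonempty
  support_subset : ∀ s ∈ M.states, ∀ a ∈ M.enabled s, (M.trans s a).support ⊆ ↑M.states
  enabled_disjoint : ∀ s ∈ M.states, ∀ t ∈ M.states, s ≠ t →
    Disjoint (M.enabled s) (M.enabled t)

/-- All enabled actions of `s` are self-loops. -/
def MDP.IsTerminal (M : MDP S A) (s : S) : Prop :=
  ∀ a ∈ M.enabled s, M.trans s a s = 1

/-- One letter `s a` of a path `s₀ a₀ s₁ a₁ …`. -/
@[ext]
structure Move (S : Type u) (A : Type v) where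
  state : S
  action : A

instance : MeasurableSpace (Move S A) := ⊤

instance : DiscreteMeasurableSpace (Move S A) := ⟨fun _ => trivial⟩

instance [Countable S] [Countable A] : Countable (Move S A) :=
  Function.Injective.countable (f := fun m : Move S A => (m.state, m.action)) (by
    intro m m' h
    exact Move.ext (congrArg Prod.fst h) (congrArg Prod.snd h))

/-- A (history-dependent, randomised) strategy. The finite path `s₀ a₀ … sₙ₋₁ aₙ₋₁ sₙ` is given by
the list of its letters `(s₀, a₀), …, (sₙ₋₁, aₙ₋₁)` and its last state `sₙ`. -/
structure Strategy (M : MDP S A) where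
  choose : List (Move S A) → S → PMF A
  support_subset : ∀ w, ∀ s ∈ M.states, (choose w s).support ⊆ ↑(M.enabled s)

/-- The list of the letters `0, …, n` of a path. -/
def prefixList {n : ℕ} (h : (i : Finset.Iic n) → Move S A) : List (Move S A) :=
  List.ofFn fun j : Fin (n + 1) => h ⟨j, Finset.mem_Iic.2 (Nat.lt_succ_iff.1 j.2)⟩

/-- The conditional law of letter `n + 1` given the letters `0, …, n`: the successor state is drawn
from the transition function, the next action from the strategy. -/
def Strategy.kernel [Countable S] [Countable A] {M : MDP S A} (σ : Strategy M) (n : ℕ) :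
    Kernel ((i : Finset.Iic n) → Move S A) (Move S A) where
  toFun h :=
    ((M.trans (h ⟨n, Finset.mem_Iic.2 le_rfl⟩).state (h ⟨n, Finset.mem_Iic.2 le_rfl⟩).action).bind
      fun t => (σ.choose (prefixList h) t).map (Move.mk t)).toMeasure
  measurable' := Measurable.of_discrete

instance [Countable S] [Countable A] {M : MDP S A} (σ : Strategy M) (n : ℕ) :
    IsMarkovKernel (σ.kernel n) :=
  ⟨fun _ => PMF.toMeasure.isProbabilityMeasure _⟩

/-- The probability measure on infinite paths from `s` that the strategy `σ` induces. -/
def pathMeasure [Countable S] [Countable A] {M : MDP S A} (σ : Strategy M) (s : S) :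
    Measure (ℕ → Move S A) :=
  Kernel.trajMeasure (X := fun _ => Move S A)
    ((σ.choose [] s).map (Move.mk s)).toMeasure σ.kernel

/-- The infinite paths that reach `F`. -/
def reach (F : Set S) : Set (ℕ → Move S A) := {ω | ∃ n, (ω n).state ∈ F}

/-- The value `V(s)`: the supremum over all strategies of the probability of reaching `F`. -/
def value [Countable S] [Countable A] (M : MDP S A) (F : Set S) (s : S) : ℝ :=
  (⨆ σ : Strategy M, pathMeasure σ s (reach F)).toReal

/-- The value `V(s, a)` of a state-action pair. -/
def actionValue [Countable S] [Countable A] (M : MDP S A) (F : Set S) (s : S) (a : A) : ℝ :=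
  ∑ t ∈ M.states, (M.trans s a t).toReal * value M F t

/-! ### End components and collapsing -/

/-- `(R, B)` is an end component of `M`, with at least one action: the pairs `(∅, ∅)` and
`({s}, ∅)` are not counted as end components. -/
structure MDP.IsEC (M : MDP S A) (R : Finset S) (B : Finset A) : Prop where
  states_subset : R ⊆ M.states
  actions_subset : B ⊆ R.biUnion M.enabled
  nonempty : B.Nonempty
  closed : ∀ s ∈ R, ∀ a ∈ B, a ∈ M.enabled s → (M.trans s a).support ⊆ ↑R
  connected : ∀ s ∈ R, ∀ t ∈ R,
    Relation.ReflTransGen (fun x y => ∃ a ∈ B, a ∈ M.enabled x ∧ 0 < M.trans x a y) s t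

/-- Maximal end components. -/
def MDP.IsMEC (M : MDP S A) (R : Finset S) (B : Finset A) : Prop :=
  M.IsEC R B ∧ ∀ R' B', M.IsEC R' B' → R ⊆ R' → B ⊆ B' → R' = R ∧ B' = B

/-- The state of `R` in which `a` is enabled (`r` if there is none). -/
def MDP.owner (M : MDP S A) (R : Finset S) (r : S) (a : A) : S :=
  if h : ∃ s ∈ R, a ∈ M.enabled s then h.choose else r

/-- Collapsing `(R, B)`; the new state is called `r`, where `r` is an element of `R`. -/
def MDP.collapse (M : MDP S A) (R : Finset S) (B : Finset A) (r : S) : MDP S A where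
  states := insert r (M.states \ R)
  start := if M.start ∈ R then r else M.start
  enabled s := if s = r then R.biUnion M.enabled \ B else M.enabled s \ B
  trans s a := (M.trans (if s = r then M.owner R r a else s) a).map
    fun t => if t ∈ R then r else t

/-- Merging the state `s` into the terminal state `z`. -/
def MDP.makeTerminal (M : MDP S A) (s z : S) : MDP S A :=
  M.collapse {s, z} (M.enabled s) z

/-! ### The auxiliary MDP of an explored set, and the identification of end components -/

/-- The MDP `M^T`: the states of `T` behave as in `M`, and their successors outside `T` get a
self-loop, with the new action `none`, as their only action. -/
def MDP.explored (M : MDP S A) (T : Finset S) : MDP S (Option A) where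
  states := T ∪ M.states.filter fun t => ∃ s ∈ T, ∃ a ∈ M.enabled s, 0 < M.trans s a t
  start := M.start
  enabled s := if s ∈ T then (M.enabled s).map Function.Embedding.some else {none}
  trans s a := match a with
    | some a => M.trans s a
    | none => PMF.pure s

/-- The maximal end components of `M^T` that are contained in `T`. -/
def MDP.identifyECs (M : MDP S A) (T : Finset S) : Finset (Finset S × Finset A) :=
  ((T.powerset ×ˢ (T.biUnion (M.explored T).enabled).powerset).filter
    fun P => (M.explored T).IsMEC P.1 P.2).image fun P => (P.1, Finset.eraseNone P.2)

/-! ### The algorithm -/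

/-- The current MDP and the current upper and lower bounds on state-action pairs. -/
structure Bounds (S : Type u) (A : Type v) where
  mdp : MDP S A
  U : S → A → ℝ
  L : S → A → ℝ

/-- `max_{a ∈ E(s)} f(s, a)`. -/
def MDP.best (M : MDP S A) (f : S → A → ℝ) (s : S) : ℝ :=
  if h : (M.enabled s).Nonempty then (M.enabled s).sup' h (f s) else 0

/-- `argmax_{a ∈ E(s)} f(s, a)`. -/
def MDP.bestActions (M : MDP S A) (f : S → A → ℝ) (s : S) : Finset A :=
  (M.enabled s).filter fun a => f s a = M.best f s

/-- `f(s, a) ← ∑ₜ Δ(s, a)(t) · f(t)`, where `f(t) = max_{b ∈ E(t)} f(t, b)`. -/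
def MDP.backup (M : MDP S A) (f : S → A → ℝ) (s : S) (a : A) : S → A → ℝ :=
  Function.update f s (Function.update (f s) a
    (∑ t ∈ M.states, (M.trans s a t).toReal * M.best f t))

/-- The BRTDP update of a state-action pair. -/
def Bounds.update (c : Bounds S A) (m : Move S A) : Bounds S A where
  mdp := c.mdp
  U := c.mdp.backup c.U m.state m.action
  L := c.mdp.backup c.L m.state m.action

/-- Collapse one end component `(R, B)`, copy the bounds of the remaining actions, and merge the new
state into the terminal state `one` if `R` contains a target state, or else into the terminal state
`zero` if no action is left. -/
def Bounds.processEC (F : Set S) (one zero : S) (c : Bounds S A) (P : Finset S × Finset A) :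
    Bounds S A :=
  if hR : P.1.Nonempty then
    let r := hR.choose
    let M := c.mdp.collapse P.1 P.2 r
    { mdp :=
        if ∃ s ∈ P.1, s ∈ F then M.makeTerminal r one
        else if M.enabled r = ∅ then M.makeTerminal r zero
        else M
      U := fun s a => if s = r then c.U (c.mdp.owner P.1 r a) a else c.U s a
      L := fun s a => if s = r then c.L (c.mdp.owner P.1 r a) a else c.L s a }
  else c

/-- The on-the-fly processing of end components, for the set `T` of explored states. -/
def Bounds.onTheFlyEC (F : Set S) (one zero : S) (c : Bounds S A) (T : Finset S) : Bounds S A :=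
  (c.mdp.identifyECs T).toList.foldl (Bounds.processEC F one zero) c

/-- A configuration of the algorithm: the MDP and the bounds, the number `iter` of finished
iterations of the outer loop, the path `ω` of the current simulation (its state-action letters,
most recent first, and its last state), and whether the algorithm has terminated. -/
structure Config (S : Type u) (A : Type v) where
  bounds : Bounds S A
  iter : ℕ
  path : List (Move S A)
  last : S
  halted : Bool

instance : MeasurableSpace (Config S A) := ⊤

/-- The start of the simulation of iteration `i`. -/
def Config.begin (c : Bounds S A) (i : ℕ) (halted : Bool) : Config S A where
  bounds := c
  iter := i
  path := []
  last := c.mdp.start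
  halted := halted

/-- The upper minus the lower bound at the initial state. -/
def Bounds.gap (c : Bounds S A) : ℝ :=
  c.mdp.best c.U c.mdp.start - c.mdp.best c.L c.mdp.start

/-- What happens after the simulated path has been extended by the action `a` and the state `s`.
If the path has `k i` states in iteration `i`, end components are identified and processed, and the
next iteration starts. Otherwise, if `s` is one of the terminal states `one`, `zero`, the
state-action pairs of the path are updated backwards, and the termination criterion is tested.
Otherwise the simulation goes on. -/
def Config.advance (F : Set S) (one zero : S) (ε : ℝ) (k : ℕ → ℕ) (c : Config S A)
    (a : A) (s : S) : Config S A :=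
  let ω := Move.mk c.last a :: c.path
  if ω.length + 1 = k c.iter then
    Config.begin (c.bounds.onTheFlyEC F one zero (ω.map Move.state).toFinset) (c.iter + 1) false
  else if s = one ∨ s = zero then
    let b := ω.foldl Bounds.update c.bounds
    Config.begin b (c.iter + 1) (decide (b.gap < ε))
  else
    { c with path := ω, last := s }

/-- One step of the simulation: the action is uniform among the enabled actions with the greatest
upper bound, and the successor is drawn from the transition function. Terminated configurations do
not change. -/
def Config.next (F : Set S) (one zero : S) (ε : ℝ) (k : ℕ → ℕ) (c : Config S A) :
    PMF (Config S A) :=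
  if h : c.halted = false ∧ (c.bounds.mdp.bestActions c.bounds.U c.last).Nonempty then
    (PMF.uniformOfFinset (c.bounds.mdp.bestActions c.bounds.U c.last) h.2).bind fun a =>
      (c.bounds.mdp.trans c.last a).map fun s => c.advance F one zero ε k a s
  else PMF.pure c

/-- The bounds at the beginning: `U = 1` and `L = 0`, except that `U = 0` at the state `zero` and
`L = 1` at the state `one`. -/
def Bounds.first (M : MDP S A) (one zero : S) : Bounds S A where
  mdp := M
  U := fun s _ => if s = zero then 0 else 1
  L := fun s _ => if s = one then 1 else 0

/-- The conditional law of configuration `n + 1` given the configurations `0, …, n`. -/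
def runKernel (F : Set S) (one zero : S) (ε : ℝ) (k : ℕ → ℕ) (n : ℕ) :
    Kernel ((i : Finset.Iic n) → Config S A) (Config S A) where
  toFun h := (Config.next F one zero ε k (h ⟨n, Finset.mem_Iic.2 le_rfl⟩)).toMeasure
  measurable' :=
    (measurable_from_top
      (f := fun c : Config S A => (Config.next F one zero ε k c).toMeasure)).comp
        (measurable_pi_apply _)

instance (F : Set S) (one zero : S) (ε : ℝ) (k : ℕ → ℕ) (n : ℕ) :
    IsMarkovKernel (runKernel (A := A) F one zero ε k n) :=
  ⟨fun _ => PMF.toMeasure.isProbabilityMeasure _⟩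

/-- The law of the random sequence of configurations of the algorithm OBRTDP on the MDP `M` with
target set `F`, terminal states `one` and `zero`, precision `ε`, and path lengths `k i`. -/
def runMeasure (M : MDP S A) (F : Set S) (one zero : S) (ε : ℝ) (k : ℕ → ℕ) :
    Measure (ℕ → Config S A) :=
  Kernel.trajMeasure (X := fun _ => Config S A)
    (Measure.dirac (Config.begin (Bounds.first M one zero) 0 false))
    (runKernel F one zero ε k)

/-- The bounds of `c` are correct at its initial state, for the MDP `M` and the target set `F`, and
their distance there is less than `ε`. The bounds on pairs are compared with the value in `M` of
the action in the state of `M` that it belongs to. -/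
structure Bounds.IsCorrect [Countable S] [Countable A] (M : MDP S A) (F : Set S) (ε : ℝ)
    (c : Bounds S A) : Prop where
  pairs : ∀ a ∈ c.mdp.enabled c.mdp.start, ∃ s ∈ M.states, a ∈ M.enabled s ∧
    c.L c.mdp.start a ≤ actionValue M F s a ∧ actionValue M F s a ≤ c.U c.mdp.start a
  lower : c.mdp.best c.L c.mdp.start ≤ value M F M.start
  upper : value M F M.start ≤ c.mdp.best c.U c.mdp.start
  close : c.gap < ε

end

end OBRTDP

/-!
*Correctness.* The value function is constant on end components, so it also solves the Bellman
equation of every MDP obtained by collapsing end components, and backups preserve the inequalities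
between the bounds and the value. The delicate point is that collapsing `(R, B)` deletes the actions
of `B`, which must not destroy the bounds of the new state. For the upper bound this follows from
the Bellman equation in the collapsed MDP. For the lower bound one needs that states cannot owe
positive lower bounds to one another in a cycle: on every set of states without `one`, a positive
maximum of the lower bound is attained by an action that may leave the set, and backups preserve
this.

*Termination.* Suppose that a run never terminates. Every collapse removes an action, so the MDP is
eventually constant, say `M'`. There are only finitely many sets of greedy actions, so some set `ρ`
of them is current at the beginning of infinitely many simulations. Almost surely every event whose
conditional probability is infinitely often bounded away from zero occurs infinitely often, so every
finite path of `ρ` from the initial state is followed infinitely often. If `ρ` could reach a state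
from which no terminal state is reachable, then it could reach an end component, and a path with
fewer than `k i` states would visit all of it; the simulation would become too long there, and the
end component would be collapsed. Hence a terminal state is always reachable under `ρ`, and all
pairs that `ρ` can reach are updated infinitely often. In the limit the distance `D` between the
bounds is therefore at most the expectation of `D` over the successors, so by the maximum principle
`D` at the initial state is at most its value `0` at the terminal states. But it is at least `ε`.
-/

namespace OBRTDP

open MeasureTheory ProbabilityTheory

noncomputable section

open scoped Classical

section Trajectories

open Preorder Filter
open scoped ENNReal

variable {X : ℕ → Type*} [∀ n, MeasurableSpace (X n)] (μ₀ : Measure (X 0))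
  (κ : (n : ℕ) → Kernel ((i : Finset.Iic n) → X i) (X (n + 1))) [∀ n, IsMarkovKernel (κ n)]

theorem trajMeasure_map_zero : (Kernel.trajMeasure μ₀ κ).map (fun ω => ω 0) = μ₀ := by
  have h0 : (fun ω : (n : ℕ) → X n => ω 0) = (fun h : (i : Finset.Iic 0) → X i =>
      h ⟨0, Finset.mem_Iic.2 le_rfl⟩) ∘ frestrictLe 0 := rfl
  rw [h0, ← Measure.map_map (by fun_prop) (by fun_prop), Kernel.trajMeasure,
    Measure.map_comp _ _ (by fun_prop), Kernel.traj_map_frestrictLe, Kernel.partialTraj_self,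
    Measure.id_comp]
  exact (MeasurableEquiv.piUnique fun i : Finset.Iic 0 => X i).map_map_symm

theorem ae_trajMeasure_zero {p : X 0 → Prop} (hp : ∀ᵐ x ∂μ₀, p x) :
    ∀ᵐ ω ∂(Kernel.trajMeasure μ₀ κ), p (ω 0) := by
  rw [← trajMeasure_map_zero μ₀ κ] at hp
  exact ae_of_ae_map (measurable_pi_apply 0).aemeasurable hp

variable [IsProbabilityMeasure μ₀]

theorem lintegral_trajMeasure_succ (n : ℕ) {f : ((i : Finset.Iic n) → X i) × X (n + 1) → ℝ≥0∞}
    (hf : Measurable f) :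
    ∫⁻ ω, f (frestrictLe n ω, ω (n + 1)) ∂(Kernel.trajMeasure μ₀ κ) =
      ∫⁻ ω, ∫⁻ y, f (frestrictLe n ω, y) ∂(κ n (frestrictLe n ω)) ∂(Kernel.trajMeasure μ₀ κ) := by
  rw [← lintegral_map hf (by fun_prop),
    ← Kernel.map_frestrictLe_trajMeasure_compProd_eq_map_trajMeasure,
    Measure.lintegral_compProd hf, lintegral_map hf.lintegral_kernel_prod_right' (by fun_prop)]

theorem ae_trajMeasure_succ_iff (n : ℕ) {E : Set (((i : Finset.Iic n) → X i) × X (n + 1))}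
    (hE : MeasurableSet E) :
    (∀ᵐ ω ∂(Kernel.trajMeasure μ₀ κ), (frestrictLe n ω, ω (n + 1)) ∈ E) ↔
      ∀ᵐ ω ∂(Kernel.trajMeasure μ₀ κ), ∀ᵐ y ∂(κ n (frestrictLe n ω)), (frestrictLe n ω, y) ∈ E := by
  have hsection : MeasurableSet {h | ∀ᵐ y ∂(κ n h), (h, y) ∈ E} :=
    Kernel.measurable_kernel_prodMk_left hE.compl (measurableSet_singleton 0)
  have hpair : Measurable fun ω : (i : ℕ) → X i => (frestrictLe n ω, ω (n + 1)) := by fun_prop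
  refine (ae_map_iff hpair.aemeasurable hE).symm.trans ?_
  rw [← Kernel.map_frestrictLe_trajMeasure_compProd_eq_map_trajMeasure,
    Measure.ae_compProd_iff hE]
  exact ae_map_iff (by fun_prop) hsection

theorem trajMeasure_apply_succ (n : ℕ) {E : Set (((i : Finset.Iic n) → X i) × X (n + 1))}
    (hE : MeasurableSet E) :
    Kernel.trajMeasure μ₀ κ {ω | (frestrictLe n ω, ω (n + 1)) ∈ E} =
      ∫⁻ ω, κ n (frestrictLe n ω) {y | (frestrictLe n ω, y) ∈ E} ∂(Kernel.trajMeasure μ₀ κ) := by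
  have hpair : Measurable fun ω : (i : ℕ) → X i => (frestrictLe n ω, ω (n + 1)) := by fun_prop
  refine (Measure.map_apply hpair hE).symm.trans ?_
  rw [← Kernel.map_frestrictLe_trajMeasure_compProd_eq_map_trajMeasure,
    Measure.compProd_apply hE]
  exact lintegral_map (Kernel.measurable_kernel_prodMk_left hE) (by fun_prop)

theorem condExp_trajMeasure_succ (n : ℕ) {E : Set (((i : Finset.Iic n) → X i) × X (n + 1))}
    (hE : MeasurableSet E) :
    (Kernel.trajMeasure μ₀ κ)[{ω | (frestrictLe n ω, ω (n + 1)) ∈ E}.indicator 1 |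
        Filtration.piLE n] =ᵐ[Kernel.trajMeasure μ₀ κ]
      fun ω => (κ n (frestrictLe n ω)).real {y | (frestrictLe n ω, y) ∈ E} := by
  set μ := Kernel.trajMeasure μ₀ κ
  have hE' : MeasurableSet {ω : (n : ℕ) → X n | (frestrictLe n ω, ω (n + 1)) ∈ E} :=
    hE.preimage (by fun_prop)
  have hκ : Measurable fun h => κ n h {y | (h, y) ∈ E} := Kernel.measurable_kernel_prodMk_left hE
  have hpast : Measurable[Filtration.piLE n] (frestrictLe (π := X) n) :=
    measurable_iff_comap_le.2 (Filtration.piLE_eq_comap_frestrictLe n).ge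
  have hmeas : Measurable[Filtration.piLE n]
      fun ω => (κ n (frestrictLe n ω)).real {y | (frestrictLe n ω, y) ∈ E} :=
    hκ.ennreal_toReal.comp hpast
  have hint : Integrable (fun ω => (κ n (frestrictLe n ω)).real {y | (frestrictLe n ω, y) ∈ E}) μ :=
    .of_bound (hmeas.mono (Filtration.piLE.le n) le_rfl).aestronglyMeasurable 1
      (.of_forall fun ω => by
        simp [abs_of_nonneg measureReal_nonneg])
  refine (ae_eq_condExp_of_forall_setIntegral_eq (Filtration.piLE.le n)
    ((integrable_const 1).indicator hE') (fun _ _ _ => hint.integrableOn) ?_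
    hmeas.aestronglyMeasurable).symm
  rw [Filtration.piLE_eq_comap_frestrictLe]
  rintro _ ⟨s, hs, rfl⟩ -
  have hsE : MeasurableSet (Prod.fst ⁻¹' s ∩ E) := (measurable_fst hs).inter hE
  have hslice : μ (frestrictLe n ⁻¹' s ∩ {ω | (frestrictLe n ω, ω (n + 1)) ∈ E}) =
      ∫⁻ ω in frestrictLe n ⁻¹' s, κ n (frestrictLe n ω) {y | (frestrictLe n ω, y) ∈ E} ∂μ := by
    rw [← lintegral_indicator (measurable_frestrictLe n hs)]
    refine (trajMeasure_apply_succ μ₀ κ n hsE).trans (lintegral_congr fun ω => ?_)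
    by_cases hω : frestrictLe n ω ∈ s <;> simp [hω]
  simp only [setIntegral_indicator hE', Pi.one_apply, setIntegral_one_eq_measureReal]
  rw [Measure.real, hslice]
  exact integral_toReal (hκ.comp (measurable_frestrictLe n)).aemeasurable
    (.of_forall fun ω => measure_lt_top _ _)

theorem ae_frequently_trajMeasure (D : (n : ℕ) → Set ((i : Finset.Iic n) → X i))
    (E : (n : ℕ) → Set (((i : Finset.Iic n) → X i) × X (n + 1))) (hE : ∀ n, MeasurableSet (E n))
    {δ : ℝ} (hδ : 0 < δ) (h : ∀ n, ∀ x ∈ D n, δ ≤ (κ n x).real {y | (x, y) ∈ E n}) :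
    ∀ᵐ ω ∂(Kernel.trajMeasure μ₀ κ), (∃ᶠ n in atTop, frestrictLe n ω ∈ D n) →
      ∃ᶠ n in atTop, (frestrictLe n ω, ω (n + 1)) ∈ E n := by
  set μ := Kernel.trajMeasure μ₀ κ
  let B : ℕ → Set ((n : ℕ) → X n)
    | 0 => ∅
    | n + 1 => {ω | (frestrictLe n ω, ω (n + 1)) ∈ E n}
  have hB : ∀ n, MeasurableSet[Filtration.piLE n] (B n)
    | 0 => @MeasurableSet.empty _ (Filtration.piLE 0)
    | n + 1 => by
      rw [Filtration.piLE_eq_comap_frestrictLe]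
      refine ⟨{x | (frestrictLe₂ n.le_succ x, x ⟨n + 1, Finset.mem_Iic.2 le_rfl⟩) ∈ E n},
        (hE n).preimage (by fun_prop), rfl⟩
  have hcond : ∀ᵐ ω ∂μ, ∀ n, (μ[(B (n + 1)).indicator 1 | Filtration.piLE n]) ω =
      (κ n (frestrictLe n ω)).real {y | (frestrictLe n ω, y) ∈ E n} :=
    ae_all_iff.2 fun n => condExp_trajMeasure_succ μ₀ κ n (hE n)
  filter_upwards [ae_mem_limsup_atTop_iff μ hB, hcond] with ω hlimsup hcond hD
  have hE_of_B : ω ∈ limsup B atTop → ∃ᶠ n in atTop, (frestrictLe n ω, ω (n + 1)) ∈ E n := by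
    rw [← limsup_nat_add B 1, mem_limsup_iff_frequently_mem]
    exact id
  refine hE_of_B (hlimsup.2 ?_)
  simp only [hcond]
  refine (not_summable_iff_tendsto_nat_atTop_of_nonneg fun n => measureReal_nonneg).1 fun hsum => ?_
  have hsmall := hsum.tendsto_atTop_zero.eventually (gt_mem_nhds hδ)
  obtain ⟨n, hnD, hn⟩ := (hD.and_eventually hsmall).exists
  exact (h n _ hnD).not_gt hn

end Trajectories

section Expectations

variable {S A : Type*} {M : MDP S A} {s t : S} {a : A}

theorem pmf_map_apply_ne_zero_iff {Y Z : Type*} (p : PMF Y) (g : Y → Z) (z : Z) :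
    p.map g z ≠ 0 ↔ ∃ y, p y ≠ 0 ∧ g y = z := by
  rw [← PMF.mem_support_iff, PMF.mem_support_map_iff]
  rfl

theorem pmf_sum_map_mul {Y Z : Type*} (p : PMF Y) (g : Y → Z) (f : Z → ℝ) (s : Finset Y)
    (t : Finset Z) (hs : ∀ y, p y ≠ 0 → y ∈ s) (ht : ∀ y, p y ≠ 0 → g y ∈ t) :
    ∑ z ∈ t, (p.map g z).toReal * f z = ∑ y ∈ s, (p y).toReal * f (g y) := by
  have hmap : ∀ z, (p.map g z).toReal = ∑ y ∈ s, if z = g y then (p y).toReal else 0 := by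
    intro z
    rw [PMF.map_apply, tsum_eq_sum (s := s), ENNReal.toReal_sum]
    · exact Finset.sum_congr rfl fun y _ => by split_ifs <;> simp
    · intro y _
      split_ifs <;> simp [PMF.apply_ne_top]
    · intro y hy
      simp [not_imp_comm.1 (hs y) hy]
  simp_rw [hmap, Finset.sum_mul]
  rw [Finset.sum_comm]
  refine Finset.sum_congr rfl fun y _ => ?_
  by_cases hy : p y = 0
  · simp [hy]
  · simp [ite_mul, ht y hy]

/-- The expectation of `f` over the successors of `s` under the action `a`. -/
def MDP.mean (M : MDP S A) (s : S) (a : A) (f : S → ℝ) : ℝ :=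
  ∑ t ∈ M.states, (M.trans s a t).toReal * f t

namespace MDP

theorem mean_mono {f g : S → ℝ} (h : ∀ t ∈ M.states, M.trans s a t ≠ 0 → f t ≤ g t) :
    M.mean s a f ≤ M.mean s a g := by
  refine Finset.sum_le_sum fun t ht => ?_
  by_cases h0 : M.trans s a t = 0
  · simp [h0]
  · exact mul_le_mul_of_nonneg_left (h t ht h0) ENNReal.toReal_nonneg

theorem mean_congr {f g : S → ℝ} (h : ∀ t ∈ M.states, M.trans s a t ≠ 0 → f t = g t) :
    M.mean s a f = M.mean s a g :=
  le_antisymm (mean_mono fun t ht h0 => (h t ht h0).le) (mean_mono fun t ht h0 => (h t ht h0).ge)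

theorem mean_nonneg {f : S → ℝ} (h : ∀ t ∈ M.states, 0 ≤ f t) : 0 ≤ M.mean s a f :=
  Finset.sum_nonneg fun t ht => mul_nonneg ENNReal.toReal_nonneg (h t ht)

theorem mean_sub (M : MDP S A) (s : S) (a : A) (f g : S → ℝ) :
    M.mean s a (fun t => f t - g t) = M.mean s a f - M.mean s a g := by
  simp only [mean, mul_sub, Finset.sum_sub_distrib]

theorem mean_neg (M : MDP S A) (s : S) (a : A) (f : S → ℝ) :
    M.mean s a (fun t => -f t) = -M.mean s a f := by
  simp only [mean, mul_neg, Finset.sum_neg_distrib]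

theorem mean_of_trans_eq_map {S' A' : Type*} {M' : MDP S' A'} {s' : S'} {a' : A'} {g : S → S'}
    (h : M'.trans s' a' = (M.trans s a).map g) (hs : ∀ t, M.trans s a t ≠ 0 → t ∈ M.states)
    (hg : ∀ t ∈ M.states, g t ∈ M'.states) (f : S' → ℝ) :
    M'.mean s' a' f = M.mean s a (fun t => f (g t)) := by
  rw [mean, h]
  exact pmf_sum_map_mul _ _ _ _ _ hs fun t ht => hg t (hs t ht)

theorem IsTerminal.eq_of_trans_ne_zero (h : M.IsTerminal s) (ha : a ∈ M.enabled s)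
    (ht : M.trans s a t ≠ 0) : t = s := by
  rw [← PMF.mem_support_iff, (PMF.apply_eq_one_iff _ _).1 (h a ha)] at ht
  exact ht

namespace IsValid

theorem mem_states (hM : M.IsValid) (hs : s ∈ M.states) (ha : a ∈ M.enabled s)
    (ht : M.trans s a t ≠ 0) : t ∈ M.states :=
  hM.support_subset s hs a ha ((PMF.mem_support_iff _ _).2 ht)

theorem eq_of_mem_enabled (hM : M.IsValid) (hs : s ∈ M.states) (ht : t ∈ M.states)
    (has : a ∈ M.enabled s) (hat : a ∈ M.enabled t) : s = t := by
  by_contra h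
  exact Finset.disjoint_left.1 (hM.enabled_disjoint s hs t ht h) has hat

theorem mean_const (hM : M.IsValid) (hs : s ∈ M.states) (ha : a ∈ M.enabled s) (c : ℝ) :
    M.mean s a (fun _ => c) = c := by
  have hsum : ∑ t ∈ M.states, M.trans s a t = 1 := by
    rw [← PMF.tsum_coe (M.trans s a), tsum_eq_sum]
    exact fun t => not_imp_comm.1 (hM.mem_states hs ha)
  rw [mean, ← Finset.sum_mul, ← ENNReal.toReal_sum fun t _ => PMF.apply_ne_top _ _, hsum,
    ENNReal.toReal_one, one_mul]

variable {f : S → ℝ} {c : ℝ}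

theorem mean_le (hM : M.IsValid) (hs : s ∈ M.states) (ha : a ∈ M.enabled s)
    (h : ∀ t ∈ M.states, M.trans s a t ≠ 0 → f t ≤ c) : M.mean s a f ≤ c :=
  (mean_mono h).trans_eq (hM.mean_const hs ha c)

theorem mean_eq (hM : M.IsValid) (hs : s ∈ M.states) (ha : a ∈ M.enabled s)
    (h : ∀ t ∈ M.states, M.trans s a t ≠ 0 → f t = c) : M.mean s a f = c :=
  (mean_congr h).trans (hM.mean_const hs ha c)

theorem mean_eq_of_isTerminal (hM : M.IsValid) (hs : s ∈ M.states) (hterm : M.IsTerminal s)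
    (ha : a ∈ M.enabled s) (f : S → ℝ) : M.mean s a f = f s :=
  hM.mean_eq hs ha fun _ _ ht => congrArg f (hterm.eq_of_trans_ne_zero ha ht)

theorem eq_of_le_mean (hM : M.IsValid) (hs : s ∈ M.states) (ha : a ∈ M.enabled s)
    (h : ∀ t ∈ M.states, M.trans s a t ≠ 0 → f t ≤ c) (hc : c ≤ M.mean s a f)
    (ht : M.trans s a t ≠ 0) : f t = c := by
  have hzero : M.mean s a (fun t => c - f t) = 0 := by
    rw [mean_sub, hM.mean_const hs ha, hc.antisymm (hM.mean_le hs ha h), sub_self]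
  have hnonneg : ∀ t ∈ M.states, 0 ≤ (M.trans s a t).toReal * (c - f t) := by
    intro t ht
    by_cases h0 : M.trans s a t = 0
    · simp [h0]
    · exact mul_nonneg ENNReal.toReal_nonneg (sub_nonneg.2 (h t ht h0))
  have hterm := (Finset.sum_eq_zero_iff_of_nonneg hnonneg).1 hzero t (hM.mem_states hs ha ht)
  have hpos : (M.trans s a t).toReal ≠ 0 := ENNReal.toReal_ne_zero.2 ⟨ht, PMF.apply_ne_top _ _⟩
  linarith [(mul_eq_zero_iff_left hpos).1 hterm]

theorem eq_of_mean_le (hM : M.IsValid) (hs : s ∈ M.states) (ha : a ∈ M.enabled s)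
    (h : ∀ t ∈ M.states, M.trans s a t ≠ 0 → c ≤ f t) (hc : M.mean s a f ≤ c)
    (ht : M.trans s a t ≠ 0) : f t = c :=
  neg_injective <| hM.eq_of_le_mean hs ha (f := fun t => -f t)
    (fun t ht h0 => neg_le_neg (h t ht h0)) (by rw [mean_neg]; exact neg_le_neg hc) ht

end IsValid

theorem best_eq_sup' (M : MDP S A) (f : S → A → ℝ) (h : (M.enabled s).Nonempty) :
    M.best f s = (M.enabled s).sup' h (f s) :=
  dif_pos h

theorem le_best (M : MDP S A) (f : S → A → ℝ) (ha : a ∈ M.enabled s) : f s a ≤ M.best f s := by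
  rw [M.best_eq_sup' f ⟨a, ha⟩]
  exact Finset.le_sup' (f s) ha

theorem exists_eq_best (M : MDP S A) (f : S → A → ℝ) (h : (M.enabled s).Nonempty) :
    ∃ a ∈ M.enabled s, f s a = M.best f s := by
  obtain ⟨a, ha, hs⟩ := Finset.exists_mem_eq_sup' h (f s)
  exact ⟨a, ha, by rw [M.best_eq_sup' f h, hs]⟩

theorem best_le (M : MDP S A) {f : S → A → ℝ} (h : (M.enabled s).Nonempty) {c : ℝ}
    (hc : ∀ a ∈ M.enabled s, f s a ≤ c) : M.best f s ≤ c := by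
  rw [M.best_eq_sup' f h]
  exact Finset.sup'_le h (f s) hc

theorem best_mono (M : MDP S A) {f g : S → A → ℝ} (h : ∀ a ∈ M.enabled s, f s a ≤ g s a) :
    M.best f s ≤ M.best g s := by
  by_cases hE : (M.enabled s).Nonempty
  · exact M.best_le hE fun a ha => (h a ha).trans (M.le_best g ha)
  · rw [best, best, dif_neg hE, dif_neg hE]

end MDP

end Expectations

section Value

open Preorder OmegaCompletePartialOrder
open scoped ENNReal Topology

variable {Y Z : Type*}

theorem lintegral_pmf_toMeasure [Countable Y] [MeasurableSpace Y] [MeasurableSingletonClass Y]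
    (p : PMF Y) (f : Y → ℝ≥0∞) : ∫⁻ y, f y ∂p.toMeasure = ∑' y, p y * f y := by
  simp_rw [lintegral_countable', PMF.toMeasure_apply_singleton _ _ (measurableSet_singleton _),
    mul_comm]

theorem ae_pmf_toMeasure_iff [MeasurableSpace Y] [DiscreteMeasurableSpace Y] {p : PMF Y}
    {P : Y → Prop} : (∀ᵐ y ∂p.toMeasure, P y) ↔ ∀ y ∈ p.support, P y := by
  rw [ae_iff, PMF.toMeasure_apply_eq_zero_iff _ (MeasurableSet.of_discrete), Set.disjoint_left]
  simp

theorem pmf_tsum_bind_mul (p : PMF Y) (q : Y → PMF Z) (f : Z → ℝ≥0∞) :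
    ∑' z, p.bind q z * f z = ∑' y, p y * ∑' z, q y z * f z := by
  simp_rw [PMF.bind_apply, ← ENNReal.tsum_mul_right, ← ENNReal.tsum_mul_left]
  rw [ENNReal.tsum_comm]
  simp_rw [mul_assoc]

theorem pmf_tsum_pure_mul (y : Y) (f : Y → ℝ≥0∞) : ∑' z, PMF.pure y z * f z = f y := by
  rw [tsum_eq_single y fun z hz => by simp [hz], PMF.pure_apply_self, one_mul]

theorem pmf_tsum_map_mul (p : PMF Y) (g : Y → Z) (f : Z → ℝ≥0∞) :
    ∑' z, p.map g z * f z = ∑' y, p y * f (g y) := by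
  simp_rw [PMF.map, pmf_tsum_bind_mul, Function.comp_apply, pmf_tsum_pure_mul]

theorem pmf_tsum_mul_mono (p : PMF Y) {f g : Y → ℝ≥0∞} (h : ∀ y ∈ p.support, f y ≤ g y) :
    ∑' y, p y * f y ≤ ∑' y, p y * g y := by
  refine ENNReal.tsum_le_tsum fun y => ?_
  by_cases hy : p y = 0
  · simp [hy]
  · gcongr
    exact h y ((PMF.mem_support_iff _ _).2 hy)

theorem pmf_tsum_mul_le (p : PMF Y) {f : Y → ℝ≥0∞} {c : ℝ≥0∞} (h : ∀ y ∈ p.support, f y ≤ c) :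
    ∑' y, p y * f y ≤ c :=
  (pmf_tsum_mul_mono p h).trans_eq (by rw [ENNReal.tsum_mul_right, PMF.tsum_coe, one_mul])

variable {S A : Type*} {M : MDP S A} {F : Set S} {s : S} {a : A}

namespace MDP

/-- The counterpart of `MDP.mean` for functions with values in `[0, ∞]`. -/
def lmean (M : MDP S A) (s : S) (a : A) (W : S → ℝ≥0∞) : ℝ≥0∞ := ∑' t, M.trans s a t * W t

theorem IsValid.lmean_eq_sum (hM : M.IsValid) (hs : s ∈ M.states) (ha : a ∈ M.enabled s)
    (W : S → ℝ≥0∞) : M.lmean s a W = ∑ t ∈ M.states, M.trans s a t * W t :=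
  tsum_eq_sum fun t ht => by rw [not_imp_comm.1 (hM.mem_states hs ha) ht, zero_mul]

theorem IsValid.toReal_lmean (hM : M.IsValid) (hs : s ∈ M.states) (ha : a ∈ M.enabled s)
    {W : S → ℝ≥0∞} (hW : ∀ t ∈ M.states, W t ≠ ∞) :
    (M.lmean s a W).toReal = M.mean s a (fun t => (W t).toReal) := by
  rw [hM.lmean_eq_sum hs ha,
    ENNReal.toReal_sum fun t ht => ENNReal.mul_ne_top (PMF.apply_ne_top _ _) (hW t ht)]
  simp_rw [ENNReal.toReal_mul, mean]

theorem IsValid.lmean_ofReal (hM : M.IsValid) (hs : s ∈ M.states) (ha : a ∈ M.enabled s)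
    {W : S → ℝ} (hW : ∀ t ∈ M.states, 0 ≤ W t) :
    M.lmean s a (fun t => ENNReal.ofReal (W t)) = ENNReal.ofReal (M.mean s a W) := by
  rw [hM.lmean_eq_sum hs ha, mean,
    ENNReal.ofReal_sum_of_nonneg fun t ht => mul_nonneg ENNReal.toReal_nonneg (hW t ht)]
  refine Finset.sum_congr rfl fun t _ => ?_
  rw [ENNReal.ofReal_mul ENNReal.toReal_nonneg, ENNReal.ofReal_toReal (PMF.apply_ne_top _ _)]

/-- The Bellman operator for the maximal probability of reaching `F`. -/
def bellman (M : MDP S A) (F : Set S) : (S → ℝ≥0∞) →o (S → ℝ≥0∞) where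
  toFun W s := if s ∈ F then 1 else ⨆ a ∈ M.enabled s, M.lmean s a W
  monotone' W W' h s := by
    dsimp only
    split_ifs
    · exact le_rfl
    · exact iSup₂_mono fun a _ => ENNReal.tsum_le_tsum fun t => by gcongr; exact h t

theorem bellman_of_mem (M : MDP S A) (hs : s ∈ F) (W : S → ℝ≥0∞) : M.bellman F W s = 1 :=
  if_pos hs

theorem bellman_of_notMem (M : MDP S A) (hs : s ∉ F) (W : S → ℝ≥0∞) :
    M.bellman F W s = ⨆ a ∈ M.enabled s, M.lmean s a W :=
  if_neg hs

theorem ωScottContinuous_bellman (M : MDP S A) (F : Set S) :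
    ωScottContinuous (M.bellman F) := by
  refine ωScottContinuous_iff_map_ωSup_of_orderHom.2 fun W => funext fun s => ?_
  have hlmean : ∀ a, M.lmean s a (ωSup W) = ⨆ n, M.lmean s a (W n) := fun a => by
    simp_rw [lmean, ENNReal.tsum_eq_iSup_sum]
    rw [iSup_comm]
    refine iSup_congr fun X => ?_
    rw [← ENNReal.finsetSum_iSup_of_monotone fun t m n hmn => by gcongr; exact W.monotone hmn t]
    exact Finset.sum_congr rfl fun t _ => ENNReal.mul_iSup ..
  change M.bellman F (ωSup W) s = ⨆ n, M.bellman F (W n) s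
  by_cases hs : s ∈ F
  · simp only [bellman_of_mem M hs, ciSup_const]
  · simp only [bellman_of_notMem M hs, hlmean]
    rw [iSup_comm]
    exact iSup_congr fun a => iSup_comm

theorem lfp_bellman_eq_iSup (M : MDP S A) (F : Set S) (s : S) :
    (M.bellman F).lfp s = ⨆ n, (M.bellman F)^[n] ⊥ s := by
  rw [fixedPoints.lfp_eq_sSup_iterate _ (M.ωScottContinuous_bellman F), iSup_apply]

theorem lmean_lfp_bellman_le (hs : s ∉ F) (ha : a ∈ M.enabled s) :
    M.lmean s a (M.bellman F).lfp ≤ (M.bellman F).lfp s := by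
  rw [← congrFun (M.bellman F).map_lfp s, bellman_of_notMem M hs]
  exact le_iSup₂ (f := fun a _ => M.lmean s a (M.bellman F).lfp) a ha

theorem exists_bellman_le_lmean [Nonempty A] (M : MDP S A) (F : Set S) (W : S → ℝ≥0∞) (s : S) :
    ∃ a, ((M.enabled s).Nonempty → a ∈ M.enabled s) ∧
      (s ∉ F → M.bellman F W s ≤ M.lmean s a W) := by
  by_cases hE : (M.enabled s).Nonempty
  · obtain ⟨a, ha, hmax⟩ := (M.enabled s).exists_max_image (fun a => M.lmean s a W) hE
    refine ⟨a, fun _ => ha, fun hs => ?_⟩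
    rw [bellman_of_notMem M hs]
    exact iSup₂_le hmax
  · refine ⟨Classical.arbitrary A, fun h => absurd h hE, fun hs => ?_⟩
    simp [bellman_of_notMem M hs, Finset.not_nonempty_iff_eq_empty.1 hE]

end MDP

/-- The paths that reach `F` with one of their states `0, …, n`. -/
def reachBy (F : Set S) (n : ℕ) : Set (ℕ → Move S A) := {ω | ∃ i ≤ n, (ω i).state ∈ F}

theorem mem_reachBy_zero {ω : ℕ → Move S A} : ω ∈ reachBy F 0 ↔ (ω 0).state ∈ F := by
  simp [reachBy]

theorem mem_reachBy_succ {n : ℕ} {ω : ℕ → Move S A} :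
    ω ∈ reachBy F (n + 1) ↔ ω ∈ reachBy F n ∨ (ω (n + 1)).state ∈ F := by
  simp [reachBy, Nat.le_add_one_iff, or_and_right, exists_or]

theorem monotone_reachBy : Monotone (reachBy (A := A) F) :=
  fun _ _ hmn _ ⟨i, hi, hF⟩ => ⟨i, hi.trans hmn, hF⟩

theorem iUnion_reachBy : ⋃ n, reachBy F n = (reach F : Set (ℕ → Move S A)) := by
  ext ω
  simp only [reachBy, reach, Set.mem_iUnion, Set.mem_ofPred_eq]
  exact ⟨fun ⟨_, i, _, hi⟩ => ⟨i, hi⟩, fun ⟨i, hi⟩ => ⟨i, i, le_rfl, hi⟩⟩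

theorem measurableSet_reachBy (F : Set S) (n : ℕ) :
    MeasurableSet (reachBy F n : Set (ℕ → Move S A)) := by
  have h : (reachBy F n : Set (ℕ → Move S A)) = ⋃ i ≤ n, (fun ω => ω i) ⁻¹' {m | m.state ∈ F} := by
    ext ω
    simp [reachBy]
  rw [h]
  exact .biUnion (Set.to_countable _) fun i _ => measurable_pi_apply i .of_discrete

variable [Countable S] [Countable A]

instance (σ : Strategy M) (s : S) : IsProbabilityMeasure (pathMeasure σ s) := by
  unfold pathMeasure
  infer_instance

theorem lintegral_kernel (σ : Strategy M) (n : ℕ) (h : (i : Finset.Iic n) → Move S A)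
    (f : Move S A → ℝ≥0∞) :
    ∫⁻ m, f m ∂(σ.kernel n h) =
      M.lmean (h ⟨n, Finset.mem_Iic.2 le_rfl⟩).state (h ⟨n, Finset.mem_Iic.2 le_rfl⟩).action
        fun t => ∑' b, σ.choose (prefixList h) t b * f ⟨t, b⟩ := by
  change ∫⁻ m, f m ∂(PMF.toMeasure _) = _
  simp_rw [lintegral_pmf_toMeasure, pmf_tsum_bind_mul, pmf_tsum_map_mul, MDP.lmean]

theorem lintegral_reachBy_zero (σ : Strategy M) (s : S) (F : Set S) (g : Move S A → ℝ≥0∞) :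
    ∫⁻ ω, (if ω ∈ reachBy F 0 then 1 else g (ω 0)) ∂(pathMeasure σ s) =
      ∑' b, σ.choose [] s b * (if s ∈ F then 1 else g ⟨s, b⟩) := by
  simp_rw [mem_reachBy_zero]
  rw [← lintegral_map (f := fun m : Move S A => if m.state ∈ F then 1 else g m)
    Measurable.of_discrete (measurable_pi_apply 0), pathMeasure, trajMeasure_map_zero,
    lintegral_pmf_toMeasure, pmf_tsum_map_mul]

theorem lintegral_reachBy_succ (σ : Strategy M) (s : S) (F : Set S) (n : ℕ)
    (g : Move S A → ℝ≥0∞) :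
    ∫⁻ ω, (if ω ∈ reachBy F (n + 1) then 1 else g (ω (n + 1))) ∂(pathMeasure σ s) =
      ∫⁻ ω, (if ω ∈ reachBy F n then 1 else M.lmean (ω n).state (ω n).action fun t =>
        ∑' b, σ.choose (prefixList (frestrictLe n ω)) t b * (if t ∈ F then 1 else g ⟨t, b⟩))
          ∂(pathMeasure σ s) := by
  have hpast : ∀ ω : ℕ → Move S A,
      ω ∈ reachBy F n ↔ ∃ i, (frestrictLe (π := fun _ => Move S A) n ω i).state ∈ F := by
    simp [reachBy]
  simp_rw [mem_reachBy_succ, hpast]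
  refine (lintegral_trajMeasure_succ (X := fun _ => Move S A)
    ((σ.choose [] s).map (Move.mk s)).toMeasure σ.kernel n
    (f := fun p => if (∃ i, (p.1 i).state ∈ F) ∨ p.2.state ∈ F then 1 else g p.2)
    Measurable.of_discrete).trans (lintegral_congr fun ω => ?_)
  by_cases hω : ∃ i, (frestrictLe (π := fun _ => Move S A) n ω i).state ∈ F
  · simp only [hω, true_or, if_true, lintegral_const, measure_univ, mul_one]
  · simp only [hω, false_or, if_false, lintegral_kernel]
    rfl

theorem ae_mem_enabled (hM : M.IsValid) (σ : Strategy M) (hs : s ∈ M.states) :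
    ∀ᵐ ω ∂(pathMeasure σ s), ∀ n,
      (ω n).state ∈ M.states ∧ (ω n).action ∈ M.enabled (ω n).state := by
  refine ae_all_iff.2 fun n => ?_
  induction n with
  | zero =>
    refine ae_trajMeasure_zero (X := fun _ => Move S A) _ _
      (p := fun m : Move S A => m.state ∈ M.states ∧ m.action ∈ M.enabled m.state)
      (ae_pmf_toMeasure_iff.2 fun m hm => ?_)
    obtain ⟨b, hb, rfl⟩ := (PMF.mem_support_map_iff _ _ _).1 hm
    exact ⟨hs, σ.support_subset _ _ hs hb⟩
  | succ n ih =>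
    refine (ae_trajMeasure_succ_iff (X := fun _ => Move S A) _ σ.kernel n
      (E := {p | p.2.state ∈ M.states ∧ p.2.action ∈ M.enabled p.2.state}) .of_discrete).2 ?_
    filter_upwards [ih] with ω hω
    refine ae_pmf_toMeasure_iff.2 fun m hm => ?_
    obtain ⟨t, ht, hm⟩ := (PMF.mem_support_bind_iff _ _ _).1 hm
    obtain ⟨b, hb, rfl⟩ := (PMF.mem_support_map_iff _ _ _).1 hm
    have hts := hM.support_subset _ hω.1 _ hω.2 ht
    exact ⟨hts, σ.support_subset _ _ hts hb⟩

theorem pathMeasure_reach_le (hM : M.IsValid) {W : S → ℝ≥0∞}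
    (hF : ∀ s ∈ M.states, s ∈ F → 1 ≤ W s)
    (hW : ∀ s ∈ M.states, s ∉ F → ∀ a ∈ M.enabled s, M.lmean s a W ≤ W s)
    (σ : Strategy M) (hs : s ∈ M.states) : pathMeasure σ s (reach F) ≤ W s := by
  have hchoose : ∀ t ∈ M.states, ∀ w,
      ∑' b, σ.choose w t b * (if t ∈ F then 1 else M.lmean t b W) ≤ W t := by
    refine fun t ht w => pmf_tsum_mul_le _ fun b hb => ?_
    split_ifs with htF
    · exact hF t ht htF
    · exact hW t ht htF b (σ.support_subset w t ht hb)
  have hsuper : ∀ n, ∫⁻ ω, (if ω ∈ reachBy F n then 1 else M.lmean (ω n).state (ω n).action W)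
      ∂(pathMeasure σ s) ≤ W s := by
    intro n
    induction n with
    | zero =>
      rw [lintegral_reachBy_zero σ s F fun m => M.lmean m.state m.action W]
      exact hchoose s hs []
    | succ n ih =>
      rw [lintegral_reachBy_succ σ s F n fun m => M.lmean m.state m.action W]
      refine le_trans (lintegral_mono_ae ?_) ih
      filter_upwards [ae_mem_enabled hM σ hs] with ω hω
      split_ifs
      · exact le_rfl
      · exact pmf_tsum_mul_mono _ fun t ht =>
          hchoose t (hM.support_subset _ (hω n).1 _ (hω n).2 ht) _
  rw [← iUnion_reachBy, monotone_reachBy.measure_iUnion]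
  refine iSup_le fun n => ?_
  rw [← lintegral_indicator_one (measurableSet_reachBy F n)]
  refine (lintegral_mono fun ω => ?_).trans (hsuper n)
  simp only [Set.indicator_apply, Pi.one_apply]
  split_ifs <;> simp

omit [Countable S] [Countable A] in
theorem exists_strategy_bellman_le (hM : M.IsValid) (F : Set S) (W : ℕ → S → ℝ≥0∞) :
    ∃ σ : Strategy M, ∀ w t, M.bellman F (W w.length) t ≤
      ∑' b, σ.choose w t b * (if t ∈ F then 1 else M.lmean t b (W w.length)) := by
  have : Nonempty A := ⟨(hM.enabled_nonempty _ hM.start_mem).choose⟩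
  choose opt hopt_mem hopt using fun n => M.exists_bellman_le_lmean F (W n)
  refine ⟨⟨fun w t => PMF.pure (opt w.length t), fun w t ht => ?_⟩, fun w t => ?_⟩
  · rw [PMF.support_pure, Set.singleton_subset_iff]
    exact hopt_mem _ t (hM.enabled_nonempty t ht)
  · rw [pmf_tsum_pure_mul]
    split_ifs with ht
    · exact (M.bellman_of_mem ht _).le
    · exact hopt _ _ ht

theorem exists_iterate_bellman_le_pathMeasure (hM : M.IsValid) (F : Set S) (N : ℕ) (s : S) :
    ∃ σ : Strategy M, (M.bellman F)^[N + 1] ⊥ s ≤ pathMeasure σ s (reach F) := by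
  obtain ⟨σ, hσ⟩ := exists_strategy_bellman_le hM F fun n => (M.bellman F)^[N - n] ⊥
  refine ⟨σ, ?_⟩
  have hsub : ∀ n ≤ N, (M.bellman F)^[N + 1] ⊥ s ≤ ∫⁻ ω, (if ω ∈ reachBy F n then 1 else
      M.lmean (ω n).state (ω n).action ((M.bellman F)^[N - n] ⊥)) ∂(pathMeasure σ s) := by
    intro n
    induction n with
    | zero =>
      intro _
      rw [lintegral_reachBy_zero σ s F fun m =>
        M.lmean m.state m.action ((M.bellman F)^[N - 0] ⊥), Function.iterate_succ_apply']
      exact hσ [] s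
    | succ n ih =>
      intro hn
      rw [lintegral_reachBy_succ σ s F n fun m =>
        M.lmean m.state m.action ((M.bellman F)^[N - (n + 1)] ⊥)]
      refine (ih (by lia)).trans (lintegral_mono fun ω => ?_)
      dsimp only
      split_ifs
      · exact le_rfl
      · refine pmf_tsum_mul_mono _ fun t _ => ?_
        rw [show N - n = N - (n + 1) + 1 by lia, Function.iterate_succ_apply']
        simpa [prefixList] using hσ (prefixList (frestrictLe n ω)) t
  calc (M.bellman F)^[N + 1] ⊥ s
      ≤ ∫⁻ ω, (reachBy F N).indicator 1 ω ∂(pathMeasure σ s) := by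
        simpa [MDP.lmean, Set.indicator_apply] using hsub N le_rfl
    _ = pathMeasure σ s (reachBy F N) := lintegral_indicator_one (measurableSet_reachBy F N)
    _ ≤ pathMeasure σ s (reach F) := measure_mono (iUnion_reachBy ▸ Set.subset_iUnion _ N)

theorem iSup_pathMeasure_reach (hM : M.IsValid) (F : Set S) (hs : s ∈ M.states) :
    ⨆ σ : Strategy M, pathMeasure σ s (reach F) = (M.bellman F).lfp s := by
  refine le_antisymm (iSup_le fun σ => ?_) ?_
  · refine pathMeasure_reach_le hM (fun t _ ht => ?_)
      (fun t _ ht a ha => MDP.lmean_lfp_bellman_le ht ha) σ hs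
    rw [← (M.bellman F).map_lfp, MDP.bellman_of_mem M ht]
  · rw [MDP.lfp_bellman_eq_iSup]
    refine iSup_le fun n => ?_
    rcases n with - | n
    · exact bot_le
    · obtain ⟨σ, hσ⟩ := exists_iterate_bellman_le_pathMeasure hM F n s
      exact hσ.trans (le_iSup (fun σ : Strategy M => pathMeasure σ s (reach F)) σ)

theorem value_nonneg (M : MDP S A) (F : Set S) (s : S) : 0 ≤ value M F s := ENNReal.toReal_nonneg

theorem iSup_pathMeasure_reach_le_one (M : MDP S A) (F : Set S) (s : S) :
    ⨆ σ : Strategy M, pathMeasure σ s (reach F) ≤ 1 :=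
  iSup_le fun _ => prob_le_one

theorem value_le_one (M : MDP S A) (F : Set S) (s : S) : value M F s ≤ 1 :=
  ENNReal.toReal_le_of_le_ofReal zero_le_one
    (by simpa using iSup_pathMeasure_reach_le_one M F s)

theorem value_of_mem (hM : M.IsValid) (hs : s ∈ M.states) (hsF : s ∈ F) : value M F s = 1 := by
  rw [value, iSup_pathMeasure_reach hM F hs, ← (M.bellman F).map_lfp, MDP.bellman_of_mem M hsF,
    ENNReal.toReal_one]

theorem actionValue_le_value (hM : M.IsValid) (F : Set S) (hs : s ∈ M.states)
    (ha : a ∈ M.enabled s) : actionValue M F s a ≤ value M F s := by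
  by_cases hsF : s ∈ F
  · rw [value_of_mem hM hs hsF]
    exact hM.mean_le hs ha fun t _ _ => value_le_one M F t
  · have hfinite : ∀ t ∈ M.states, (M.bellman F).lfp t ≠ ∞ := fun t ht => by
      rw [← iSup_pathMeasure_reach hM F ht]
      exact ne_top_of_le_ne_top ENNReal.one_ne_top (iSup_pathMeasure_reach_le_one M F t)
    calc actionValue M F s a = M.mean s a fun t => ((M.bellman F).lfp t).toReal :=
          MDP.mean_congr fun t ht _ => by rw [value, iSup_pathMeasure_reach hM F ht]
      _ = (M.lmean s a (M.bellman F).lfp).toReal := (hM.toReal_lmean hs ha hfinite).symm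
      _ ≤ ((M.bellman F).lfp s).toReal :=
          ENNReal.toReal_mono (hfinite s hs) (MDP.lmean_lfp_bellman_le hsF ha)
      _ = value M F s := by rw [value, iSup_pathMeasure_reach hM F hs]

theorem value_le_of_supersolution (hM : M.IsValid) {W : S → ℝ} (h0 : ∀ s ∈ M.states, 0 ≤ W s)
    (hF : ∀ s ∈ M.states, s ∈ F → 1 ≤ W s)
    (hW : ∀ s ∈ M.states, s ∉ F → ∀ a ∈ M.enabled s, M.mean s a W ≤ W s)
    (hs : s ∈ M.states) : value M F s ≤ W s := by
  refine ENNReal.toReal_le_of_le_ofReal (h0 s hs) (iSup_le fun σ => ?_)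
  refine pathMeasure_reach_le (W := fun t => ENNReal.ofReal (W t)) hM (fun t ht htF => ?_)
    (fun t ht htF a ha => ?_) σ hs
  · simpa using hF t ht htF
  · rw [hM.lmean_ofReal ht ha h0]
    exact ENNReal.ofReal_le_ofReal (hW t ht htF a ha)

theorem value_le_sub_of_closed (hM : M.IsValid) {R : Set S} (hRF : ∀ s ∈ R, s ∉ F) {v δ : ℝ}
    (hv : ∀ s ∈ R, value M F s = v) (hδ : 0 ≤ δ) (hδv : δ ≤ v)
    (hstep : ∀ s ∈ R, s ∈ M.states → ∀ a ∈ M.enabled s,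
      (∀ t, M.trans s a t ≠ 0 → t ∈ R) ∨ actionValue M F s a ≤ v - δ)
    (hs : s ∈ M.states) (hsR : s ∈ R) : v ≤ v - δ := by
  let W : S → ℝ := fun x => if x ∈ R then v - δ else value M F x
  have hWR : ∀ x ∈ R, W x = v - δ := fun x hx => if_pos hx
  have hWRc : ∀ x ∉ R, W x = value M F x := fun x hx => if_neg hx
  have hW_le : ∀ x, W x ≤ value M F x := fun x => by
    by_cases hx : x ∈ R
    · linarith [hWR x hx, hv x hx]
    · exact (hWRc x hx).le
  have hle : value M F s ≤ W s := by
    refine value_le_of_supersolution hM (fun x _ => ?_) (fun x hx hxF => ?_)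
      (fun x hx _ a ha => ?_) hs
    · by_cases hxR : x ∈ R
      · linarith [hWR x hxR]
      · exact (value_nonneg M F x).trans_eq (hWRc x hxR).symm
    · rw [hWRc x fun hxR => hRF x hxR hxF, value_of_mem hM hx hxF]
    · have hmean : M.mean x a W ≤ actionValue M F x a := MDP.mean_mono fun t _ _ => hW_le t
      by_cases hxR : x ∈ R
      · rw [hWR x hxR]
        rcases hstep x hxR hx a ha with hstay | hloss
        · exact hM.mean_le hx ha fun t _ ht => (hWR t (hstay t ht)).le
        · exact hmean.trans hloss
      · exact (hmean.trans (actionValue_le_value hM F hx ha)).trans_eq (hWRc x hxR).symm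
  rwa [hv s hsR, hWR s hsR] at hle

theorem value_eq_zero_of_closed (hM : M.IsValid) {R : Set S} (hRF : ∀ s ∈ R, s ∉ F) {v : ℝ}
    (hv : ∀ s ∈ R, value M F s = v)
    (hstep : ∀ s ∈ R, s ∈ M.states → ∀ a ∈ M.enabled s,
      (∀ t, M.trans s a t ≠ 0 → t ∈ R) ∨ actionValue M F s a < v)
    (hs : s ∈ M.states) (hsR : s ∈ R) : v = 0 := by
  by_contra hv0
  have hv_pos : 0 < v := ((value_nonneg M F s).trans_eq (hv s hsR)).lt_of_ne' hv0
  have hsmall : ∀ c : ℝ, 0 < c → ∀ᶠ δ in 𝓝[>] (0 : ℝ), δ ≤ c := fun c hc =>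
    nhdsWithin_le_nhds (Iic_mem_nhds hc)
  have hloss : ∀ᶠ δ in 𝓝[>] (0 : ℝ), ∀ s ∈ M.states, ∀ a ∈ M.enabled s,
      actionValue M F s a < v → actionValue M F s a ≤ v - δ := by
    simp_rw [Filter.eventually_all_finset]
    refine fun s _ a _ => Filter.eventually_imp_distrib_left.2 fun hlt => ?_
    exact (hsmall _ (sub_pos.2 hlt)).mono fun δ hδ => by linarith
  obtain ⟨δ, hδ, hδv, hδ_pos⟩ := (hloss.and ((hsmall v hv_pos).and self_mem_nhdsWithin)).exists
  have hδ_pos : 0 < δ := hδ_pos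
  have := value_le_sub_of_closed hM hRF hv hδ_pos.le hδv
    (fun s hsR hs a ha => (hstep s hsR hs a ha).imp_right (hδ s hs a ha)) hs hsR
  linarith

theorem value_eq_zero_of_isTerminal (hM : M.IsValid) (hs : s ∈ M.states) (hterm : M.IsTerminal s)
    (hsF : s ∉ F) : value M F s = 0 := by
  refine value_eq_zero_of_closed hM (R := {s}) (fun _ ht => ht ▸ hsF) (fun _ ht => ht ▸ rfl)
    (fun t ht _ a ha => Or.inl ?_) hs rfl
  obtain rfl := ht
  exact fun _ => hterm.eq_of_trans_ne_zero ha

end Value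

section Quotient

variable {S A : Type*}

theorem MDP.IsEC.reflTransGen {M : MDP S A} {R : Finset S} {B : Finset A} (hR : M.IsEC R B)
    {r : S → S → Prop} (hr : ∀ x ∈ R, ∀ y ∈ R, ∀ a ∈ B, a ∈ M.enabled x → M.trans x a y ≠ 0 → r x y)
    {s t : S} (hs : s ∈ R) (ht : t ∈ R) : Relation.ReflTransGen r s t := by
  have hpath : ∀ t, Relation.ReflTransGen
      (fun x y => ∃ a ∈ B, a ∈ M.enabled x ∧ 0 < M.trans x a y) s t →
      t ∈ R ∧ Relation.ReflTransGen r s t := by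
    intro t ht
    induction ht with
    | refl => exact ⟨hs, .refl⟩
    | tail _ hstep ih =>
      obtain ⟨a, haB, ha, hpos⟩ := hstep
      have hy := hR.closed _ ih.1 a haB ha ((PMF.mem_support_iff _ _).2 hpos.ne')
      exact ⟨hy, ih.2.tail (hr _ ih.1 _ hy a haB ha hpos.ne')⟩
  exact (hpath t (hR.connected s hs t ht)).2

/-- A superharmonic function is constant on an end component: it is minimal at some state, and
minimality spreads along the actions of the end component. -/
theorem MDP.IsEC.eq_of_mean_le {M : MDP S A} (hM : M.IsValid) {R : Finset S} {B : Finset A}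
    (hR : M.IsEC R B) {f : S → ℝ} (hf : ∀ s ∈ R, ∀ a ∈ M.enabled s, M.mean s a f ≤ f s) {s t : S}
    (hs : s ∈ R) (ht : t ∈ R) : f s = f t := by
  obtain ⟨x, hx, hmin⟩ := R.exists_min_image f ⟨s, hs⟩
  have hspread : ∀ y ∈ R, ∀ z ∈ R, ∀ a ∈ B, a ∈ M.enabled y → M.trans y a z ≠ 0 →
      f y = f x → f z = f x := fun y hy z _ a haB ha hz hyx =>
    hM.eq_of_mean_le (hR.states_subset hy) ha
      (fun t _ ht => hmin t (hR.closed y hy a haB ha ((PMF.mem_support_iff _ _).2 ht)))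
      ((hf y hy a ha).trans_eq hyx) hz
  have hconst : ∀ y ∈ R, f y = f x := by
    intro y hy
    have hpath := hR.reflTransGen hspread hx hy
    clear hy
    induction hpath with
    | refl => rfl
    | tail _ hstep ih => exact hstep ih
  rw [hconst s hs, hconst t ht]

variable [Countable S] [Countable A] {M M' : MDP S A} {F : Set S} {one zero s x : S} {a : A}
  {proj : S → S}

/-- The standing assumptions on the MDP, the target set and the two terminal states. -/
structure Setting (M : MDP S A) (F : Set S) (one zero : S) : Prop where
  valid : M.IsValid
  one_mem : one ∈ M.states
  zero_mem : zero ∈ M.states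
  one_terminal : M.IsTerminal one
  zero_terminal : M.IsTerminal zero
  one_target : one ∈ F
  zero_target : zero ∉ F
  target : ∀ s ∈ M.states, s ∈ F → ∃ a ∈ M.enabled s, actionValue M F s a = 1

namespace Setting

theorem ne (hS : Setting M F one zero) : one ≠ zero :=
  ne_of_mem_of_not_mem hS.one_target hS.zero_target

theorem value_one (hS : Setting M F one zero) : value M F one = 1 :=
  value_of_mem hS.valid hS.one_mem hS.one_target

theorem value_zero (hS : Setting M F one zero) : value M F zero = 0 :=
  value_eq_zero_of_isTerminal hS.valid hS.zero_mem hS.zero_terminal hS.zero_target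

end Setting

/-- `M'` arises from `M` by successively collapsing end components; `proj` sends a state of `M` to
the state of `M'` that it has been merged into. An action of `M` may disappear in `M'` only if it
has become a self-loop at a state that is not a target, or if it belongs to a state that has been
merged into `one`. -/
structure IsQuotient (M : MDP S A) (F : Set S) (one zero : S) (M' : MDP S A) (proj : S → S) :
    Prop where
  states_subset : M'.states ⊆ M.states
  one_mem : one ∈ M'.states
  zero_mem : zero ∈ M'.states
  proj_mem : ∀ s ∈ M.states, proj s ∈ M'.states
  proj_self : ∀ s ∈ M'.states, proj s = s
  start_eq : M'.start = proj M.start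
  exists_owner : ∀ s ∈ M'.states, ∀ a ∈ M'.enabled s, ∃ x ∈ M.states, proj x = s ∧
    a ∈ M.enabled x ∧ M'.trans s a = (M.trans x a).map proj
  removed : ∀ x ∈ M.states, ∀ a ∈ M.enabled x, a ∈ M'.enabled (proj x) ∨
    ((∀ t, M.trans x a t ≠ 0 → proj t = proj x) ∧ proj x ∉ F) ∨ proj x = one
  value_proj : ∀ x ∈ M.states, value M F (proj x) = value M F x
  target : ∀ f ∈ M.states, f ∈ F → proj f = f ∨ proj f = one
  enabled_nonempty : ∀ s ∈ M'.states, (M'.enabled s).Nonempty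
  one_enabled : ∀ a ∈ M'.enabled one, a ∈ M.enabled one
  zero_enabled : ∀ a ∈ M'.enabled zero, a ∈ M.enabled zero

namespace IsQuotient

theorem refl (hS : Setting M F one zero) : IsQuotient M F one zero M id where
  states_subset := subset_rfl
  one_mem := hS.one_mem
  zero_mem := hS.zero_mem
  proj_mem := fun _ h => h
  proj_self := fun _ _ => rfl
  start_eq := rfl
  exists_owner := fun s hs _ ha => ⟨s, hs, rfl, ha, (PMF.map_id _).symm⟩
  removed := fun _ _ _ h => Or.inl h
  value_proj := fun _ _ => rfl
  target := fun _ _ _ => Or.inl rfl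
  enabled_nonempty := hS.valid.enabled_nonempty
  one_enabled := fun _ h => h
  zero_enabled := fun _ h => h

theorem isValid (hM : M.IsValid) (hq : IsQuotient M F one zero M' proj) : M'.IsValid where
  start_mem := hq.start_eq ▸ hq.proj_mem _ hM.start_mem
  enabled_nonempty := hq.enabled_nonempty
  support_subset := by
    intro s hs a ha t ht
    obtain ⟨x, hx, rfl, hax, htrans⟩ := hq.exists_owner s hs a ha
    rw [htrans, PMF.mem_support_map_iff] at ht
    obtain ⟨t, ht, rfl⟩ := ht
    exact hq.proj_mem _ (hM.support_subset x hx a hax ht)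
  enabled_disjoint := by
    intro s hs t ht hst
    rw [Finset.disjoint_left]
    intro a has hat
    obtain ⟨x, hx, rfl, hax, -⟩ := hq.exists_owner s hs a has
    obtain ⟨y, hy, rfl, hay, -⟩ := hq.exists_owner t ht a hat
    exact hst (congrArg proj (hM.eq_of_mem_enabled hx hy hax hay))

theorem trans_eq (hM : M.IsValid) (hq : IsQuotient M F one zero M' proj) (hx : x ∈ M.states)
    (ha : a ∈ M.enabled x) (ha' : a ∈ M'.enabled (proj x)) :
    M'.trans (proj x) a = (M.trans x a).map proj := by
  obtain ⟨y, hy, hyx, hay, htrans⟩ := hq.exists_owner _ (hq.proj_mem x hx) a ha'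
  rw [hM.eq_of_mem_enabled hx hy ha hay, ← htrans, hyx]

theorem mean_eq (hM : M.IsValid) (hq : IsQuotient M F one zero M' proj) (hx : x ∈ M.states)
    (ha : a ∈ M.enabled x) (ha' : a ∈ M'.enabled (proj x)) (f : S → ℝ) :
    M'.mean (proj x) a f = M.mean x a (fun t => f (proj t)) :=
  MDP.mean_of_trans_eq_map (hq.trans_eq hM hx ha ha') (fun _ => hM.mem_states hx ha) hq.proj_mem f

theorem mean_value_eq (hM : M.IsValid) (hq : IsQuotient M F one zero M' proj) (hx : x ∈ M.states)
    (ha : a ∈ M.enabled x) (ha' : a ∈ M'.enabled (proj x)) :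
    M'.mean (proj x) a (value M F) = actionValue M F x a :=
  (hq.mean_eq hM hx ha ha' _).trans (MDP.mean_congr fun t ht _ => hq.value_proj t ht)

theorem mean_value_le (hM : M.IsValid) (hq : IsQuotient M F one zero M' proj)
    (hs : s ∈ M'.states) (ha : a ∈ M'.enabled s) :
    M'.mean s a (value M F) ≤ value M F s := by
  obtain ⟨x, hx, rfl, hax, -⟩ := hq.exists_owner s hs a ha
  rw [hq.mean_value_eq hM hx hax ha, hq.value_proj x hx]
  exact actionValue_le_value hM F hx hax

theorem isTerminal_of_enabled_subset (hM : M.IsValid) (hq : IsQuotient M F one zero M' proj)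
    (hs : s ∈ M'.states) (hsub : ∀ a ∈ M'.enabled s, a ∈ M.enabled s) (hterm : M.IsTerminal s) :
    M'.IsTerminal s := by
  intro a ha
  have hproj := hq.proj_self s hs
  have htrans := hq.trans_eq hM (hq.states_subset hs) (hsub a ha) (by rwa [hproj])
  have hpure : M.trans s a = PMF.pure s := by
    ext t
    by_cases ht : t = s
    · rw [ht, hterm a (hsub a ha), PMF.pure_apply_self]
    · rw [PMF.pure_apply_of_ne _ _ ht]
      exact not_not.1 fun h => ht (hterm.eq_of_trans_ne_zero (hsub a ha) h)
  rw [hproj, hpure, PMF.pure_map, hproj] at htrans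
  rw [htrans, PMF.pure_apply_self]

theorem one_isTerminal (hS : Setting M F one zero) (hq : IsQuotient M F one zero M' proj) :
    M'.IsTerminal one :=
  hq.isTerminal_of_enabled_subset hS.valid hq.one_mem hq.one_enabled hS.one_terminal

theorem zero_isTerminal (hS : Setting M F one zero) (hq : IsQuotient M F one zero M' proj) :
    M'.IsTerminal zero :=
  hq.isTerminal_of_enabled_subset hS.valid hq.zero_mem hq.zero_enabled hS.zero_terminal

theorem value_eq_zero_of_closed (hM : M.IsValid) (hq : IsQuotient M F one zero M' proj)
    {R : Finset S} (hR : R ⊆ M'.states) (hone : one ∉ R) (hRF : ∀ s ∈ R, s ∉ F) {v : ℝ}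
    (hv : ∀ s ∈ R, value M F s = v)
    (hstep : ∀ s ∈ R, ∀ a ∈ M'.enabled s,
      (∀ t, M'.trans s a t ≠ 0 → t ∈ R) ∨ M'.mean s a (value M F) < v)
    (hs : s ∈ R) : v = 0 := by
  have hsM := hq.states_subset (hR hs)
  refine OBRTDP.value_eq_zero_of_closed hM (F := F) (R := {x | x ∈ M.states ∧ proj x ∈ R})
    ?_ ?_ ?_ hsM ⟨hsM, (hq.proj_self s (hR hs)).symm ▸ hs⟩
  · rintro x ⟨hx, hxR⟩ hxF
    rcases hq.target x hx hxF with h | h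
    · exact hRF _ hxR (h.symm ▸ hxF)
    · exact hone (h ▸ hxR)
  · rintro x ⟨hx, hxR⟩
    rw [← hq.value_proj x hx, hv _ hxR]
  · rintro x ⟨-, hxR⟩ hx a ha
    rcases hq.removed x hx a ha with ha' | ⟨hloop, -⟩ | h
    · rw [← hq.mean_value_eq hM hx ha ha']
      refine (hstep _ hxR a ha').imp_left fun h t ht => ⟨hM.mem_states hx ha ht, h _ ?_⟩
      rw [hq.trans_eq hM hx ha ha', pmf_map_apply_ne_zero_iff]
      exact ⟨t, ht, rfl⟩
    · exact Or.inl fun t ht => ⟨hM.mem_states hx ha ht, (hloop t ht).symm ▸ hxR⟩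
    · exact absurd (h ▸ hxR) hone

theorem exists_mean_value_eq_of_mem (hS : Setting M F one zero)
    (hq : IsQuotient M F one zero M' proj) (hs : s ∈ M'.states) (hsF : s ∈ F) (hone : s ≠ one) :
    ∃ a ∈ M'.enabled s, M'.mean s a (value M F) = value M F s := by
  have hsM := hq.states_subset hs
  have hproj := hq.proj_self s hs
  obtain ⟨a, ha, hav⟩ := hS.target s hsM hsF
  rcases hq.removed s hsM a ha with ha' | ⟨-, h⟩ | h
  · have hmean := hq.mean_value_eq hS.valid hsM ha ha'
    rw [hproj] at ha' hmean
    exact ⟨a, ha', by rw [hmean, hav, value_of_mem hS.valid hsM hsF]⟩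
  · exact absurd (hproj.symm ▸ hsF) h
  · exact absurd (hproj ▸ h) hone

/-- The Bellman equation in a quotient. Away from the targets, a state at which every action loses
value has value zero, and then no action can lose value. -/
theorem exists_mean_value_eq (hS : Setting M F one zero) (hq : IsQuotient M F one zero M' proj)
    (hs : s ∈ M'.states) : ∃ a ∈ M'.enabled s, M'.mean s a (value M F) = value M F s := by
  obtain ⟨b, hb⟩ := hq.enabled_nonempty s hs
  by_cases hone : s = one
  · subst hone
    exact ⟨b, hb, (hq.isValid hS.valid).mean_eq_of_isTerminal hs (hq.one_isTerminal hS) hb _⟩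
  by_cases hsF : s ∈ F
  · exact hq.exists_mean_value_eq_of_mem hS hs hsF hone
  by_contra! hne
  have hlt : ∀ a ∈ M'.enabled s, M'.mean s a (value M F) < value M F s := fun a ha =>
    (hq.mean_value_le hS.valid hs ha).lt_of_ne (hne a ha)
  have hzero : value M F s = 0 :=
    hq.value_eq_zero_of_closed hS.valid (R := {s}) (Finset.singleton_subset_iff.2 hs)
      (by simpa using Ne.symm hone) (by simpa using hsF) (by simp)
      (by simpa using fun a ha => Or.inr (hlt a ha)) (Finset.mem_singleton_self s)
  have hnonneg := MDP.mean_nonneg (s := s) (a := b) fun t (_ : t ∈ M'.states) =>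
    value_nonneg M F t
  linarith [hlt b hb]

end IsQuotient

end Quotient

section Soundness

variable {S A : Type*}

namespace MDP

variable {M : MDP S A} {f : S → A → ℝ} {one s : S} {a : A}

theorem best_of_forall_eq (M : MDP S A) (h : (M.enabled s).Nonempty) {c : ℝ}
    (hc : ∀ a ∈ M.enabled s, f s a = c) : M.best f s = c := by
  obtain ⟨a, ha, hs⟩ := M.exists_eq_best f h
  rw [← hs, hc a ha]

theorem backup_apply (M : MDP S A) (f : S → A → ℝ) (s : S) (a : A) (x : S) (c : A) :
    M.backup f s a x c = if x = s ∧ c = a then M.mean s a (M.best f) else f x c := by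
  simp only [backup, mean]
  by_cases hx : x = s
  · subst hx
    by_cases hc : c = a
    · subst hc
      simp
    · simp [hc]
  · simp [hx]

theorem backup_self (M : MDP S A) (f : S → A → ℝ) (s : S) (a : A) :
    M.backup f s a s a = M.mean s a (M.best f) := by
  rw [backup_apply, if_pos ⟨rfl, rfl⟩]

/-- A function on state-action pairs that does not increase when a pair is backed up; the upper
bounds of the algorithm have this property. -/
def IsSuperharmonic (M : MDP S A) (f : S → A → ℝ) : Prop :=
  ∀ s ∈ M.states, ∀ a ∈ M.enabled s, M.mean s a (M.best f) ≤ f s a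

/-- A function on state-action pairs that does not decrease when a pair is backed up; the lower
bounds of the algorithm have this property. -/
def IsSubharmonic (M : MDP S A) (f : S → A → ℝ) : Prop :=
  ∀ s ∈ M.states, ∀ a ∈ M.enabled s, f s a ≤ M.mean s a (M.best f)

/-- A positive maximum of `best f` on a set of states without `one` is attained by an action that
may leave the set. For a lower bound `f` this excludes cycles of states that owe their values to
one another. -/
def IsJustified (M : MDP S A) (one : S) (f : S → A → ℝ) : Prop :=
  ∀ X ⊆ M.states, one ∉ X → ∀ l : ℝ, 0 < l → (∀ x ∈ X, M.best f x ≤ l) →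
    (∃ x ∈ X, M.best f x = l) →
    ∃ x ∈ X, ∃ a ∈ M.enabled x, f x a = l ∧ ∃ t, M.trans x a t ≠ 0 ∧ t ∉ X

theorem IsValid.isSuperharmonic_of_mean_le (hM : M.IsValid) {g : S → ℝ}
    (hg : ∀ s ∈ M.states, ∀ a ∈ M.enabled s, M.mean s a g ≤ g s) :
    M.IsSuperharmonic fun s _ => g s := by
  intro s hs a ha
  have hbest : ∀ t ∈ M.states, M.best (fun s _ => g s) t = g t := fun t ht =>
    M.best_of_forall_eq (hM.enabled_nonempty t ht) fun _ _ => rfl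
  rw [mean_congr fun t ht _ => hbest t ht]
  exact hg s hs a ha

theorem IsValid.isSubharmonic_of_le_mean (hM : M.IsValid) {g : S → ℝ}
    (hg : ∀ s ∈ M.states, ∀ a ∈ M.enabled s, g s ≤ M.mean s a g) :
    M.IsSubharmonic fun s _ => g s := by
  intro s hs a ha
  have hbest : ∀ t ∈ M.states, M.best (fun s _ => g s) t = g t := fun t ht =>
    M.best_of_forall_eq (hM.enabled_nonempty t ht) fun _ _ => rfl
  rw [mean_congr fun t ht _ => hbest t ht]
  exact hg s hs a ha

theorem IsSuperharmonic.backup_le (hf : M.IsSuperharmonic f) {x : S} (hx : x ∈ M.states) {c : A}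
    (hc : c ∈ M.enabled x) : M.backup f s a x c ≤ f x c := by
  rw [backup_apply]
  split_ifs with h
  · obtain ⟨rfl, rfl⟩ := h
    exact hf x hx c hc
  · exact le_rfl

theorem IsSubharmonic.le_backup (hf : M.IsSubharmonic f) {x : S} (hx : x ∈ M.states) {c : A}
    (hc : c ∈ M.enabled x) : f x c ≤ M.backup f s a x c := by
  rw [backup_apply]
  split_ifs with h
  · obtain ⟨rfl, rfl⟩ := h
    exact hf x hx c hc
  · exact le_rfl

theorem IsSuperharmonic.backup (hf : M.IsSuperharmonic f) (s : S) (a : A) :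
    M.IsSuperharmonic (M.backup f s a) := by
  intro x hx c hc
  have hmean : M.mean x c (M.best (M.backup f s a)) ≤ M.mean x c (M.best f) :=
    mean_mono fun t ht _ => M.best_mono fun _ => hf.backup_le ht
  rw [M.backup_apply f s a x c]
  split_ifs with h
  · obtain ⟨rfl, rfl⟩ := h
    exact hmean
  · exact hmean.trans (hf x hx c hc)

theorem IsSubharmonic.backup (hf : M.IsSubharmonic f) (s : S) (a : A) :
    M.IsSubharmonic (M.backup f s a) := by
  intro x hx c hc
  have hmean : M.mean x c (M.best f) ≤ M.mean x c (M.best (M.backup f s a)) :=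
    mean_mono fun t ht _ => M.best_mono fun _ => hf.le_backup ht
  rw [M.backup_apply f s a x c]
  split_ifs with h
  · obtain ⟨rfl, rfl⟩ := h
    exact hmean
  · exact (hf x hx c hc).trans hmean

/-- If the maximum on `X` is new, it is attained at the pair that has been backed up, and all the
successors of this pair have a value that was not attained in `X` before. -/
theorem IsJustified.backup (hM : M.IsValid) (hsub : M.IsSubharmonic f) (hf : M.IsJustified one f)
    (s : S) (a : A) : M.IsJustified one (M.backup f s a) := by
  rintro X hX hone l hl hle ⟨x, hx, hxl⟩
  have hbest : ∀ y ∈ X, M.best f y ≤ l := fun y hy =>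
    (M.best_mono fun _ => hsub.le_backup (hX hy)).trans (hle y hy)
  by_cases hex : ∃ y ∈ X, M.best f y = l
  · obtain ⟨y, hy, d, hd, hdl, ht⟩ := hf X hX hone l hl hbest hex
    refine ⟨y, hy, d, hd, le_antisymm ((M.le_best _ hd).trans (hle y hy)) ?_, ht⟩
    exact hdl.symm.trans_le (hsub.le_backup (hX hy) hd)
  · push Not at hex
    obtain ⟨c, hc, hcl⟩ := M.exists_eq_best (M.backup f s a) (hM.enabled_nonempty x (hX hx))
    rw [hxl] at hcl
    refine ⟨x, hx, c, hc, hcl, ?_⟩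
    by_contra! hstay
    rw [backup_apply] at hcl
    split_ifs at hcl with h
    · obtain ⟨rfl, rfl⟩ := h
      obtain ⟨t, ht⟩ := (M.trans x c).support_nonempty
      have ht := (PMF.mem_support_iff _ _).1 ht
      exact hex t (hstay t ht)
        (hM.eq_of_le_mean (hX hx) hc (fun t _ ht => hbest t (hstay t ht)) hcl.ge ht)
    · exact hex x hx ((hbest x hx).antisymm (hcl.symm.trans_le (M.le_best f hc)))

end MDP

namespace Bounds

/-- `c` has the same MDP as `b` and tighter bounds. -/
structure Refines (c b : Bounds S A) : Prop where
  mdp_eq : c.mdp = b.mdp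
  upper_le : ∀ s ∈ b.mdp.states, ∀ a ∈ b.mdp.enabled s, c.U s a ≤ b.U s a
  le_lower : ∀ s ∈ b.mdp.states, ∀ a ∈ b.mdp.enabled s, b.L s a ≤ c.L s a

namespace Refines

variable {b c d : Bounds S A} {s : S}

theorem refl (b : Bounds S A) : b.Refines b :=
  ⟨rfl, fun _ _ _ _ => le_rfl, fun _ _ _ _ => le_rfl⟩

theorem trans (hdc : d.Refines c) (hcb : c.Refines b) : d.Refines b where
  mdp_eq := hdc.mdp_eq.trans hcb.mdp_eq
  upper_le s hs a ha := (hdc.upper_le s (hcb.mdp_eq ▸ hs) a (hcb.mdp_eq ▸ ha)).trans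
    (hcb.upper_le s hs a ha)
  le_lower s hs a ha := (hcb.le_lower s hs a ha).trans
    (hdc.le_lower s (hcb.mdp_eq ▸ hs) a (hcb.mdp_eq ▸ ha))

theorem best_upper_le (h : c.Refines b) (hs : s ∈ b.mdp.states) :
    b.mdp.best c.U s ≤ b.mdp.best b.U s :=
  b.mdp.best_mono (h.upper_le s hs)

theorem le_best_lower (h : c.Refines b) (hs : s ∈ b.mdp.states) :
    b.mdp.best b.L s ≤ b.mdp.best c.L s :=
  b.mdp.best_mono (h.le_lower s hs)

end Refines

end Bounds

variable [Countable S] [Countable A] {M : MDP S A} {F : Set S} {one zero s : S} {b : Bounds S A}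
  {proj : S → S}

namespace Bounds

/-- The invariant of the algorithm: the current MDP is a quotient of `M`, and `U` and `L` are
bounds on its value which backups improve. -/
structure IsSound (M : MDP S A) (F : Set S) (one zero : S) (b : Bounds S A) (proj : S → S) :
    Prop where
  quot : IsQuotient M F one zero b.mdp proj
  lower_nonneg : ∀ s ∈ b.mdp.states, ∀ a ∈ b.mdp.enabled s, 0 ≤ b.L s a
  lower : ∀ s ∈ b.mdp.states, ∀ a ∈ b.mdp.enabled s, b.L s a ≤ b.mdp.mean s a (value M F)
  upper : ∀ s ∈ b.mdp.states, ∀ a ∈ b.mdp.enabled s, b.mdp.mean s a (value M F) ≤ b.U s a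
  upper_le_one : ∀ s ∈ b.mdp.states, ∀ a ∈ b.mdp.enabled s, b.U s a ≤ 1
  super : b.mdp.IsSuperharmonic b.U
  sub : b.mdp.IsSubharmonic b.L
  justified : b.mdp.IsJustified one b.L
  upper_zero : ∀ a ∈ b.mdp.enabled zero, b.U zero a = 0
  lower_one : ∀ a ∈ b.mdp.enabled one, b.L one a = 1

namespace IsSound

theorem isValid (hM : M.IsValid) (hb : b.IsSound M F one zero proj) : b.mdp.IsValid :=
  hb.quot.isValid hM

theorem value_le_best (hS : Setting M F one zero) (hb : b.IsSound M F one zero proj)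
    (hs : s ∈ b.mdp.states) : value M F s ≤ b.mdp.best b.U s := by
  obtain ⟨a, ha, hv⟩ := hb.quot.exists_mean_value_eq hS hs
  rw [← hv]
  exact (hb.upper s hs a ha).trans (b.mdp.le_best _ ha)

theorem best_le_value (hM : M.IsValid) (hb : b.IsSound M F one zero proj)
    (hs : s ∈ b.mdp.states) : b.mdp.best b.L s ≤ value M F s :=
  b.mdp.best_le (hb.quot.enabled_nonempty s hs) fun a ha =>
    (hb.lower s hs a ha).trans (hb.quot.mean_value_le hM hs ha)

theorem best_upper_le_one (hb : b.IsSound M F one zero proj) (hs : s ∈ b.mdp.states) :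
    b.mdp.best b.U s ≤ 1 :=
  b.mdp.best_le (hb.quot.enabled_nonempty s hs) (hb.upper_le_one s hs)

theorem best_lower_nonneg (hb : b.IsSound M F one zero proj) (hs : s ∈ b.mdp.states) :
    0 ≤ b.mdp.best b.L s := by
  obtain ⟨a, ha⟩ := hb.quot.enabled_nonempty s hs
  exact (hb.lower_nonneg s hs a ha).trans (b.mdp.le_best _ ha)

theorem best_upper_zero (hb : b.IsSound M F one zero proj) : b.mdp.best b.U zero = 0 :=
  b.mdp.best_of_forall_eq (hb.quot.enabled_nonempty zero hb.quot.zero_mem) hb.upper_zero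

theorem best_lower_one (hb : b.IsSound M F one zero proj) : b.mdp.best b.L one = 1 :=
  b.mdp.best_of_forall_eq (hb.quot.enabled_nonempty one hb.quot.one_mem) hb.lower_one

end IsSound

theorem isSound_first (hS : Setting M F one zero) :
    (Bounds.first M one zero).IsSound M F one zero id where
  quot := .refl hS
  lower_nonneg s _ a _ := by
    dsimp only [Bounds.first]
    split_ifs <;> norm_num
  lower s hs a ha := by
    dsimp only [Bounds.first] at hs ha ⊢
    split_ifs with h
    · subst h
      rw [hS.valid.mean_eq_of_isTerminal hs hS.one_terminal ha, hS.value_one]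
    · exact MDP.mean_nonneg fun t _ => value_nonneg M F t
  upper s hs a ha := by
    dsimp only [Bounds.first] at hs ha ⊢
    split_ifs with h
    · subst h
      rw [hS.valid.mean_eq_of_isTerminal hs hS.zero_terminal ha, hS.value_zero]
    · exact hS.valid.mean_le hs ha fun t _ _ => value_le_one M F t
  upper_le_one s _ a _ := by
    dsimp only [Bounds.first]
    split_ifs <;> norm_num
  super := by
    refine hS.valid.isSuperharmonic_of_mean_le (g := fun s => if s = zero then 0 else 1)
      fun s hs a ha => ?_
    split_ifs with h
    · subst h
      rw [hS.valid.mean_eq_of_isTerminal hs hS.zero_terminal ha, if_pos rfl]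
    · exact hS.valid.mean_le hs ha fun t _ _ => by split_ifs <;> norm_num
  sub := by
    refine hS.valid.isSubharmonic_of_le_mean (g := fun s => if s = one then 1 else 0)
      fun s hs a ha => ?_
    split_ifs with h
    · subst h
      rw [hS.valid.mean_eq_of_isTerminal hs hS.one_terminal ha, if_pos rfl]
    · exact MDP.mean_nonneg fun t _ => by split_ifs <;> norm_num
  justified := by
    rintro X hX hone l hl - ⟨x, hx, hxl⟩
    have hzero : M.best (Bounds.first M one zero).L x = 0 :=
      M.best_of_forall_eq (hS.valid.enabled_nonempty x (hX hx)) fun _ _ =>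
        if_neg (ne_of_mem_of_not_mem hx hone)
    exact absurd (hxl.symm.trans hzero) hl.ne'
  upper_zero _ _ := if_pos rfl
  lower_one _ _ := if_pos rfl

namespace IsSound

theorem refines_update (hb : b.IsSound M F one zero proj) (m : Move S A) :
    (b.update m).Refines b where
  mdp_eq := rfl
  upper_le _ hs _ ha := hb.super.backup_le hs ha
  le_lower _ hs _ ha := hb.sub.le_backup hs ha

theorem lower_update (hM : M.IsValid) (hb : b.IsSound M F one zero proj) (m : Move S A)
    (hs : s ∈ b.mdp.states) {a : A} (ha : a ∈ b.mdp.enabled s) :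
    (b.update m).L s a ≤ b.mdp.mean s a (value M F) := by
  refine (b.mdp.backup_apply b.L _ _ s a).trans_le ?_
  split_ifs with h
  · obtain ⟨rfl, rfl⟩ := h
    exact MDP.mean_mono fun t ht _ => hb.best_le_value hM ht
  · exact hb.lower s hs a ha

theorem upper_update (hS : Setting M F one zero) (hb : b.IsSound M F one zero proj) (m : Move S A)
    (hs : s ∈ b.mdp.states) {a : A} (ha : a ∈ b.mdp.enabled s) :
    b.mdp.mean s a (value M F) ≤ (b.update m).U s a := by
  refine le_of_le_of_eq ?_ (b.mdp.backup_apply b.U _ _ s a).symm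
  split_ifs with h
  · obtain ⟨rfl, rfl⟩ := h
    exact MDP.mean_mono fun t ht _ => hb.value_le_best hS ht
  · exact hb.upper s hs a ha

theorem update (hS : Setting M F one zero) (hb : b.IsSound M F one zero proj) (m : Move S A) :
    (b.update m).IsSound M F one zero proj where
  quot := hb.quot
  lower_nonneg s hs a ha := (hb.lower_nonneg s hs a ha).trans (hb.sub.le_backup hs ha)
  lower _ hs _ ha := hb.lower_update hS.valid m hs ha
  upper _ hs _ ha := hb.upper_update hS m hs ha
  upper_le_one s hs a ha := (hb.super.backup_le hs ha).trans (hb.upper_le_one s hs a ha)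
  super := hb.super.backup _ _
  sub := hb.sub.backup _ _
  justified := hb.justified.backup (hb.isValid hS.valid) hb.sub _ _
  upper_zero a ha := by
    refine ((hb.super.backup_le hb.quot.zero_mem ha).trans_eq (hb.upper_zero a ha)).antisymm ?_
    exact (MDP.mean_nonneg fun t _ => value_nonneg M F t).trans
      (hb.upper_update hS m hb.quot.zero_mem ha)
  lower_one a ha := by
    refine le_antisymm ?_ ((hb.lower_one a ha).ge.trans (hb.sub.le_backup hb.quot.one_mem ha))
    exact (hb.lower_update hS.valid m hb.quot.one_mem ha).trans
      ((hb.isValid hS.valid).mean_le hb.quot.one_mem ha fun t _ _ => value_le_one M F t)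

theorem foldl_update (hS : Setting M F one zero) (hb : b.IsSound M F one zero proj)
    (w : List (Move S A)) : (w.foldl Bounds.update b).IsSound M F one zero proj := by
  induction w generalizing b with
  | nil => exact hb
  | cons m _ ih => exact ih (hb.update hS m)

theorem refines_foldl_update (hS : Setting M F one zero) (hb : b.IsSound M F one zero proj)
    (w : List (Move S A)) : (w.foldl Bounds.update b).Refines b := by
  induction w generalizing b with
  | nil => exact .refl b
  | cons m _ ih => exact (ih (hb.update hS m)).trans (hb.refines_update m)

theorem foldl_update_upper_le (hS : Setting M F one zero) (hb : b.IsSound M F one zero proj)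
    {w : List (Move S A)}
    (hw : ∀ m ∈ w, m.state ∈ b.mdp.states ∧ m.action ∈ b.mdp.enabled m.state) :
    ∀ m ∈ w, (w.foldl Bounds.update b).U m.state m.action ≤
      b.mdp.mean m.state m.action (b.mdp.best b.U) := by
  induction w generalizing b with
  | nil => simp
  | cons m w ih =>
    have hm := hw m List.mem_cons_self
    have hu := hb.update hS m
    refine List.forall_mem_cons.2 ⟨?_, fun m' hm' => ?_⟩
    · rw [← MDP.backup_self]
      exact (hu.refines_foldl_update hS w).upper_le _ hm.1 _ hm.2
    · refine (ih hu (fun m hm => hw m (List.mem_cons_of_mem _ hm)) m' hm').trans ?_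
      exact MDP.mean_mono fun t ht _ => (hb.refines_update m).best_upper_le ht

theorem le_foldl_update_lower (hS : Setting M F one zero) (hb : b.IsSound M F one zero proj)
    {w : List (Move S A)}
    (hw : ∀ m ∈ w, m.state ∈ b.mdp.states ∧ m.action ∈ b.mdp.enabled m.state) :
    ∀ m ∈ w, b.mdp.mean m.state m.action (b.mdp.best b.L) ≤
      (w.foldl Bounds.update b).L m.state m.action := by
  induction w generalizing b with
  | nil => simp
  | cons m w ih =>
    have hm := hw m List.mem_cons_self
    have hu := hb.update hS m
    refine List.forall_mem_cons.2 ⟨?_, fun m' hm' => ?_⟩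
    · rw [← MDP.backup_self]
      exact (hu.refines_foldl_update hS w).le_lower _ hm.1 _ hm.2
    · refine le_trans ?_ (ih hu (fun m hm => hw m (List.mem_cons_of_mem _ hm)) m' hm')
      exact MDP.mean_mono fun t ht _ => (hb.refines_update m).le_best_lower ht

end IsSound

end Bounds

end Soundness

section Merging

variable {S A : Type*}

/-- The map that merges `R` into the state `r`. -/
def mergeMap (R : Finset S) (r : S) (t : S) : S := if t ∈ R then r else t

section mergeMap

variable {R : Finset S} {r t : S}

theorem mergeMap_of_mem (h : t ∈ R) : mergeMap R r t = r := if_pos h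

theorem mergeMap_of_notMem (h : t ∉ R) : mergeMap R r t = t := if_neg h

theorem mergeMap_self (R : Finset S) (r : S) : mergeMap R r r = r := ite_self r

theorem mergeMap_comp_mergeMap (hr : r ∈ R) (z : S) :
    mergeMap {r, z} z ∘ mergeMap R r = mergeMap R z := by
  funext t
  simp only [Function.comp_apply, mergeMap, Finset.mem_insert, Finset.mem_singleton]
  grind

end mergeMap

namespace MDP

variable {M : MDP S A} {R : Finset S} {B : Finset A} {r s y z : S} {a : A}

theorem IsEC.exists_enabled (h : M.IsEC R B) (ha : a ∈ B) : ∃ s ∈ R, a ∈ M.enabled s :=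
  Finset.mem_biUnion.1 (h.actions_subset ha)

theorem IsEC.states_nonempty (h : M.IsEC R B) : R.Nonempty := by
  obtain ⟨a, ha⟩ := h.nonempty
  obtain ⟨s, hs, -⟩ := h.exists_enabled ha
  exact ⟨s, hs⟩

theorem owner_eq (hunique : ∀ x ∈ R, a ∈ M.enabled x → x = y) (hy : y ∈ R) (ha : a ∈ M.enabled y) :
    M.owner R r a = y := by
  have h : ∃ s ∈ R, a ∈ M.enabled s := ⟨y, hy, ha⟩
  rw [owner, dif_pos h]
  exact hunique _ h.choose_spec.1 h.choose_spec.2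

theorem mem_states_collapse :
    s ∈ (M.collapse R B r).states ↔ s = r ∨ s ∈ M.states ∧ s ∉ R := by
  simp only [collapse, Finset.mem_insert, Finset.mem_sdiff]

theorem enabled_collapse_self : (M.collapse R B r).enabled r = R.biUnion M.enabled \ B :=
  if_pos rfl

theorem enabled_collapse_of_ne (hs : s ≠ r) : (M.collapse R B r).enabled s = M.enabled s \ B :=
  if_neg hs

theorem trans_collapse_self (M : MDP S A) (R : Finset S) (B : Finset A) (r : S) (a : A) :
    (M.collapse R B r).trans r a = (M.trans (M.owner R r a) a).map (mergeMap R r) := by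
  simp only [collapse, if_pos]
  rfl

theorem trans_collapse_of_ne (hs : s ≠ r) :
    (M.collapse R B r).trans s a = (M.trans s a).map (mergeMap R r) := by
  simp only [collapse, if_neg hs]
  rfl

theorem IsValid.notMem_biUnion_enabled (hM : M.IsValid) (hR : R ⊆ M.states) (hy : y ∈ M.states)
    (hyR : y ∉ R) (ha : a ∈ M.enabled y) : a ∉ R.biUnion M.enabled := by
  intro h
  obtain ⟨x, hx, hxa⟩ := Finset.mem_biUnion.1 h
  exact hyR (hM.eq_of_mem_enabled hy (hR hx) ha hxa ▸ hx)

theorem IsValid.enabled_collapse (hM : M.IsValid) (hR : M.IsEC R B) (hr : r ∈ R)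
    (hy : y ∈ M.states) (hyR : y ∉ R) : (M.collapse R B r).enabled y = M.enabled y := by
  rw [enabled_collapse_of_ne (ne_of_mem_of_not_mem hr hyR).symm, Finset.sdiff_eq_self_iff_disjoint,
    Finset.disjoint_left]
  exact fun a ha haB =>
    hM.notMem_biUnion_enabled hR.states_subset hy hyR ha (hR.actions_subset haB)

theorem IsValid.disjoint_enabled_collapse_self (hM : M.IsValid) (hR : M.IsEC R B) (hr : r ∈ R)
    (hy : y ∈ M.states) (hyR : y ∉ R) :
    Disjoint ((M.collapse R B r).enabled y) ((M.collapse R B r).enabled r) := by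
  rw [hM.enabled_collapse hR hr hy hyR, enabled_collapse_self, Finset.disjoint_left]
  exact fun a ha ha' =>
    hM.notMem_biUnion_enabled hR.states_subset hy hyR ha (Finset.mem_sdiff.1 ha').1

theorem mem_states_makeTerminal :
    y ∈ (M.makeTerminal s z).states ↔ y = z ∨ y ∈ M.states ∧ y ≠ s := by
  simp only [makeTerminal, mem_states_collapse, Finset.mem_insert, Finset.mem_singleton]
  grind

theorem enabled_makeTerminal (hdisj : Disjoint (M.enabled y) (M.enabled s)) :
    (M.makeTerminal s z).enabled y = M.enabled y := by
  rw [makeTerminal]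
  by_cases hyz : y = z
  · subst hyz
    rw [enabled_collapse_self, Finset.biUnion_insert, Finset.singleton_biUnion,
      Finset.union_sdiff_cancel_left hdisj.symm]
  · rw [enabled_collapse_of_ne hyz, Finset.sdiff_eq_self_of_disjoint hdisj]

theorem trans_makeTerminal (hdisj : Disjoint (M.enabled y) (M.enabled s)) (ha : a ∈ M.enabled y) :
    (M.makeTerminal s z).trans y a = (M.trans y a).map (mergeMap {s, z} z) := by
  rw [makeTerminal]
  by_cases hyz : y = z
  · subst hyz
    have howner : M.owner {s, y} y a = y := by
      refine owner_eq ?_ (by simp) ha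
      simp only [Finset.mem_insert, Finset.mem_singleton, forall_eq_or_imp, forall_eq,
        implies_true, and_true]
      exact fun has => absurd has (Finset.disjoint_left.1 hdisj ha)
    rw [trans_collapse_self, howner]
  · rw [trans_collapse_of_ne hyz]

end MDP

variable {M : MDP S A} {F : Set S} {one zero : S} {b c : Bounds S A} {proj : S → S} {R : Finset S}
  {B : Finset A} {r s t : S} {a : A}

/-- `c` arises from `b` by merging the states of the end component `(R, B)` into `r`, which is a
state of `R` or a terminal state. -/
structure IsMerge (F : Set S) (one zero : S) (b c : Bounds S A) (R : Finset S) (B : Finset A)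
    (r : S) : Prop where
  mem_states : ∀ s, s ∈ c.mdp.states ↔ s = r ∨ s ∈ b.mdp.states ∧ s ∉ R
  start_eq : c.mdp.start = mergeMap R r b.mdp.start
  exists_owner : ∀ s ∈ c.mdp.states, ∀ a ∈ c.mdp.enabled s, ∃ y ∈ b.mdp.states,
    mergeMap R r y = s ∧ a ∈ b.mdp.enabled y ∧
    c.mdp.trans s a = (b.mdp.trans y a).map (mergeMap R r) ∧
    c.U s a = b.U y a ∧ c.L s a = b.L y a ∧ (y ∈ R → r ∈ R ∧ a ∉ B)
  enabled_of_notMem : ∀ y ∈ b.mdp.states, y ∉ R → ∀ a ∈ b.mdp.enabled y, a ∈ c.mdp.enabled y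
  enabled_of_mem : r ∈ R → ∀ y ∈ R, ∀ a ∈ b.mdp.enabled y, a ∉ B → a ∈ c.mdp.enabled r
  cases : (r ∈ R ∧ (∀ s ∈ R, s ∉ F) ∧ (c.mdp.enabled r).Nonempty) ∨
    (r = one ∧ ∃ s ∈ R, s ∈ F) ∨
    (r = zero ∧ (∀ s ∈ R, s ∉ F) ∧ ∀ y ∈ R, ∀ a ∈ b.mdp.enabled y, a ∈ B)

theorem isMerge_collapse (hV : b.mdp.IsValid) (hR : b.mdp.IsEC R B) (hr : r ∈ R)
    (hRF : ∀ s ∈ R, s ∉ F) (hne : ((b.mdp.collapse R B r).enabled r).Nonempty) :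
    IsMerge F one zero b { mdp := b.mdp.collapse R B r
                           U := fun s a => if s = r then b.U (b.mdp.owner R r a) a else b.U s a
                           L := fun s a => if s = r then b.L (b.mdp.owner R r a) a else b.L s a }
      R B r where
  mem_states _ := MDP.mem_states_collapse
  start_eq := rfl
  exists_owner s hs a ha := by
    by_cases hsr : s = r
    · subst hsr
      obtain ⟨hexists, haB⟩ := Finset.mem_sdiff.1 (MDP.enabled_collapse_self ▸ ha)
      obtain ⟨y, hy, hay⟩ := Finset.mem_biUnion.1 hexists
      have howner : b.mdp.owner R s a = y := MDP.owner_eq (fun x hx hax =>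
        hV.eq_of_mem_enabled (hR.states_subset hx) (hR.states_subset hy) hax hay) hy hay
      exact ⟨y, hR.states_subset hy, mergeMap_of_mem hy, hay,
        by rw [MDP.trans_collapse_self, howner], by simp only [if_pos, howner],
        by simp only [if_pos, howner], fun _ => ⟨hr, haB⟩⟩
    · obtain ⟨hs, hsR⟩ := (MDP.mem_states_collapse.1 hs).resolve_left hsr
      exact ⟨s, hs, mergeMap_of_notMem hsR, hV.enabled_collapse hR hr hs hsR ▸ ha,
        MDP.trans_collapse_of_ne hsr, if_neg hsr, if_neg hsr, fun h => absurd h hsR⟩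
  enabled_of_notMem y hy hyR a ha := (hV.enabled_collapse hR hr hy hyR).symm ▸ ha
  enabled_of_mem _ y hy a ha haB := by
    rw [MDP.enabled_collapse_self]
    exact Finset.mem_sdiff.2 ⟨Finset.mem_biUnion.2 ⟨y, hy, ha⟩, haB⟩
  cases := Or.inl ⟨hr, hRF, hne⟩

theorem isMerge_makeTerminal (hV : b.mdp.IsValid) (hR : b.mdp.IsEC R B) (hr : r ∈ R) {z : S}
    (hz : z ∈ b.mdp.states) (hzR : z ∉ R)
    (hcases : (z = one ∧ ∃ s ∈ R, s ∈ F) ∨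
      (z = zero ∧ (∀ s ∈ R, s ∉ F) ∧ ∀ y ∈ R, ∀ a ∈ b.mdp.enabled y, a ∈ B)) :
    IsMerge F one zero b { mdp := (b.mdp.collapse R B r).makeTerminal r z
                           U := fun s a => if s = r then b.U (b.mdp.owner R r a) a else b.U s a
                           L := fun s a => if s = r then b.L (b.mdp.owner R r a) a else b.L s a }
      R B z := by
  have hcomp := mergeMap_comp_mergeMap hr z
  have hne : ∀ {y}, y ∉ R → y ≠ r := fun hyR => (ne_of_mem_of_not_mem hr hyR).symm
  have hmem : ∀ s, s ∈ ((b.mdp.collapse R B r).makeTerminal r z).states ↔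
      s = z ∨ s ∈ b.mdp.states ∧ s ∉ R := by
    intro s
    rw [MDP.mem_states_makeTerminal, MDP.mem_states_collapse]
    grind
  have henabled : ∀ y ∈ b.mdp.states, y ∉ R →
      ((b.mdp.collapse R B r).makeTerminal r z).enabled y = b.mdp.enabled y := fun y hy hyR => by
    rw [MDP.enabled_makeTerminal (hV.disjoint_enabled_collapse_self hR hr hy hyR),
      hV.enabled_collapse hR hr hy hyR]
  refine ⟨hmem, ?_, fun s hs a ha => ?_, fun y hy hyR a ha => (henabled y hy hyR).symm ▸ ha,
    fun h => absurd h hzR, Or.inr hcases⟩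
  · rw [← hcomp]
    rfl
  · obtain ⟨hs, hsR⟩ : s ∈ b.mdp.states ∧ s ∉ R := by
      rcases (hmem s).1 hs with rfl | h
      exacts [⟨hz, hzR⟩, h]
    have ha' : a ∈ b.mdp.enabled s := henabled s hs hsR ▸ ha
    have htrans := MDP.trans_makeTerminal (z := z)
      (hV.disjoint_enabled_collapse_self hR hr hs hsR)
      ((hV.enabled_collapse hR hr hs hsR).symm ▸ ha')
    rw [MDP.trans_collapse_of_ne (hne hsR), PMF.map_comp, hcomp] at htrans
    exact ⟨s, hs, mergeMap_of_notMem hsR, ha', htrans, if_neg (hne hsR), if_neg (hne hsR),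
      fun h => absurd h hsR⟩

theorem isMerge_processEC (F : Set S) (hV : b.mdp.IsValid) (hone : one ∈ b.mdp.states)
    (hzero : zero ∈ b.mdp.states) {P : Finset S × Finset A} (hP : b.mdp.IsEC P.1 P.2)
    (honeP : one ∉ P.1) (hzeroP : zero ∉ P.1) :
    ∃ r, IsMerge F one zero b (b.processEC F one zero P) P.1 P.2 r := by
  have hne := hP.states_nonempty
  have hr := hne.choose_spec
  rw [Bounds.processEC, dif_pos hne]
  dsimp only
  split_ifs with hF hE
  · exact ⟨one, isMerge_makeTerminal hV hP hr hone honeP (Or.inl ⟨rfl, hF⟩)⟩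
  · push Not at hF
    rw [MDP.enabled_collapse_self, Finset.sdiff_eq_empty_iff_subset] at hE
    exact ⟨zero, isMerge_makeTerminal hV hP hr hzero hzeroP (Or.inr ⟨rfl, hF, fun y hy a ha =>
      hE (Finset.mem_biUnion.2 ⟨y, hy, ha⟩)⟩)⟩
  · push Not at hF
    exact ⟨_, isMerge_collapse hV hP hr hF (Finset.nonempty_iff_ne_empty.2 hE)⟩

namespace IsMerge

theorem mergeMap_mem (hm : IsMerge F one zero b c R B r) (ht : t ∈ b.mdp.states) :
    mergeMap R r t ∈ c.mdp.states := by
  rw [hm.mem_states]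
  by_cases h : t ∈ R
  · exact Or.inl (mergeMap_of_mem h)
  · rw [mergeMap_of_notMem h]
    exact Or.inr ⟨ht, h⟩

theorem mergeMap_eq (hm : IsMerge F one zero b c R B r) (hs : s ∈ c.mdp.states) :
    mergeMap R r s = s := by
  rcases (hm.mem_states s).1 hs with rfl | h
  exacts [mergeMap_self R s, mergeMap_of_notMem h.2]

theorem of_mem_enabled (hm : IsMerge F one zero b c R B r) (hs : s ∈ b.mdp.states) (hsR : s ∉ R)
    (ha : a ∈ c.mdp.enabled s) :
    a ∈ b.mdp.enabled s ∧ c.mdp.trans s a = (b.mdp.trans s a).map (mergeMap R r) ∧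
      c.U s a = b.U s a ∧ c.L s a = b.L s a := by
  obtain ⟨y, -, hys, hay, htrans, hU, hL, hyR⟩ :=
    hm.exists_owner s ((hm.mem_states s).2 (Or.inr ⟨hs, hsR⟩)) a ha
  by_cases h : y ∈ R
  · rw [mergeMap_of_mem h] at hys
    exact absurd (hys ▸ (hyR h).1) hsR
  · rw [mergeMap_of_notMem h] at hys
    subst hys
    exact ⟨hay, htrans, hU, hL⟩

theorem trans_mergeMap (hm : IsMerge F one zero b c R B r) (hV : b.mdp.IsValid)
    (ht : t ∈ b.mdp.states) (ha : a ∈ b.mdp.enabled t) (ha' : a ∈ c.mdp.enabled (mergeMap R r t)) :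
    c.mdp.trans (mergeMap R r t) a = (b.mdp.trans t a).map (mergeMap R r) ∧
      c.L (mergeMap R r t) a = b.L t a := by
  obtain ⟨y, hy, -, hay, htrans, -, hL, -⟩ := hm.exists_owner _ (hm.mergeMap_mem ht) a ha'
  obtain rfl := hV.eq_of_mem_enabled ht hy ha hay
  exact ⟨htrans, hL⟩

theorem mean_eq (hm : IsMerge F one zero b c R B r) (hV : b.mdp.IsValid) (ht : t ∈ b.mdp.states)
    (ha : a ∈ b.mdp.enabled t) (htrans : c.mdp.trans s a = (b.mdp.trans t a).map (mergeMap R r))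
    (f : S → ℝ) : c.mdp.mean s a f = b.mdp.mean t a fun t => f (mergeMap R r t) :=
  MDP.mean_of_trans_eq_map htrans (fun _ h => hV.mem_states ht ha h)
    (fun _ => hm.mergeMap_mem) f

theorem isJustified (hm : IsMerge F one zero b c R B r) (hV : b.mdp.IsValid)
    (hR : b.mdp.IsEC R B) (hone : one ∉ R)
    (hne : ∀ s ∈ c.mdp.states, (c.mdp.enabled s).Nonempty)
    (hle : ∀ t ∈ b.mdp.states, b.mdp.best b.L t ≤ c.mdp.best c.L (mergeMap R r t))
    (hb : b.mdp.IsJustified one b.L) : c.mdp.IsJustified one c.L := by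
  rintro X hX hXone l hl hXle ⟨s, hs, hsl⟩
  let Y := b.mdp.states.filter fun t => mergeMap R r t ∈ X
  have hYone : one ∉ Y := fun h =>
    hXone (mergeMap_of_notMem (r := r) hone ▸ (Finset.mem_filter.1 h).2)
  have hYle : ∀ t ∈ Y, b.mdp.best b.L t ≤ l := fun t ht =>
    (hle t (Finset.mem_filter.1 ht).1).trans (hXle _ (Finset.mem_filter.1 ht).2)
  have hYmax : ∃ t ∈ Y, b.mdp.best b.L t = l := by
    obtain ⟨a, ha, hbest⟩ := c.mdp.exists_eq_best c.L (hne s (hX hs))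
    obtain ⟨y, hy, hys, hay, -, -, hL, -⟩ := hm.exists_owner s (hX hs) a ha
    have hyY : y ∈ Y := Finset.mem_filter.2 ⟨hy, hys.symm ▸ hs⟩
    refine ⟨y, hyY, (hYle y hyY).antisymm ?_⟩
    rw [← hsl, ← hbest, hL]
    exact b.mdp.le_best _ hay
  obtain ⟨x, hx, a, ha, hxa, t, ht, htY⟩ := hb Y (Finset.filter_subset _ _) hYone l hl hYle hYmax
  obtain ⟨hxs, hxX⟩ := Finset.mem_filter.1 hx
  have ha' : a ∈ c.mdp.enabled (mergeMap R r x) := by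
    by_cases hxR : x ∈ R
    · have haB : a ∉ B := fun haB => by
        have htR : t ∈ R := hR.closed x hxR a haB ha ((PMF.mem_support_iff _ _).2 ht)
        refine htY (Finset.mem_filter.2 ⟨hR.states_subset htR, ?_⟩)
        rwa [mergeMap_of_mem htR, ← mergeMap_of_mem (r := r) hxR]
      rw [mergeMap_of_mem hxR] at hxX ⊢
      rcases hm.cases with ⟨hr, -⟩ | ⟨rfl, -⟩ | ⟨-, -, hall⟩
      exacts [hm.enabled_of_mem hr x hxR a ha haB, absurd hxX hXone,
        absurd (hall x hxR a ha) haB]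
    · rw [mergeMap_of_notMem hxR]
      exact hm.enabled_of_notMem x hxs hxR a ha
  obtain ⟨htrans, hL⟩ := hm.trans_mergeMap hV hxs ha ha'
  refine ⟨_, hxX, a, ha', hL.trans hxa, mergeMap R r t, ?_, fun h => htY ?_⟩
  · rw [htrans, pmf_map_apply_ne_zero_iff]
    exact ⟨t, ht, rfl⟩
  · exact Finset.mem_filter.2 ⟨hV.mem_states hxs ha ht, h⟩

variable [Countable S] [Countable A]

theorem mem_states_right (hm : IsMerge F one zero b c R B r) (hR : b.mdp.IsEC R B)
    (hq : IsQuotient M F one zero b.mdp proj) : r ∈ b.mdp.states := by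
  rcases hm.cases with ⟨hr, -⟩ | ⟨rfl, -⟩ | ⟨rfl, -⟩
  exacts [hR.states_subset hr, hq.one_mem, hq.zero_mem]

theorem value_eq (hm : IsMerge F one zero b c R B r) (hS : Setting M F one zero)
    (hq : IsQuotient M F one zero b.mdp proj) (hR : b.mdp.IsEC R B) (hone : one ∉ R) (hs : s ∈ R) :
    value M F r = value M F s := by
  have hconst : ∀ s ∈ R, ∀ t ∈ R, value M F s = value M F t := fun s hs t ht =>
    hR.eq_of_mean_le (hq.isValid hS.valid)
      (fun x hx a ha => hq.mean_value_le hS.valid (hR.states_subset hx) ha) hs ht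
  rcases hm.cases with ⟨hr, -⟩ | ⟨rfl, t, ht, htF⟩ | ⟨rfl, hRF, hall⟩
  · exact hconst r hr s hs
  · rw [hconst s hs t ht, hS.value_one,
      value_of_mem hS.valid (hq.states_subset (hR.states_subset ht)) htF]
  · rw [hS.value_zero, hq.value_eq_zero_of_closed hS.valid hR.states_subset hone hRF
      (fun t ht => hconst t ht s hs) (fun y hy a ha => Or.inl fun t ht => ?_) hs]
    exact hR.closed y hy a (hall y hy a ha) ha ((PMF.mem_support_iff _ _).2 ht)

theorem value_mergeMap (hm : IsMerge F one zero b c R B r) (hS : Setting M F one zero)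
    (hq : IsQuotient M F one zero b.mdp proj) (hR : b.mdp.IsEC R B) (hone : one ∉ R) (t : S) :
    value M F (mergeMap R r t) = value M F t := by
  by_cases h : t ∈ R
  · rw [mergeMap_of_mem h, hm.value_eq hS hq hR hone h]
  · rw [mergeMap_of_notMem h]

theorem removed (hm : IsMerge F one zero b c R B r) (hS : Setting M F one zero)
    (hq : IsQuotient M F one zero b.mdp proj) (hR : b.mdp.IsEC R B) (hone : one ∉ R) {x : S}
    (hx : x ∈ M.states) (ha : a ∈ M.enabled x) :
    a ∈ c.mdp.enabled (mergeMap R r (proj x)) ∨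
      ((∀ t, M.trans x a t ≠ 0 → mergeMap R r (proj t) = mergeMap R r (proj x)) ∧
        mergeMap R r (proj x) ∉ F) ∨ mergeMap R r (proj x) = one := by
  have htarget : proj x ∈ R → r ∉ F ∨ r = one := fun _ => by
    rcases hm.cases with ⟨hr, hRF, -⟩ | ⟨hr, -⟩ | ⟨rfl, -⟩
    exacts [Or.inl (hRF r hr), Or.inr hr, Or.inl hS.zero_target]
  rcases hq.removed x hx a ha with ha' | ⟨hloop, hxF⟩ | hx1
  · by_cases hxR : proj x ∈ R
    · have hclosed : a ∈ B → ∀ t, M.trans x a t ≠ 0 → mergeMap R r (proj t) = r := by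
        intro haB t ht
        refine mergeMap_of_mem (hR.closed _ hxR a haB ha' ((PMF.mem_support_iff _ _).2 ?_))
        rw [hq.trans_eq hS.valid hx ha ha', pmf_map_apply_ne_zero_iff]
        exact ⟨t, ht, rfl⟩
      rw [mergeMap_of_mem hxR]
      by_cases haB : a ∈ B
      · exact Or.inr ((htarget hxR).imp_left fun hrF => ⟨hclosed haB, hrF⟩)
      · rcases hm.cases with ⟨hr, -⟩ | ⟨hr, -⟩ | ⟨-, -, hall⟩
        exacts [Or.inl (hm.enabled_of_mem hr _ hxR a ha' haB), Or.inr (Or.inr hr),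
          absurd (hall _ hxR a ha') haB]
    · rw [mergeMap_of_notMem hxR]
      exact Or.inl (hm.enabled_of_notMem _ (hq.proj_mem x hx) hxR a ha')
  · refine Or.inr ?_
    have hloop' : ∀ t, M.trans x a t ≠ 0 → mergeMap R r (proj t) = mergeMap R r (proj x) :=
      fun t ht => by rw [hloop t ht]
    by_cases hxR : proj x ∈ R
    · rw [mergeMap_of_mem hxR] at hloop' ⊢
      exact (htarget hxR).imp_left fun hrF => ⟨hloop', hrF⟩
    · rw [mergeMap_of_notMem hxR] at hloop' ⊢
      exact Or.inl ⟨hloop', hxF⟩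
  · rw [hx1, mergeMap_of_notMem hone]
    exact Or.inr (Or.inr rfl)

theorem target (hm : IsMerge F one zero b c R B r)
    (hq : IsQuotient M F one zero b.mdp proj) (hone : one ∉ R) {f : S} (hf : f ∈ M.states)
    (hfF : f ∈ F) : mergeMap R r (proj f) = f ∨ mergeMap R r (proj f) = one := by
  rcases hq.target f hf hfF with h | h
  · rw [h]
    by_cases hfR : f ∈ R
    · rw [mergeMap_of_mem hfR]
      rcases hm.cases with ⟨-, hRF, -⟩ | ⟨hr, -⟩ | ⟨-, hRF, -⟩
      exacts [absurd hfF (hRF f hfR), Or.inr hr, absurd hfF (hRF f hfR)]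
    · exact Or.inl (mergeMap_of_notMem hfR)
  · rw [h]
    exact Or.inr (mergeMap_of_notMem hone)

theorem enabled_nonempty (hm : IsMerge F one zero b c R B r)
    (hq : IsQuotient M F one zero b.mdp proj) (hone : one ∉ R) (hzero : zero ∉ R)
    (hs : s ∈ c.mdp.states) : (c.mdp.enabled s).Nonempty := by
  have hoff : ∀ s ∈ b.mdp.states, s ∉ R → (c.mdp.enabled s).Nonempty := fun s hs hsR =>
    (hq.enabled_nonempty s hs).mono fun a ha => hm.enabled_of_notMem s hs hsR a ha
  rcases (hm.mem_states s).1 hs with rfl | ⟨hs, hsR⟩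
  · rcases hm.cases with ⟨-, -, hne⟩ | ⟨rfl, -⟩ | ⟨rfl, -⟩
    exacts [hne, hoff _ hq.one_mem hone, hoff _ hq.zero_mem hzero]
  · exact hoff s hs hsR

theorem isQuotient (hm : IsMerge F one zero b c R B r) (hS : Setting M F one zero)
    (hq : IsQuotient M F one zero b.mdp proj) (hR : b.mdp.IsEC R B) (hone : one ∉ R)
    (hzero : zero ∉ R) : IsQuotient M F one zero c.mdp (mergeMap R r ∘ proj) := by
  have hsub : c.mdp.states ⊆ b.mdp.states := by
    intro s hs
    rcases (hm.mem_states s).1 hs with rfl | h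
    exacts [hm.mem_states_right hR hq, h.1]
  exact
    { states_subset := hsub.trans hq.states_subset
      one_mem := (hm.mem_states _).2 (Or.inr ⟨hq.one_mem, hone⟩)
      zero_mem := (hm.mem_states _).2 (Or.inr ⟨hq.zero_mem, hzero⟩)
      proj_mem := fun s hs => hm.mergeMap_mem (hq.proj_mem s hs)
      proj_self := fun s hs => by
        rw [Function.comp_apply, hq.proj_self s (hsub hs), hm.mergeMap_eq hs]
      start_eq := by rw [hm.start_eq, hq.start_eq, Function.comp_apply]
      exists_owner := by
        intro s hs a ha
        obtain ⟨y, hy, hys, hay, htrans, -⟩ := hm.exists_owner s hs a ha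
        obtain ⟨x, hx, hxy, hax, htrans'⟩ := hq.exists_owner y hy a hay
        refine ⟨x, hx, by rw [Function.comp_apply, hxy, hys], hax, ?_⟩
        rw [htrans, htrans', PMF.map_comp]
      removed := fun _ hx _ ha => hm.removed hS hq hR hone hx ha
      value_proj := fun x hx =>
        (hm.value_mergeMap hS hq hR hone (proj x)).trans (hq.value_proj x hx)
      target := fun _ hf hfF => hm.target hq hone hf hfF
      enabled_nonempty := fun _ => hm.enabled_nonempty hq hone hzero
      one_enabled := fun a ha => hq.one_enabled a (hm.of_mem_enabled hq.one_mem hone ha).1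
      zero_enabled := fun a ha => hq.zero_enabled a (hm.of_mem_enabled hq.zero_mem hzero ha).1 }

theorem best_upper_mergeMap_le (hm : IsMerge F one zero b c R B r) (hS : Setting M F one zero)
    (hb : b.IsSound M F one zero proj) (hR : b.mdp.IsEC R B) (hone : one ∉ R) (hzero : zero ∉ R)
    (ht : t ∈ b.mdp.states) : c.mdp.best c.U (mergeMap R r t) ≤ b.mdp.best b.U t := by
  have hqc := hm.isQuotient hS hb.quot hR hone hzero
  refine c.mdp.best_le (hqc.enabled_nonempty _ (hm.mergeMap_mem ht)) fun a ha => ?_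
  by_cases htR : t ∈ R
  · obtain ⟨y, hy, hyt, hay, -, hU, -⟩ := hm.exists_owner _ (hm.mergeMap_mem ht) a ha
    have hvalue := hm.value_eq hS hb.quot hR hone htR
    rw [mergeMap_of_mem htR] at hyt ha hU ⊢
    rw [hU]
    rcases hm.cases with ⟨hr, -⟩ | ⟨rfl, -⟩ | ⟨rfl, -⟩
    · have hyR : y ∈ R := by
        by_contra h
        exact h ((mergeMap_of_notMem h).symm.trans hyt ▸ hr)
      refine (b.mdp.le_best _ hay).trans_eq (hR.eq_of_mean_le (hb.isValid hS.valid) ?_ hyR htR)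
      exact fun x hx d hd => (hb.super x (hR.states_subset hx) d hd).trans (b.mdp.le_best _ hd)
    · exact (hb.upper_le_one y hy a hay).trans
        ((hS.value_one.symm.trans hvalue).trans_le (hb.value_le_best hS ht))
    · obtain ⟨ha', -, hU', -⟩ := hm.of_mem_enabled hb.quot.zero_mem hzero ha
      rw [← hU, hU', hb.upper_zero a ha', ← hS.value_zero, hvalue]
      exact hb.value_le_best hS ht
  · rw [mergeMap_of_notMem htR] at ha ⊢
    obtain ⟨ha', -, hU, -⟩ := hm.of_mem_enabled ht htR ha
    exact hU.trans_le (b.mdp.le_best _ ha')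

/-- Inside the end component the greatest lower bound belongs to an action that leaves it, because
the lower bounds are justified, and such an action survives. -/
theorem le_best_lower_mergeMap (hm : IsMerge F one zero b c R B r) (hS : Setting M F one zero)
    (hb : b.IsSound M F one zero proj) (hR : b.mdp.IsEC R B) (hone : one ∉ R) (hzero : zero ∉ R)
    (hlower : ∀ s ∈ c.mdp.states, ∀ a ∈ c.mdp.enabled s, 0 ≤ c.L s a)
    (ht : t ∈ b.mdp.states) : b.mdp.best b.L t ≤ c.mdp.best c.L (mergeMap R r t) := by
  have hV := hb.isValid hS.valid
  have hqc := hm.isQuotient hS hb.quot hR hone hzero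
  have hkept : ∀ x ∈ b.mdp.states, ∀ a ∈ b.mdp.enabled x, a ∈ c.mdp.enabled (mergeMap R r x) →
      b.L x a ≤ c.mdp.best c.L (mergeMap R r x) := fun x hx a ha ha' =>
    (hm.trans_mergeMap hV hx ha ha').2.symm.trans_le (c.mdp.le_best _ ha')
  have hnonneg : 0 ≤ c.mdp.best c.L (mergeMap R r t) := by
    obtain ⟨a, ha⟩ := hqc.enabled_nonempty _ (hm.mergeMap_mem ht)
    exact (hlower _ (hm.mergeMap_mem ht) a ha).trans (c.mdp.le_best _ ha)
  by_cases htR : t ∈ R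
  · have hle := (hb.best_le_value hS.valid ht).trans_eq (hm.value_eq hS hb.quot hR hone htR).symm
    rw [mergeMap_of_mem htR] at hnonneg ⊢
    rcases hm.cases with ⟨hr, -⟩ | ⟨rfl, -⟩ | ⟨rfl, -⟩
    · obtain ⟨x, hx, hmax⟩ := R.exists_max_image (b.mdp.best b.L) ⟨t, htR⟩
      refine (hmax t htR).trans ?_
      rcases le_or_gt (b.mdp.best b.L x) 0 with hle | hpos
      · exact hle.trans hnonneg
      · obtain ⟨y, hy, a, ha, hya, u, hu, huR⟩ :=
          hb.justified R hR.states_subset hone _ hpos hmax ⟨x, hx, rfl⟩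
        have haB : a ∉ B := fun haB =>
          huR (hR.closed y hy a haB ha ((PMF.mem_support_iff _ _).2 hu))
        have hkept := hkept y (hR.states_subset hy) a ha
        rw [mergeMap_of_mem hy] at hkept
        exact hya.symm.trans_le (hkept (hm.enabled_of_mem hr y hy a ha haB))
    · obtain ⟨a, ha⟩ := hb.quot.enabled_nonempty _ hb.quot.one_mem
      have ha' := hm.enabled_of_notMem _ hb.quot.one_mem hone a ha
      rw [hS.value_one, ← hb.lower_one a ha,
        ← (hm.of_mem_enabled hb.quot.one_mem hone ha').2.2.2] at hle
      exact hle.trans (c.mdp.le_best _ ha')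
    · rw [hS.value_zero] at hle
      exact hle.trans hnonneg
  · obtain ⟨a, ha, hbest⟩ := b.mdp.exists_eq_best b.L (hb.quot.enabled_nonempty t ht)
    rw [← hbest]
    refine hkept t ht a ha ?_
    rw [mergeMap_of_notMem htR]
    exact hm.enabled_of_notMem t ht htR a ha

theorem isSound (hm : IsMerge F one zero b c R B r) (hS : Setting M F one zero)
    (hb : b.IsSound M F one zero proj) (hR : b.mdp.IsEC R B) (hone : one ∉ R) (hzero : zero ∉ R) :
    c.IsSound M F one zero (mergeMap R r ∘ proj) := by
  have hV := hb.isValid hS.valid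
  have hqc := hm.isQuotient hS hb.quot hR hone hzero
  have howner : ∀ s ∈ c.mdp.states, ∀ a ∈ c.mdp.enabled s, ∃ y ∈ b.mdp.states,
      a ∈ b.mdp.enabled y ∧ c.U s a = b.U y a ∧ c.L s a = b.L y a ∧
      (∀ f, c.mdp.mean s a f = b.mdp.mean y a fun t => f (mergeMap R r t)) ∧
      c.mdp.mean s a (value M F) = b.mdp.mean y a (value M F) := by
    intro s hs a ha
    obtain ⟨y, hy, -, hay, htrans, hU, hL, -⟩ := hm.exists_owner s hs a ha
    have hmean := hm.mean_eq hV hy hay htrans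
    exact ⟨y, hy, hay, hU, hL, hmean, (hmean _).trans
      (MDP.mean_congr fun t _ _ => hm.value_mergeMap hS hb.quot hR hone t)⟩
  have hlower : ∀ s ∈ c.mdp.states, ∀ a ∈ c.mdp.enabled s, 0 ≤ c.L s a := fun s hs a ha => by
    obtain ⟨y, hy, hay, -, hL, -⟩ := howner s hs a ha
    exact (hb.lower_nonneg y hy a hay).trans_eq hL.symm
  have hle : ∀ t ∈ b.mdp.states, b.mdp.best b.L t ≤ c.mdp.best c.L (mergeMap R r t) :=
    fun t => hm.le_best_lower_mergeMap hS hb hR hone hzero hlower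
  refine ⟨hqc, hlower, fun s hs a ha => ?_, fun s hs a ha => ?_, fun s hs a ha => ?_,
    fun s hs a ha => ?_, fun s hs a ha => ?_,
    hm.isJustified hV hR hone hqc.enabled_nonempty hle hb.justified, fun a ha => ?_, fun a ha => ?_⟩
  · obtain ⟨y, hy, hay, -, hL, -, hvalue⟩ := howner s hs a ha
    rw [hL, hvalue]
    exact hb.lower y hy a hay
  · obtain ⟨y, hy, hay, hU, -, -, hvalue⟩ := howner s hs a ha
    rw [hU, hvalue]
    exact hb.upper y hy a hay
  · obtain ⟨y, hy, hay, hU, -⟩ := howner s hs a ha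
    exact hU.trans_le (hb.upper_le_one y hy a hay)
  · obtain ⟨y, hy, hay, hU, -, hmean, -⟩ := howner s hs a ha
    rw [hU, hmean]
    exact (MDP.mean_mono fun t ht _ =>
      hm.best_upper_mergeMap_le hS hb hR hone hzero ht).trans (hb.super y hy a hay)
  · obtain ⟨y, hy, hay, -, hL, hmean, -⟩ := howner s hs a ha
    rw [hL, hmean]
    exact (hb.sub y hy a hay).trans (MDP.mean_mono fun t ht _ => hle t ht)
  · obtain ⟨ha', -, hU, -⟩ := hm.of_mem_enabled hb.quot.zero_mem hzero ha
    rw [hU, hb.upper_zero a ha']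
  · obtain ⟨ha', -, -, hL⟩ := hm.of_mem_enabled hb.quot.one_mem hone ha
    rw [hL, hb.lower_one a ha']

end IsMerge

end Merging

section Identification

open Relation

variable {S A : Type*}

namespace MDP

variable {M : MDP S A} {T R : Finset S} {B : Finset A} {x : S}

/-- All enabled actions of an MDP. -/
def actions (M : MDP S A) : Finset A := M.states.biUnion M.enabled

-- `IsEC` is stated with the classical decidability instance, which is not the one inferred for
-- `Option A`; at that type this lemma stands in for `Finset.mem_biUnion`.
theorem subset_biUnion_enabled (h : ∀ a ∈ B, ∃ s ∈ R, a ∈ M.enabled s) : B ⊆ R.biUnion M.enabled :=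
  fun a ha => Finset.mem_biUnion.2 (h a ha)

theorem mem_explored_enabled (hx : x ∈ T) {a : Option A} :
    a ∈ (M.explored T).enabled x ↔ ∃ a' ∈ M.enabled x, some a' = a := by
  simp only [explored, if_pos hx, Finset.mem_map, Function.Embedding.some_apply]

theorem eq_of_mem_explored_enabled (hx : x ∉ T) {a : Option A}
    (ha : a ∈ (M.explored T).enabled x) {y : S} (hy : (M.explored T).trans x a y ≠ 0) : y = x := by
  obtain rfl : a = none := by simpa only [explored, if_neg hx, Finset.mem_singleton] using ha
  exact (PMF.mem_support_pure_iff _ _).1 ((PMF.mem_support_iff _ _).2 hy)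

theorem IsEC.of_explored (hT : T ⊆ M.states) (hRT : R ⊆ T) {B : Finset (Option A)}
    (h : (M.explored T).IsEC R B) : M.IsEC R (Finset.eraseNone B) where
  states_subset := hRT.trans hT
  actions_subset a ha := by
    obtain ⟨s, hs, hsa⟩ := h.exists_enabled (Finset.mem_eraseNone.1 ha)
    obtain ⟨a', ha', h'⟩ := (mem_explored_enabled (hRT hs)).1 hsa
    exact Finset.mem_biUnion.2 ⟨s, hs, Option.some_injective _ h' ▸ ha'⟩
  nonempty := by
    obtain ⟨a, ha⟩ := h.nonempty
    obtain ⟨s, hs, hsa⟩ := h.exists_enabled ha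
    obtain ⟨a', -, rfl⟩ := (mem_explored_enabled (hRT hs)).1 hsa
    exact ⟨a', Finset.mem_eraseNone.2 ha⟩
  closed s hs a haB ha := h.closed s hs (some a) (Finset.mem_eraseNone.1 haB)
    ((mem_explored_enabled (hRT hs)).2 ⟨a, ha, rfl⟩)
  connected s hs t ht := h.reflTransGen (fun x hx _ _ a haB ha hy => by
    obtain ⟨a', ha', rfl⟩ := (mem_explored_enabled (hRT hx)).1 ha
    exact ⟨a', Finset.mem_eraseNone.2 haB, ha', pos_iff_ne_zero.2 hy⟩) hs ht

theorem IsEC.explored (h : M.IsEC R B) (hRT : R ⊆ T) :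
    (M.explored T).IsEC R (B.map Function.Embedding.some) where
  states_subset _ hs := Finset.mem_union_left _ (hRT hs)
  actions_subset := subset_biUnion_enabled fun a ha => by
    obtain ⟨a', ha', rfl⟩ := Finset.mem_map.1 ha
    obtain ⟨s, hs, hsa⟩ := h.exists_enabled ha'
    exact ⟨s, hs, (mem_explored_enabled (hRT hs)).2 ⟨a', hsa, rfl⟩⟩
  nonempty := h.nonempty.map
  closed s hs a haB ha := by
    obtain ⟨a', ha', rfl⟩ := (mem_explored_enabled (hRT hs)).1 ha
    exact h.closed s hs a' ((Finset.mem_map' _).1 haB) ha'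
  connected s hs t ht := h.reflTransGen (fun x hx _ _ a haB ha hy =>
    ⟨some a, Finset.mem_map_of_mem _ haB, (mem_explored_enabled (hRT hx)).2 ⟨a, ha, rfl⟩,
      pos_iff_ne_zero.2 hy⟩) hs ht

theorem IsEC.subset_of_explored {B : Finset (Option A)} (h : (M.explored T).IsEC R B) (hx : x ∈ R)
    (hxT : x ∈ T) : R ⊆ T := by
  intro y hy
  by_contra hyT
  have hstay : ∀ z, ReflTransGen (fun x y => x ∉ T → y = x) y z → z = y := by
    intro z hz
    induction hz with
    | refl => rfl
    | tail _ hstep ih => exact ih ▸ hstep (ih ▸ hyT)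
  have hxy : x = y := hstay x <| h.reflTransGen
    (fun u _ v _ a _ ha hv hu => eq_of_mem_explored_enabled hu ha hv) hy hx
  exact hyT (hxy ▸ hxT)

theorem IsEC.union {R₁ R₂ : Finset S} {B₁ B₂ : Finset A}
    (hdisj : ∀ s ∈ R₁ ∪ R₂, ∀ t ∈ R₁ ∪ R₂, ∀ a ∈ M.enabled s, a ∈ M.enabled t → s = t)
    (h₁ : M.IsEC R₁ B₁) (h₂ : M.IsEC R₂ B₂) (hx₁ : x ∈ R₁) (hx₂ : x ∈ R₂) :
    M.IsEC (R₁ ∪ R₂) (B₁ ∪ B₂) where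
  states_subset := Finset.union_subset h₁.states_subset h₂.states_subset
  actions_subset := by
    rw [Finset.union_biUnion]
    exact Finset.union_subset_union h₁.actions_subset h₂.actions_subset
  nonempty := h₁.nonempty.mono Finset.subset_union_left
  closed s hs a haB ha := by
    rw [Finset.coe_union]
    rcases Finset.mem_union.1 haB with haB | haB
    · obtain ⟨t, ht, hta⟩ := h₁.exists_enabled haB
      rw [hdisj s hs t (Finset.mem_union_left _ ht) a ha hta]
      exact (h₁.closed t ht a haB hta).trans Set.subset_union_left
    · obtain ⟨t, ht, hta⟩ := h₂.exists_enabled haB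
      rw [hdisj s hs t (Finset.mem_union_right _ ht) a ha hta]
      exact (h₂.closed t ht a haB hta).trans Set.subset_union_right
  connected s hs t ht := by
    let r (x y : S) := ∃ a ∈ B₁ ∪ B₂, a ∈ M.enabled x ∧ 0 < M.trans x a y
    have hconn₁ : ∀ {s t}, s ∈ R₁ → t ∈ R₁ → ReflTransGen r s t := h₁.reflTransGen
      fun _ _ _ _ a ha hax hy => ⟨a, Finset.mem_union_left _ ha, hax, pos_iff_ne_zero.2 hy⟩
    have hconn₂ : ∀ {s t}, s ∈ R₂ → t ∈ R₂ → ReflTransGen r s t := h₂.reflTransGen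
      fun _ _ _ _ a ha hax hy => ⟨a, Finset.mem_union_right _ ha, hax, pos_iff_ne_zero.2 hy⟩
    have hsx := (Finset.mem_union.1 hs).elim (hconn₁ · hx₁) (hconn₂ · hx₂)
    exact hsx.trans ((Finset.mem_union.1 ht).elim (hconn₁ hx₁ ·) (hconn₂ hx₂ ·))

theorem IsMEC.eq {R₁ R₂ : Finset S} {B₁ B₂ : Finset A} (h₁ : M.IsMEC R₁ B₁) (h₂ : M.IsMEC R₂ B₂)
    (hdisj : ∀ s ∈ R₁ ∪ R₂, ∀ t ∈ R₁ ∪ R₂, ∀ a ∈ M.enabled s, a ∈ M.enabled t → s = t)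
    (hx₁ : x ∈ R₁) (hx₂ : x ∈ R₂) : R₁ = R₂ ∧ B₁ = B₂ := by
  have hunion := IsEC.union hdisj h₁.1 h₂.1 hx₁ hx₂
  obtain ⟨hR₁, hB₁⟩ := h₁.2 _ _ hunion Finset.subset_union_left Finset.subset_union_left
  obtain ⟨hR₂, hB₂⟩ := h₂.2 _ _ hunion Finset.subset_union_right Finset.subset_union_right
  exact ⟨hR₁.symm.trans hR₂, hB₁.symm.trans hB₂⟩

theorem finite_setOf_isEC (M : MDP S A) : {P : Finset S × Finset A | M.IsEC P.1 P.2}.Finite :=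
  (M.states.powerset ×ˢ M.actions.powerset).finite_toSet.subset fun _ hP =>
    Finset.mem_product.2 ⟨Finset.mem_powerset.2 hP.states_subset, Finset.mem_powerset.2
      (hP.actions_subset.trans (Finset.biUnion_subset_biUnion_of_subset_left _ hP.states_subset))⟩

theorem IsEC.exists_isMEC (h : M.IsEC R B) : ∃ R' B', R ⊆ R' ∧ M.IsMEC R' B' := by
  obtain ⟨⟨R', B'⟩, hle, hmax⟩ := M.finite_setOf_isEC.exists_le_maximal (a := (R, B)) h
  refine ⟨R', B', hle.1, hmax.prop, fun R'' B'' h' hR hB => ?_⟩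
  have hle' := hmax.le_of_ge (y := (R'', B'')) h' ⟨hR, hB⟩
  exact ⟨hle'.1.antisymm hR, hle'.2.antisymm hB⟩

theorem mem_identifyECs {P : Finset S × Finset A} :
    P ∈ M.identifyECs T ↔
      ∃ B, P.1 ⊆ T ∧ (M.explored T).IsMEC P.1 B ∧ P.2 = Finset.eraseNone B := by
  simp only [identifyECs, Finset.mem_image, Finset.mem_filter, Finset.mem_product,
    Finset.mem_powerset]
  constructor
  · rintro ⟨⟨R, B⟩, ⟨⟨hR, -⟩, hmec⟩, rfl⟩
    exact ⟨B, hR, hmec, rfl⟩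
  · rintro ⟨B, hR, hmec, hB⟩
    refine ⟨(P.1, B), ⟨⟨hR, fun a ha => ?_⟩, hmec⟩, Prod.ext rfl hB.symm⟩
    obtain ⟨s, hs, hsa⟩ := hmec.1.exists_enabled ha
    exact Finset.mem_biUnion.2 ⟨s, hR hs, hsa⟩

theorem isEC_of_mem_identifyECs (hT : T ⊆ M.states) {P : Finset S × Finset A}
    (hP : P ∈ M.identifyECs T) : M.IsEC P.1 P.2 ∧ P.1 ⊆ T := by
  obtain ⟨B, hR, hmec, hB⟩ := mem_identifyECs.1 hP
  rw [hB]
  exact ⟨hmec.1.of_explored hT hR, hR⟩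

theorem IsValid.disjoint_of_mem_identifyECs (hM : M.IsValid) (hT : T ⊆ M.states)
    {P Q : Finset S × Finset A} (hP : P ∈ M.identifyECs T) (hQ : Q ∈ M.identifyECs T)
    (hPQ : P ≠ Q) : Disjoint P.1 Q.1 := by
  obtain ⟨B, hPT, hmecP, hB⟩ := mem_identifyECs.1 hP
  obtain ⟨C, hQT, hmecQ, hC⟩ := mem_identifyECs.1 hQ
  rw [Finset.disjoint_left]
  intro x hxP hxQ
  have hdisj : ∀ s ∈ P.1 ∪ Q.1, ∀ t ∈ P.1 ∪ Q.1, ∀ a ∈ (M.explored T).enabled s,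
      a ∈ (M.explored T).enabled t → s = t := by
    intro s hs t ht a hsa hta
    have hs' := Finset.union_subset hPT hQT hs
    have ht' := Finset.union_subset hPT hQT ht
    obtain ⟨a₁, ha₁, rfl⟩ := (mem_explored_enabled hs').1 hsa
    obtain ⟨a₂, ha₂, h⟩ := (mem_explored_enabled ht').1 hta
    exact hM.eq_of_mem_enabled (hT hs') (hT ht') ha₁ (Option.some_injective _ h ▸ ha₂)
  obtain ⟨hstates, hactions⟩ := hmecP.eq hmecQ hdisj hxP hxQ
  exact hPQ (Prod.ext hstates (by rw [hB, hC, hactions]))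

theorem IsEC.identifyECs_nonempty (h : M.IsEC R B) (hRT : R ⊆ T) : (M.identifyECs T).Nonempty := by
  obtain ⟨R', B', hRR', hmec⟩ := (h.explored hRT).exists_isMEC
  obtain ⟨x, hx⟩ := h.states_nonempty
  exact ⟨(R', Finset.eraseNone B'), mem_identifyECs.2
    ⟨B', hmec.1.subset_of_explored (hRR' hx) (hRT hx), hmec, rfl⟩⟩

end MDP

variable {M : MDP S A} {F : Set S} {one zero : S} {b c : Bounds S A} {proj : S → S}
  {R T : Finset S} {B : Finset A} {r : S}

theorem IsMerge.isEC (hm : IsMerge F one zero b c R B r) {Q : Finset S} {C : Finset A}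
    (hQ : b.mdp.IsEC Q C) (hdisj : Disjoint R Q) : c.mdp.IsEC Q C := by
  have hQR : ∀ {q}, q ∈ Q → q ∉ R := fun hq hqR => Finset.disjoint_left.1 hdisj hqR hq
  have henabled : ∀ {q a}, q ∈ Q → a ∈ b.mdp.enabled q → a ∈ c.mdp.enabled q := fun hq ha =>
    hm.enabled_of_notMem _ (hQ.states_subset hq) (hQR hq) _ ha
  have hback : ∀ {q a}, q ∈ Q → a ∈ c.mdp.enabled q →
      a ∈ b.mdp.enabled q ∧ c.mdp.trans q a = (b.mdp.trans q a).map (mergeMap R r) :=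
    fun hq ha => (hm.of_mem_enabled (hQ.states_subset hq) (hQR hq) ha).imp_right And.left
  refine ⟨fun q hq => (hm.mem_states q).2 (Or.inr ⟨hQ.states_subset hq, hQR hq⟩), fun a ha => ?_,
    hQ.nonempty, fun s hs a haC ha t ht => ?_, fun s hs t ht =>
      hQ.reflTransGen (fun x hx y hy a haC ha hxy => ⟨a, haC, henabled hx ha, ?_⟩) hs ht⟩
  · obtain ⟨s, hs, hsa⟩ := hQ.exists_enabled ha
    exact Finset.mem_biUnion.2 ⟨s, hs, henabled hs hsa⟩
  · obtain ⟨hab, htrans⟩ := hback hs ha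
    rw [htrans, PMF.mem_support_map_iff] at ht
    obtain ⟨t', ht', rfl⟩ := ht
    have htQ : t' ∈ Q := hQ.closed s hs a haC hab ht'
    exact (mergeMap_of_notMem (hQR htQ)).symm ▸ htQ
  · rw [(hback hx (henabled hx ha)).2, pos_iff_ne_zero, pmf_map_apply_ne_zero_iff]
    exact ⟨y, hxy, mergeMap_of_notMem (hQR hy)⟩

theorem IsMerge.card_actions_lt (hm : IsMerge F one zero b c R B r) (hV : b.mdp.IsValid)
    (hR : b.mdp.IsEC R B) : c.mdp.actions.card < b.mdp.actions.card := by
  refine Finset.card_lt_card ((Finset.ssubset_iff_of_subset fun a ha => ?_).2 ?_)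
  · obtain ⟨s, hs, hsa⟩ := Finset.mem_biUnion.1 ha
    obtain ⟨y, hy, -, hay, -⟩ := hm.exists_owner s hs a hsa
    exact Finset.mem_biUnion.2 ⟨y, hy, hay⟩
  · obtain ⟨a, ha⟩ := hR.nonempty
    obtain ⟨x, hx, hxa⟩ := hR.exists_enabled ha
    refine ⟨a, Finset.mem_biUnion.2 ⟨x, hR.states_subset hx, hxa⟩, fun h => ?_⟩
    obtain ⟨s, hs, hsa⟩ := Finset.mem_biUnion.1 h
    obtain ⟨y, hy, -, hay, -, -, -, hyR⟩ := hm.exists_owner s hs a hsa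
    have hxy := hV.eq_of_mem_enabled hy (hR.states_subset hx) hay hxa
    exact (hyR (hxy ▸ hx)).2 ha

namespace Bounds.IsSound

variable [Countable S] [Countable A]

theorem foldl_processEC (hS : Setting M F one zero) (hb : b.IsSound M F one zero proj)
    (l : List (Finset S × Finset A)) (hl : l.Pairwise fun P Q => Disjoint P.1 Q.1)
    (hEC : ∀ P ∈ l, b.mdp.IsEC P.1 P.2 ∧ one ∉ P.1 ∧ zero ∉ P.1) :
    ∃ proj', (l.foldl (processEC F one zero) b).IsSound M F one zero proj' ∧
      (l ≠ [] → (l.foldl (processEC F one zero) b).mdp.actions.card < b.mdp.actions.card) := by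
  induction l generalizing b proj with
  | nil => exact ⟨proj, hb, fun h => absurd rfl h⟩
  | cons P l ih =>
    rw [List.pairwise_cons] at hl
    obtain ⟨hP, honeP, hzeroP⟩ := hEC P List.mem_cons_self
    have hV := hb.isValid hS.valid
    obtain ⟨r, hm⟩ := isMerge_processEC F hV hb.quot.one_mem hb.quot.zero_mem hP honeP hzeroP
    obtain ⟨proj', hsound, hcard⟩ := ih (hm.isSound hS hb hP honeP hzeroP) hl.2 fun Q hQ =>
      (hEC Q (List.mem_cons_of_mem _ hQ)).imp_left fun hQ' => hm.isEC hQ' (hl.1 Q hQ)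
    have hlt := hm.card_actions_lt hV hP
    refine ⟨proj', hsound, fun _ => ?_⟩
    rw [List.foldl_cons]
    rcases eq_or_ne l [] with rfl | hnil
    exacts [hlt, (hcard hnil).trans hlt]

theorem onTheFlyEC (hS : Setting M F one zero) (hb : b.IsSound M F one zero proj)
    (hT : T ⊆ b.mdp.states) (hone : one ∉ T) (hzero : zero ∉ T) :
    (∃ proj', (b.onTheFlyEC F one zero T).IsSound M F one zero proj') ∧
      ((b.mdp.identifyECs T = ∅ ∧ b.onTheFlyEC F one zero T = b) ∨
        (b.onTheFlyEC F one zero T).mdp.actions.card < b.mdp.actions.card) := by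
  have hEC : ∀ P ∈ (b.mdp.identifyECs T).toList,
      b.mdp.IsEC P.1 P.2 ∧ one ∉ P.1 ∧ zero ∉ P.1 := fun P hP => by
    obtain ⟨h, hPT⟩ := MDP.isEC_of_mem_identifyECs hT (Finset.mem_toList.1 hP)
    exact ⟨h, fun h => hone (hPT h), fun h => hzero (hPT h)⟩
  have hdisj : (b.mdp.identifyECs T).toList.Pairwise fun P Q => Disjoint P.1 Q.1 :=
    List.Pairwise.imp_of_mem (fun hP hQ hne => (hb.isValid hS.valid).disjoint_of_mem_identifyECs hT
      (Finset.mem_toList.1 hP) (Finset.mem_toList.1 hQ) hne) (Finset.nodup_toList _)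
  obtain ⟨proj', hsound, hcard⟩ := hb.foldl_processEC hS _ hdisj hEC
  refine ⟨⟨proj', hsound⟩, ?_⟩
  by_cases hE : b.mdp.identifyECs T = ∅
  · refine Or.inl ⟨hE, ?_⟩
    rw [Bounds.onTheFlyEC, hE, Finset.toList_empty, List.foldl_nil]
  · exact Or.inr (hcard fun h => hE (Finset.toList_eq_nil.1 h))

end Bounds.IsSound

end Identification

section Configurations

variable {S A : Type*}

theorem MDP.mem_bestActions {M : MDP S A} {f : S → A → ℝ} {s : S} {a : A} :
    a ∈ M.bestActions f s ↔ a ∈ M.enabled s ∧ f s a = M.best f s := by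
  simp only [bestActions, Finset.mem_filter]

namespace Config

variable {F : Set S} {one zero : S} {ε : ℝ} {k : ℕ → ℕ} {c d : Config S A} {a : A} {t : S}

/-- The states visited by the current simulation. -/
def visited (c : Config S A) : Finset S := (c.last :: c.path.map Move.state).toFinset

/-- The three kinds of steps: the path is extended, or it is long enough and end components are
processed, or a terminal state has been reached and the bounds are updated. -/
inductive Step (F : Set S) (one zero : S) (ε : ℝ) (k : ℕ → ℕ) (c : Config S A) (a : A) (t : S) :
    Config S A → Prop
  | extend (hlen : c.path.length + 2 < k c.iter) (h1 : t ≠ one) (h0 : t ≠ zero) :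
      Step F one zero ε k c a t { c with path := ⟨c.last, a⟩ :: c.path, last := t }
  | timeout (hlen : c.path.length + 2 = k c.iter) :
      Step F one zero ε k c a t
        (begin (c.bounds.onTheFlyEC F one zero c.visited) (c.iter + 1) false)
  | update (hlen : c.path.length + 2 < k c.iter) (ht : t = one ∨ t = zero) :
      Step F one zero ε k c a t (begin ((⟨c.last, a⟩ :: c.path).foldl Bounds.update c.bounds)
        (c.iter + 1) (decide (((⟨c.last, a⟩ :: c.path).foldl Bounds.update c.bounds).gap < ε)))

theorem step_advance (h : c.path.length + 1 < k c.iter) (a : A) (t : S) :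
    c.Step F one zero ε k a t (c.advance F one zero ε k a t) := by
  simp only [advance, List.length_cons]
  split_ifs with hlen ht
  · exact .timeout hlen
  · exact .update (by lia) ht
  · exact .extend (by lia) (fun h => ht (.inl h)) fun h => ht (.inr h)

theorem path_ne_nil_of_timeout (hk : ∀ i, 3 ≤ k i) (hlen : c.path.length + 2 = k c.iter) :
    c.path ≠ [] := by
  intro h
  have := hk c.iter
  simp only [h, List.length_nil] at hlen
  lia

theorem mem_support_next (hc : c.halted = false)
    (hne : (c.bounds.mdp.bestActions c.bounds.U c.last).Nonempty) :
    d ∈ (c.next F one zero ε k).support ↔ ∃ a ∈ c.bounds.mdp.bestActions c.bounds.U c.last,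
      ∃ t, c.bounds.mdp.trans c.last a t ≠ 0 ∧ d = c.advance F one zero ε k a t := by
  rw [next, dif_pos ⟨hc, hne⟩, PMF.mem_support_bind_iff]
  simp only [PMF.mem_support_uniformOfFinset_iff, PMF.mem_support_map_iff]
  simp only [PMF.mem_support_iff, eq_comm (a := d)]

theorem le_next_advance (hc : c.halted = false)
    (ha : a ∈ c.bounds.mdp.bestActions c.bounds.U c.last) (t : S) :
    ((c.bounds.mdp.enabled c.last).card : ENNReal)⁻¹ * c.bounds.mdp.trans c.last a t ≤
      c.next F one zero ε k (c.advance F one zero ε k a t) := by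
  rw [next, dif_pos ⟨hc, ⟨a, ha⟩⟩, PMF.bind_apply]
  refine le_trans ?_ (ENNReal.le_tsum a)
  rw [PMF.uniformOfFinset_apply_of_mem _ ha]
  gcongr
  · exact Finset.filter_subset _ _
  · rw [PMF.map_apply]
    exact le_of_eq_of_le (if_pos rfl).symm (ENNReal.le_tsum t)

end Config

variable [Countable S] [Countable A]

/-- The invariant of the configurations of the algorithm. -/
structure Config.IsSound (M : MDP S A) (F : Set S) (one zero : S) (ε : ℝ) (k : ℕ → ℕ)
    (c : Config S A) : Prop where
  bounds : ∃ proj, c.bounds.IsSound M F one zero proj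
  halted : c.halted = true → c.bounds.gap < ε
  path : ∀ m ∈ c.path, m.state ∈ c.bounds.mdp.states ∧ m.action ∈ c.bounds.mdp.enabled m.state ∧
    m.state ≠ one ∧ m.state ≠ zero
  last_mem : c.last ∈ c.bounds.mdp.states
  last_eq_start : c.path = [] → c.last = c.bounds.mdp.start
  last_nonterminal : c.path ≠ [] → c.last ≠ one ∧ c.last ≠ zero
  length_lt : c.path.length + 1 < k c.iter

variable {M : MDP S A} {F : Set S} {one zero : S} {ε : ℝ} {k : ℕ → ℕ} {c d : Config S A} {a : A}
  {t : S}

namespace Config.IsSound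

theorem begin (hM : M.IsValid) (hk : ∀ i, 3 ≤ k i) {b : Bounds S A} {proj : S → S}
    (hb : b.IsSound M F one zero proj) (i : ℕ) {h : Bool} (hh : h = true → b.gap < ε) :
    (Config.begin b i h).IsSound M F one zero ε k where
  bounds := ⟨proj, hb⟩
  halted := hh
  path := by simp [Config.begin]
  last_mem := (hb.isValid hM).start_mem
  last_eq_start _ := rfl
  last_nonterminal h := (h rfl).elim
  length_lt := (hk i).trans_lt' (by simp [Config.begin])

theorem bestActions_nonempty (hc : c.IsSound M F one zero ε k) {s : S}
    (hs : s ∈ c.bounds.mdp.states) : (c.bounds.mdp.bestActions c.bounds.U s).Nonempty := by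
  obtain ⟨proj, hb⟩ := hc.bounds
  obtain ⟨a, ha, h⟩ := c.bounds.mdp.exists_eq_best c.bounds.U (hb.quot.enabled_nonempty _ hs)
  exact ⟨a, MDP.mem_bestActions.2 ⟨ha, h⟩⟩

theorem visited_subset (hc : c.IsSound M F one zero ε k) : c.visited ⊆ c.bounds.mdp.states := by
  intro s hs
  simp only [visited, List.mem_toFinset, List.mem_cons, List.mem_map] at hs
  obtain rfl | ⟨m, hm, rfl⟩ := hs
  exacts [hc.last_mem, (hc.path m hm).1]

theorem nonterminal_of_mem_visited (hc : c.IsSound M F one zero ε k) (hpath : c.path ≠ []) {s : S}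
    (hs : s ∈ c.visited) : s ≠ one ∧ s ≠ zero := by
  simp only [visited, List.mem_toFinset, List.mem_cons, List.mem_map] at hs
  obtain rfl | ⟨m, hm, rfl⟩ := hs
  exacts [hc.last_nonterminal hpath, (hc.path m hm).2.2]

theorem onTheFlyEC (hS : Setting M F one zero) (hk : ∀ i, 3 ≤ k i)
    (hc : c.IsSound M F one zero ε k) (hlen : c.path.length + 2 = k c.iter) :
    (∃ proj, (c.bounds.onTheFlyEC F one zero c.visited).IsSound M F one zero proj) ∧
      ((c.bounds.mdp.identifyECs c.visited = ∅ ∧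
          c.bounds.onTheFlyEC F one zero c.visited = c.bounds) ∨
        (c.bounds.onTheFlyEC F one zero c.visited).mdp.actions.card <
          c.bounds.mdp.actions.card) := by
  obtain ⟨proj, hb⟩ := hc.bounds
  have hpath := path_ne_nil_of_timeout hk hlen
  exact hb.onTheFlyEC hS hc.visited_subset (fun h => (hc.nonterminal_of_mem_visited hpath h).1 rfl)
    fun h => (hc.nonterminal_of_mem_visited hpath h).2 rfl

theorem extend (hS : Setting M F one zero) (hc : c.IsSound M F one zero ε k)
    (hhalt : c.halted = false) (ha : a ∈ c.bounds.mdp.enabled c.last)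
    (ht : c.bounds.mdp.trans c.last a t ≠ 0) (hlen : c.path.length + 2 < k c.iter) (h1 : t ≠ one)
    (h0 : t ≠ zero) :
    IsSound M F one zero ε k { c with path := ⟨c.last, a⟩ :: c.path, last := t } := by
  obtain ⟨proj, hb⟩ := hc.bounds
  have hlast : c.last ≠ one ∧ c.last ≠ zero := by
    constructor <;> intro h <;> rw [h] at ha ht
    · exact h1 ((hb.quot.one_isTerminal hS).eq_of_trans_ne_zero ha ht)
    · exact h0 ((hb.quot.zero_isTerminal hS).eq_of_trans_ne_zero ha ht)
  exact {
    bounds := ⟨proj, hb⟩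
    halted := fun h => by simp [hhalt] at h
    path := List.forall_mem_cons.2 ⟨⟨hc.last_mem, ha, hlast⟩, hc.path⟩
    last_mem := (hb.isValid hS.valid).mem_states hc.last_mem ha ht
    last_eq_start := fun h => (List.cons_ne_nil _ _ h).elim
    last_nonterminal := fun _ => ⟨h1, h0⟩
    length_lt := hlen }

theorem advance (hS : Setting M F one zero) (hk : ∀ i, 3 ≤ k i)
    (hc : c.IsSound M F one zero ε k) (hhalt : c.halted = false)
    (ha : a ∈ c.bounds.mdp.enabled c.last) (ht : c.bounds.mdp.trans c.last a t ≠ 0) :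
    (c.advance F one zero ε k a t).IsSound M F one zero ε k := by
  obtain ⟨proj, hb⟩ := hc.bounds
  have hstep := step_advance (F := F) (one := one) (zero := zero) (ε := ε) hc.length_lt a t
  generalize c.advance F one zero ε k a t = d at hstep ⊢
  cases hstep with
  | extend hlen h1 h0 => exact hc.extend hS hhalt ha ht hlen h1 h0
  | timeout hlen =>
    obtain ⟨⟨proj', hb'⟩, -⟩ := hc.onTheFlyEC hS hk hlen
    exact begin hS.valid hk hb' _ nofun
  | update hlen ht => exact begin hS.valid hk (hb.foldl_update hS _) _ of_decide_eq_true

theorem next (hS : Setting M F one zero) (hk : ∀ i, 3 ≤ k i) (hc : c.IsSound M F one zero ε k)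
    (hd : d ∈ (c.next F one zero ε k).support) : d.IsSound M F one zero ε k := by
  by_cases hhalt : c.halted = false
  · obtain ⟨a, ha, t, ht, rfl⟩ :=
      (mem_support_next hhalt (hc.bestActions_nonempty hc.last_mem)).1 hd
    exact hc.advance hS hk hhalt (MDP.mem_bestActions.1 ha).1 ht
  · rw [Config.next, dif_neg (fun h => hhalt h.1), PMF.support_pure, Set.mem_singleton_iff] at hd
    exact hd ▸ hc

theorem isCorrect (hS : Setting M F one zero) (hc : c.IsSound M F one zero ε k)
    (hhalt : c.halted = true) : c.bounds.IsCorrect M F ε := by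
  obtain ⟨proj, hb⟩ := hc.bounds
  have hstart := (hb.isValid hS.valid).start_mem
  have hvalue : value M F c.bounds.mdp.start = value M F M.start := by
    rw [hb.quot.start_eq, hb.quot.value_proj _ hS.valid.start_mem]
  refine ⟨fun a ha => ?_, ?_, ?_, hc.halted hhalt⟩
  · obtain ⟨x, hx, hxs, hax, -⟩ := hb.quot.exists_owner _ hstart a ha
    have hmean : c.bounds.mdp.mean c.bounds.mdp.start a (value M F) = actionValue M F x a :=
      hxs ▸ hb.quot.mean_value_eq hS.valid hx hax (hxs ▸ ha)
    exact ⟨x, hx, hax, hmean ▸ hb.lower _ hstart a ha, hmean ▸ hb.upper _ hstart a ha⟩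
  · exact hvalue ▸ hb.best_le_value hS.valid hstart
  · exact hvalue ▸ hb.value_le_best hS hstart

end Config.IsSound

end Configurations

section RunMeasure

open Filter

variable {S A : Type*}

/-- The configurations that can occur at time `n`. All sets of configurations are measurable, but
the σ-algebra of pairs of them is that of the product, hence the role of countability. -/
def reachable (M : MDP S A) (F : Set S) (one zero : S) (ε : ℝ) (k : ℕ → ℕ) :
    ℕ → Set (Config S A)
  | 0 => {Config.begin (Bounds.first M one zero) 0 false}
  | n + 1 => ⋃ c ∈ reachable M F one zero ε k n, (c.next F one zero ε k).support

variable (M : MDP S A) (F : Set S) (one zero : S) (ε : ℝ) (k : ℕ → ℕ)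

theorem countable_reachable : ∀ n, (reachable M F one zero ε k n).Countable
  | 0 => Set.countable_singleton _
  | n + 1 => (countable_reachable n).biUnion fun c _ => c.next F one zero ε k |>.support_countable

instance : DiscreteMeasurableSpace (Config S A) := ⟨fun _ => trivial⟩

theorem measurableSet_step {C : Set (Config S A)} (hC : C.Countable)
    (D : Config S A → Set (Config S A)) (n : ℕ) :
    MeasurableSet {p : ((i : Finset.Iic n) → Config S A) × Config S A |
      p.1 ⟨n, Finset.mem_Iic.2 le_rfl⟩ ∈ C ∧ p.2 ∈ D (p.1 ⟨n, Finset.mem_Iic.2 le_rfl⟩)} := by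
  have hcurrent : Measurable fun p : ((i : Finset.Iic n) → Config S A) × Config S A =>
      p.1 ⟨n, Finset.mem_Iic.2 le_rfl⟩ := (measurable_pi_apply _).comp measurable_fst
  have hunion : {p : ((i : Finset.Iic n) → Config S A) × Config S A |
      p.1 ⟨n, Finset.mem_Iic.2 le_rfl⟩ ∈ C ∧ p.2 ∈ D (p.1 ⟨n, Finset.mem_Iic.2 le_rfl⟩)} =
      ⋃ c ∈ C, (fun p : ((i : Finset.Iic n) → Config S A) × Config S A =>
        p.1 ⟨n, Finset.mem_Iic.2 le_rfl⟩) ⁻¹' {c} ∩ Prod.snd ⁻¹' D c := by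
    ext p
    simp
  rw [hunion]
  exact .biUnion hC fun c _ => (hcurrent (.singleton c)).inter (measurable_snd .of_discrete)

theorem ae_run_zero : ∀ᵐ run ∂(runMeasure M F one zero ε k),
    run 0 = Config.begin (Bounds.first M one zero) 0 false :=
  ae_trajMeasure_zero (X := fun _ => Config S A) _ _
    (p := fun c => c = Config.begin (Bounds.first M one zero) 0 false)
    ((ae_dirac_iff .of_discrete).2 rfl)

variable {M F one zero ε k} in
theorem ae_run_succ {n : ℕ}
    (hn : ∀ᵐ run ∂(runMeasure M F one zero ε k), run n ∈ reachable M F one zero ε k n) :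
    ∀ᵐ run ∂(runMeasure M F one zero ε k), run (n + 1) ∈ ((run n).next F one zero ε k).support := by
  have hstep := (ae_trajMeasure_succ_iff (X := fun _ => Config S A)
    (Measure.dirac (Config.begin (Bounds.first M one zero) 0 false)) (runKernel F one zero ε k) n
    (measurableSet_step (countable_reachable M F one zero ε k n)
      (fun c => (c.next F one zero ε k).support) n)).2 <| hn.mono fun run hrun => by
    change ∀ᵐ d ∂((run n).next F one zero ε k).toMeasure, run n ∈ _ ∧ d ∈ _
    rw [ae_iff, PMF.toMeasure_apply_eq_zero_iff _ .of_discrete, Set.disjoint_left]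
    exact fun d hd hd' => hd' ⟨hrun, hd⟩
  exact hstep.mono fun run hrun => hrun.2

theorem ae_mem_reachable (n : ℕ) :
    ∀ᵐ run ∂(runMeasure M F one zero ε k), run n ∈ reachable M F one zero ε k n := by
  induction n with
  | zero => exact ae_run_zero M F one zero ε k
  | succ n ih =>
    filter_upwards [ih, ae_run_succ ih] with run h h'
    exact Set.mem_biUnion h h'

theorem ae_frequently_advance (P : Config S A → Prop) (a : A) (t : S) {δ : ℝ} (hδ : 0 < δ) :
    ∀ᵐ run ∂(runMeasure M F one zero ε k),
      (∃ᶠ n in atTop, P (run n) ∧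
        δ ≤ ((run n).next F one zero ε k ((run n).advance F one zero ε k a t)).toReal) →
      ∃ᶠ n in atTop, P (run n) ∧ run (n + 1) = (run n).advance F one zero ε k a t := by
  have hfreq := ae_frequently_trajMeasure (X := fun _ => Config S A)
    (Measure.dirac (Config.begin (Bounds.first M one zero) 0 false)) (runKernel F one zero ε k)
    (fun n => {x | x ⟨n, Finset.mem_Iic.2 le_rfl⟩ ∈ reachable M F one zero ε k n ∧
      P (x ⟨n, Finset.mem_Iic.2 le_rfl⟩) ∧ δ ≤ ((x ⟨n, Finset.mem_Iic.2 le_rfl⟩).next F one zero ε k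
        ((x ⟨n, Finset.mem_Iic.2 le_rfl⟩).advance F one zero ε k a t)).toReal})
    _ (fun n => measurableSet_step (countable_reachable M F one zero ε k n)
      (fun c => {d | P c ∧ d = c.advance F one zero ε k a t}) n) hδ ?_
  · filter_upwards [hfreq, ae_all_iff.2 (ae_mem_reachable M F one zero ε k)] with run h hmem hrun
    exact (h (hrun.mono fun n hn => ⟨hmem n, hn⟩)).mono fun n hn => hn.2
  · rintro n x ⟨hx, hP, hle⟩
    rw [← PMF.toMeasure_apply_singleton _ _ (.singleton _)] at hle
    exact hle.trans (measureReal_mono fun d hd => ⟨hx, hP, hd⟩)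

end RunMeasure

section Policies

variable {S A : Type*}

namespace MDP

variable {M : MDP S A} {ρ : Finset (Move S A)} {one zero x y z : S} {p q : List (Move S A)}

/-- A path of `M` from `x` to `y` whose moves belong to `ρ`. As in `Config`, the list of its moves
starts with the most recent one. -/
inductive IsPath (M : MDP S A) (ρ : Finset (Move S A)) (x : S) : List (Move S A) → S → Prop
  | nil : IsPath M ρ x [] x
  | cons {p : List (Move S A)} {s t : S} {a : A} (hp : IsPath M ρ x p s) (ha : ⟨s, a⟩ ∈ ρ)
      (ht : M.trans s a t ≠ 0) : IsPath M ρ x (⟨s, a⟩ :: p) t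

/-- Reachability by moves of `ρ`. -/
def Reaches (M : MDP S A) (ρ : Finset (Move S A)) (x y : S) : Prop := ∃ p, M.IsPath ρ x p y

/-- A nonempty choice of enabled actions at each of the nonterminal states of `M`, given by the set
of the chosen moves. -/
structure IsPolicy (M : MDP S A) (one zero : S) (ρ : Finset (Move S A)) : Prop where
  state_mem : ∀ m ∈ ρ, m.state ∈ M.states
  action_mem : ∀ m ∈ ρ, m.action ∈ M.enabled m.state
  nonterminal : ∀ m ∈ ρ, m.state ≠ one ∧ m.state ≠ zero
  exists_move : ∀ s ∈ M.states, s ≠ one → s ≠ zero → ∃ a, ⟨s, a⟩ ∈ ρ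

theorem IsPath.mem_policy (hp : M.IsPath ρ x p y) : ∀ m ∈ p, m ∈ ρ := by
  induction hp with
  | nil => exact nofun
  | cons _ ha _ ih => exact List.forall_mem_cons.2 ⟨ha, ih⟩

theorem IsPath.append (hp : M.IsPath ρ x p y) (hq : M.IsPath ρ y q z) :
    M.IsPath ρ x (q ++ p) z := by
  induction hq with
  | nil => exact hp
  | cons _ ha ht ih => exact ih.cons ha ht

theorem IsPath.start_mem (hp : M.IsPath ρ x p y) : x ∈ y :: p.map Move.state := by
  induction hp with
  | nil => exact List.mem_cons_self
  | cons _ _ _ ih => exact List.mem_cons_of_mem _ ih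

theorem IsPath.exists_suffix (hp : M.IsPath ρ x p y) (hz : z ∈ y :: p.map Move.state) :
    ∃ q, M.IsPath ρ x q z ∧ z :: q.map Move.state <:+ y :: p.map Move.state := by
  induction hp with
  | nil =>
    obtain rfl := List.mem_singleton.1 hz
    exact ⟨[], .nil, List.suffix_rfl⟩
  | @cons p s t a hp ha ht ih =>
    obtain rfl | hz := List.mem_cons.1 hz
    · exact ⟨_, hp.cons ha ht, List.suffix_rfl⟩
    · obtain ⟨q, hq, hsuffix⟩ := ih hz
      exact ⟨q, hq, hsuffix.trans (List.suffix_cons _ _)⟩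

theorem Reaches.refl : M.Reaches ρ x x := ⟨[], .nil⟩

theorem Reaches.trans (h : M.Reaches ρ x y) (h' : M.Reaches ρ y z) : M.Reaches ρ x z :=
  let ⟨_, hp⟩ := h
  let ⟨_, hq⟩ := h'
  ⟨_, hp.append hq⟩

theorem Reaches.tail {a : A} (h : M.Reaches ρ x y) (ha : ⟨y, a⟩ ∈ ρ) (hz : M.trans y a z ≠ 0) :
    M.Reaches ρ x z :=
  let ⟨_, hp⟩ := h
  ⟨_, hp.cons ha hz⟩

theorem Reaches.exists_nodup (h : M.Reaches ρ x y) :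
    ∃ p, M.IsPath ρ x p y ∧ (y :: p.map Move.state).Nodup := by
  obtain ⟨p, hp⟩ := h
  induction hp with
  | nil => exact ⟨[], .nil, List.nodup_singleton _⟩
  | @cons _ s t a _ ha ht ih =>
    obtain ⟨p, hp, hnodup⟩ := ih
    by_cases hmem : t ∈ s :: p.map Move.state
    · obtain ⟨q, hq, hsuffix⟩ := hp.exists_suffix hmem
      exact ⟨q, hq, hnodup.sublist hsuffix.sublist⟩
    · exact ⟨_, hp.cons ha ht, List.nodup_cons.2 ⟨hmem, hnodup⟩⟩

namespace IsPolicy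

theorem path_mem_states (hM : M.IsValid) (hρ : M.IsPolicy one zero ρ) (hx : x ∈ M.states)
    (hp : M.IsPath ρ x p y) : ∀ s ∈ y :: p.map Move.state, s ∈ M.states := by
  induction hp with
  | nil => simpa using hx
  | cons _ ha ht ih =>
    exact List.forall_mem_cons.2
      ⟨hM.mem_states (hρ.state_mem _ ha) (hρ.action_mem _ ha) ht, ih⟩

theorem mem_states (hM : M.IsValid) (hρ : M.IsPolicy one zero ρ) (hx : x ∈ M.states)
    (h : M.Reaches ρ x y) : y ∈ M.states :=
  let ⟨_, hp⟩ := h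
  hρ.path_mem_states hM hx hp _ List.mem_cons_self

theorem exists_isPath_length_lt (hM : M.IsValid) (hρ : M.IsPolicy one zero ρ) (hx : x ∈ M.states)
    (h : M.Reaches ρ x y) : ∃ p, M.IsPath ρ x p y ∧ p.length < M.states.card := by
  obtain ⟨p, hp, hnodup⟩ := h.exists_nodup
  refine ⟨p, hp, ?_⟩
  have hcard := Finset.card_le_card (s := (y :: p.map Move.state).toFinset) (t := M.states)
    fun s hs => hρ.path_mem_states hM hx hp s (List.mem_toFinset.1 hs)
  rwa [List.toFinset_card_of_nodup hnodup, List.length_cons, List.length_map] at hcard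

/-- A state with the fewest reachable states lies in a bottom strongly connected component. -/
theorem exists_recurrent (hM : M.IsValid) (hρ : M.IsPolicy one zero ρ) (hx : x ∈ M.states) :
    ∃ y, M.Reaches ρ x y ∧ ∀ z, M.Reaches ρ y z → M.Reaches ρ z y := by
  obtain ⟨y, hy, hmin⟩ := (M.states.filter (M.Reaches ρ x)).exists_min_image
    (fun y => (M.states.filter (M.Reaches ρ y)).card) ⟨x, Finset.mem_filter.2 ⟨hx, .refl⟩⟩
  obtain ⟨hy, hxy⟩ := Finset.mem_filter.1 hy
  refine ⟨y, hxy, fun z hyz => ?_⟩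
  have hsubset : M.states.filter (M.Reaches ρ z) ⊆ M.states.filter (M.Reaches ρ y) :=
    Finset.monotone_filter_right _ fun _ _ h => hyz.trans h
  have heq := Finset.eq_of_subset_of_card_le hsubset
    (hmin z (Finset.mem_filter.2 ⟨hρ.mem_states hM hy hyz, hxy.trans hyz⟩))
  exact (Finset.filter_inj'.1 heq hy).2 .refl

theorem isEC_filter_reaches (hM : M.IsValid) (hρ : M.IsPolicy one zero ρ) (hy : y ∈ M.states)
    (hrec : ∀ z, M.Reaches ρ y z → M.Reaches ρ z y) (h1 : y ≠ one) (h0 : y ≠ zero) :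
    M.IsEC (M.states.filter (M.Reaches ρ y))
      ((ρ.filter fun m => M.Reaches ρ y m.state).image Move.action) where
  states_subset := Finset.filter_subset _ _
  actions_subset := Finset.image_subset_iff.2 fun m hm => by
    obtain ⟨hm, hym⟩ := Finset.mem_filter.1 hm
    exact Finset.mem_biUnion.2
      ⟨m.state, Finset.mem_filter.2 ⟨hρ.state_mem m hm, hym⟩, hρ.action_mem m hm⟩
  nonempty := by
    obtain ⟨a, ha⟩ := hρ.exists_move y hy h1 h0
    exact ⟨a, Finset.mem_image.2 ⟨⟨y, a⟩, Finset.mem_filter.2 ⟨ha, .refl⟩, rfl⟩⟩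
  closed s hs a ha has t ht := by
    obtain ⟨m, hm, rfl⟩ := Finset.mem_image.1 ha
    obtain ⟨hm, hym⟩ := Finset.mem_filter.1 hm
    obtain rfl := hM.eq_of_mem_enabled (Finset.mem_filter.1 hs).1 (hρ.state_mem m hm) has
      (hρ.action_mem m hm)
    exact Finset.mem_coe.2 <| Finset.mem_filter.2
      ⟨hM.mem_states (hρ.state_mem m hm) has ht, hym.tail hm ht⟩
  connected s hs t ht := by
    have hys := (Finset.mem_filter.1 hs).2
    obtain ⟨p, hp⟩ := (hrec s hys).trans (Finset.mem_filter.1 ht).2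
    clear ht
    induction hp with
    | nil => exact .refl
    | @cons p u t a hp ha ht ih =>
      exact ih.tail ⟨a, Finset.mem_image.2
        ⟨⟨u, a⟩, Finset.mem_filter.2 ⟨ha, hys.trans ⟨p, hp⟩⟩, rfl⟩, hρ.action_mem _ ha,
        pos_iff_ne_zero.2 ht⟩

theorem exists_isPath_cover (hM : M.IsValid) (hρ : M.IsPolicy one zero ρ) (hx : x ∈ M.states)
    (hxy : M.Reaches ρ x y) (hrec : ∀ z, M.Reaches ρ y z → M.Reaches ρ z y) (Q : Finset S)
    (hQ : ∀ z ∈ Q, M.Reaches ρ y z) :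
    ∃ z p, M.IsPath ρ x p z ∧ M.Reaches ρ y z ∧ (∀ s ∈ Q, s ∈ z :: p.map Move.state) ∧
      p.length ≤ (Q.card + 1) * (M.states.card - 1) := by
  induction Q using Finset.induction with
  | empty =>
    obtain ⟨p, hp, hlen⟩ := hρ.exists_isPath_length_lt hM hx hxy
    exact ⟨y, p, hp, .refl, by simp, by simpa using Nat.le_sub_one_of_lt hlen⟩
  | insert s Q hs ih =>
    obtain ⟨hys, hQ⟩ := Finset.forall_mem_insert _ _ _ |>.1 hQ
    obtain ⟨z, p, hp, hyz, hcover, hlen⟩ := ih hQ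
    obtain ⟨q, hq, hqlen⟩ := hρ.exists_isPath_length_lt hM (hρ.mem_states hM hx ⟨p, hp⟩)
      ((hrec z hyz).trans hys)
    refine ⟨s, q ++ p, hp.append hq, hys, ?_, ?_⟩
    · refine Finset.forall_mem_insert _ _ _ |>.2 ⟨List.mem_cons_self, fun u hu => ?_⟩
      rw [List.map_append, ← List.cons_append, List.mem_append]
      obtain rfl | hu := List.mem_cons.1 (hcover u hu)
      exacts [.inl hq.start_mem, .inr hu]
    · rw [Finset.card_insert_of_notMem hs, List.length_append]
      have := Nat.le_sub_one_of_lt hqlen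
      lia

/-- A path of fewer than `|S|²` states covers an end component, since each of its at most `|S| - 2`
states is visited after at most `|S| - 1` further moves. -/
theorem exists_isEC_cover (hM : M.IsValid) (hρ : M.IsPolicy one zero ρ) (hone : one ∈ M.states)
    (hzero : zero ∈ M.states) (hne : one ≠ zero) (hx : x ∈ M.states) (hxy : M.Reaches ρ x y)
    (hy : ∀ z, M.Reaches ρ y z → z ≠ one ∧ z ≠ zero) :
    ∃ R B z p, M.IsEC R B ∧ (∀ s ∈ R, s ≠ one ∧ s ≠ zero) ∧
      (∀ m ∈ ρ, m.state ∈ R → ∀ t, M.trans m.state m.action t ≠ 0 → t ∈ R) ∧ z ∈ R ∧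
      M.IsPath ρ x p z ∧ R ⊆ (z :: p.map Move.state).toFinset ∧
      p.length + 1 < M.states.card ^ 2 := by
  obtain ⟨v, hyv, hrec⟩ := hρ.exists_recurrent hM (hρ.mem_states hM hx hxy)
  have hv := hρ.mem_states hM hx (hxy.trans hyv)
  set R := M.states.filter (M.Reaches ρ v)
  have hRv : ∀ s ∈ R, M.Reaches ρ v s := fun s hs => (Finset.mem_filter.1 hs).2
  have hRne : ∀ s ∈ R, s ≠ one ∧ s ≠ zero := fun s hs => hy s (hyv.trans (hRv s hs))
  obtain ⟨z, p, hp, hvz, hcover, hlen⟩ := hρ.exists_isPath_cover hM hx (hxy.trans hyv) hrec R hRv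
  refine ⟨R, _, z, p, hρ.isEC_filter_reaches hM hv hrec (hy v hyv).1 (hy v hyv).2, hRne,
    fun m hm hmR t ht => ?_, Finset.mem_filter.2 ⟨hρ.mem_states hM hv hvz, hvz⟩, hp,
    fun s hs => List.mem_toFinset.2 (hcover s hs), ?_⟩
  · exact Finset.mem_filter.2 ⟨hM.mem_states (hρ.state_mem m hm) (hρ.action_mem m hm) ht,
      (hRv _ hmR).tail hm ht⟩
  · have hcard : R.card + 2 ≤ M.states.card := by
      rw [← Finset.card_pair hne, ← Finset.card_union_of_disjoint]
      · exact Finset.card_le_card (Finset.union_subset (Finset.filter_subset _ _)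
          (Finset.insert_subset hone (Finset.singleton_subset_iff.2 hzero)))
      · simpa [Finset.disjoint_right] using
          And.intro (fun h => (hRne _ h).1 rfl) fun h => (hRne _ h).2 rfl
    obtain ⟨n, hn⟩ := Nat.exists_eq_add_of_le hcard
    rw [hn] at hlen ⊢
    have : R.card + 2 + n - 1 = R.card + 1 + n := by lia
    rw [this] at hlen
    nlinarith

theorem eq_of_isPath_of_le_mean (hM : M.IsValid) (hρ : M.IsPolicy one zero ρ) {D : S → ℝ}
    (hmax : ∀ y, M.Reaches ρ x y → D y ≤ D x)
    (hD : ∀ m ∈ ρ, M.Reaches ρ x m.state → D m.state ≤ M.mean m.state m.action D)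
    (hp : M.IsPath ρ x p y) : D y = D x := by
  induction hp with
  | nil => rfl
  | @cons p s t a hp ha ht ih =>
    have hs : M.Reaches ρ x s := ⟨p, hp⟩
    exact hM.eq_of_le_mean (hρ.state_mem _ ha) (hρ.action_mem _ ha)
      (fun u _ hu => hmax u (hs.tail ha hu)) (ih ▸ hD _ ha hs) ht

theorem le_or_le_of_le_mean (hM : M.IsValid) (hρ : M.IsPolicy one zero ρ) (hx : x ∈ M.states)
    {D : S → ℝ} (hD : ∀ m ∈ ρ, M.Reaches ρ x m.state → D m.state ≤ M.mean m.state m.action D)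
    (hreach : ∀ y, M.Reaches ρ x y → M.Reaches ρ y one ∨ M.Reaches ρ y zero) :
    D x ≤ D one ∨ D x ≤ D zero := by
  obtain ⟨y, hy, hmax⟩ := (M.states.filter (M.Reaches ρ x)).exists_max_image D
    ⟨x, Finset.mem_filter.2 ⟨hx, .refl⟩⟩
  obtain ⟨hy, hxy⟩ := Finset.mem_filter.1 hy
  have hxle := hmax x (Finset.mem_filter.2 ⟨hx, .refl⟩)
  have heq : ∀ z, M.Reaches ρ y z → D z = D y := fun z ⟨p, hp⟩ =>
    hρ.eq_of_isPath_of_le_mean hM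
      (fun u hu => hmax u (Finset.mem_filter.2 ⟨hρ.mem_states hM hy hu, hxy.trans hu⟩))
      (fun m hm hym => hD m hm (hxy.trans hym)) hp
  exact (hreach y hxy).imp (fun h => hxle.trans (heq _ h).ge) fun h => hxle.trans (heq _ h).ge

end IsPolicy

end MDP

end Policies

section Runs

open Filter

variable {S A : Type*}

namespace Config

/-- The moves that the exploration can make from nonterminal states. -/
def greedyMoves (one zero : S) (c : Config S A) : Finset (Move S A) :=
  (c.bounds.mdp.states \ {one, zero}).biUnion fun s =>
    (c.bounds.mdp.bestActions c.bounds.U s).image (Move.mk s)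

/-- The part of a configuration that determines the probabilities of the continuations of the
simulation, as long as it is neither too long nor at a terminal state. -/
structure IsAt (one zero : S) (c : Config S A) (ρ : Finset (Move S A)) (p : List (Move S A))
    (s : S) : Prop where
  greedyMoves_eq : c.greedyMoves one zero = ρ
  path_eq : c.path = p
  last_eq : c.last = s

variable {one zero s : S} {a : A} {c : Config S A} {ρ : Finset (Move S A)} {p : List (Move S A)}

theorem mem_greedyMoves : ⟨s, a⟩ ∈ c.greedyMoves one zero ↔ s ∈ c.bounds.mdp.states ∧
    (s ≠ one ∧ s ≠ zero) ∧ a ∈ c.bounds.mdp.bestActions c.bounds.U s := by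
  simp [greedyMoves, and_assoc]

theorem IsAt.mem_bestActions (hc : c.IsAt one zero ρ p s) (ha : ⟨s, a⟩ ∈ ρ) :
    a ∈ c.bounds.mdp.bestActions c.bounds.U c.last := by
  rw [hc.last_eq]
  exact (mem_greedyMoves.1 (hc.greedyMoves_eq ▸ ha)).2.2

variable [Countable S] [Countable A] {M : MDP S A} {F : Set S} {ε : ℝ} {k : ℕ → ℕ}

theorem IsSound.isPolicy_greedyMoves (hc : c.IsSound M F one zero ε k) :
    c.bounds.mdp.IsPolicy one zero (c.greedyMoves one zero) where
  state_mem _ hm := (mem_greedyMoves.1 hm).1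
  action_mem _ hm := (MDP.mem_bestActions.1 (mem_greedyMoves.1 hm).2.2).1
  nonterminal _ hm := (mem_greedyMoves.1 hm).2.1
  exists_move _ hs h1 h0 :=
    let ⟨a, ha⟩ := hc.bestActions_nonempty hs
    ⟨a, mem_greedyMoves.2 ⟨hs, ⟨h1, h0⟩, ha⟩⟩

end Config

variable [Countable S] [Countable A]

/-- A run that never terminates, and in which every step that has probability at least `δ > 0`
infinitely often, given the current policy, path and state, is also taken infinitely often. -/
structure FairRun (M : MDP S A) (F : Set S) (one zero : S) (ε : ℝ) (k : ℕ → ℕ)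
    (run : ℕ → Config S A) : Prop where
  isSound : ∀ n, (run n).IsSound M F one zero ε k
  halted : ∀ n, (run n).halted = false
  step : ∀ n, ∃ a ∈ (run n).bounds.mdp.bestActions (run n).bounds.U (run n).last, ∃ t,
    (run n).bounds.mdp.trans (run n).last a t ≠ 0 ∧
      run (n + 1) = (run n).advance F one zero ε k a t
  fair : ∀ ρ p s a t {δ : ℝ}, 0 < δ →
    (∃ᶠ n in atTop, (run n).IsAt one zero ρ p s ∧
      δ ≤ ((run n).next F one zero ε k ((run n).advance F one zero ε k a t)).toReal) →
    ∃ᶠ n in atTop, (run n).IsAt one zero ρ p s ∧ run (n + 1) = (run n).advance F one zero ε k a t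

variable {M M' : MDP S A} {F : Set S} {one zero : S} {ε : ℝ} {k : ℕ → ℕ} {run : ℕ → Config S A}

theorem ae_isSound (hS : Setting M F one zero) (hk : ∀ i, 3 ≤ k i) :
    ∀ᵐ run ∂(runMeasure M F one zero ε k), ∀ n, (run n).IsSound M F one zero ε k := by
  refine ae_all_iff.2 fun n => ?_
  induction n with
  | zero =>
    filter_upwards [ae_run_zero M F one zero ε k] with run hzero
    rw [hzero]
    exact .begin hS.valid hk (Bounds.isSound_first hS) 0 nofun
  | succ n ih =>
    filter_upwards [ih, ae_run_succ (ae_mem_reachable M F one zero ε k n)] with run hn hsucc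
    exact hn.next hS hk hsucc

theorem ae_fairRun (hS : Setting M F one zero) (hk : ∀ i, 3 ≤ k i) :
    ∀ᵐ run ∂(runMeasure M F one zero ε k),
      (∀ n, (run n).halted = false) → FairRun M F one zero ε k run := by
  have hfair : ∀ᵐ run ∂(runMeasure M F one zero ε k), ∀ ρ p s a t (j : ℕ),
      (∃ᶠ n in atTop, (run n).IsAt one zero ρ p s ∧ 1 / ((j : ℝ) + 1) ≤
        ((run n).next F one zero ε k ((run n).advance F one zero ε k a t)).toReal) →
      ∃ᶠ n in atTop, (run n).IsAt one zero ρ p s ∧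
        run (n + 1) = (run n).advance F one zero ε k a t := by
    simp only [ae_all_iff]
    exact fun ρ p s a t j => ae_frequently_advance M F one zero ε k
      (fun c => c.IsAt one zero ρ p s) a t Nat.one_div_pos_of_nat
  filter_upwards [hfair, ae_isSound hS hk,
    ae_all_iff.2 fun n => ae_run_succ (ae_mem_reachable M F one zero ε k n)]
    with run hfair hsound hsucc hhalt
  refine ⟨hsound, hhalt, fun n => ?_, fun ρ p s a t δ hδ h => ?_⟩
  · exact (Config.mem_support_next (hhalt n)
      ((hsound n).bestActions_nonempty (hsound n).last_mem)).1 (hsucc n)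
  · obtain ⟨j, hj⟩ := exists_nat_one_div_lt hδ
    exact hfair ρ p s a t j (h.mono fun n hn => ⟨hn.1, hj.le.trans hn.2⟩)

namespace FairRun

theorem shift (h : FairRun M F one zero ε k run) (N : ℕ) :
    FairRun M F one zero ε k fun n => run (n + N) where
  isSound n := h.isSound _
  halted n := h.halted _
  step n := by simpa only [add_right_comm] using h.step (n + N)
  fair ρ p s a t δ hδ hfreq := by
    have hshift : ∀ P : ℕ → Prop, (∃ᶠ n in atTop, P (n + N)) ↔ ∃ᶠ n in atTop, P n := fun P => by
      rw [← frequently_map (f := atTop) (m := fun n => n + N), map_add_atTop_eq_nat]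
    have hadvance := (hshift _).2 (h.fair ρ p s a t hδ ((hshift _).1 hfreq))
    simpa only [add_right_comm] using hadvance

theorem exists_step (h : FairRun M F one zero ε k run) (n : ℕ) :
    ∃ a ∈ (run n).bounds.mdp.bestActions (run n).bounds.U (run n).last, ∃ t,
      (run n).bounds.mdp.trans (run n).last a t ≠ 0 ∧
        (run n).Step F one zero ε k a t (run (n + 1)) := by
  obtain ⟨a, ha, t, ht, hn⟩ := h.step n
  exact ⟨a, ha, t, ht, hn ▸ Config.step_advance (h.isSound n).length_lt a t⟩

theorem monotone_iter (h : FairRun M F one zero ε k run) : Monotone fun n => (run n).iter := by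
  refine monotone_nat_of_le_succ fun n => ?_
  obtain ⟨a, -, t, -, hstep⟩ := h.exists_step n
  generalize run (n + 1) = d at hstep
  cases hstep with
  | extend => exact le_rfl
  | timeout => exact Nat.le_succ _
  | update => exact Nat.le_succ _

/-- Every simulation ends, because it has fewer than `k i` states. -/
theorem exists_path_succ_eq_nil (h : FairRun M F one zero ε k run) {P : ℕ → Prop}
    (hP : ∀ m, P m → (run (m + 1)).path ≠ [] → P (m + 1)) {n : ℕ} (hn : P n) :
    ∃ m ≥ n, P m ∧ (run (m + 1)).path = [] := by
  by_contra! hcon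
  have hlong : ∀ j, P (n + j) ∧ j ≤ (run (n + j)).path.length ∧
      (run (n + j)).iter = (run n).iter := by
    intro j
    induction j with
    | zero => exact ⟨hn, Nat.zero_le _, rfl⟩
    | succ j ih =>
      obtain ⟨hPj, hlen, hiter⟩ := ih
      have hpath := hcon (n + j) (Nat.le_add_right n j) hPj
      obtain ⟨a, -, t, -, hstep⟩ := h.exists_step (n + j)
      refine ⟨hP _ hPj hpath, ?_⟩
      rw [← add_assoc]
      generalize run (n + j + 1) = d at hstep hpath ⊢
      cases hstep with
      | extend => exact ⟨Nat.succ_le_succ hlen, hiter⟩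
      | timeout => exact (hpath rfl).elim
      | update => exact (hpath rfl).elim
  obtain ⟨-, hlen, hiter⟩ := hlong (k (run n).iter)
  have hlt := (h.isSound (n + k (run n).iter)).length_lt
  rw [hiter] at hlt
  lia

theorem frequently_path_eq_nil (h : FairRun M F one zero ε k run) :
    ∃ᶠ n in atTop, (run n).path = [] :=
  frequently_atTop.2 fun n =>
    let ⟨m, hm, _, hpath⟩ := h.exists_path_succ_eq_nil (P := fun _ => True) (by simp) trivial
    ⟨m + 1, Nat.le_succ_of_le hm, hpath⟩

theorem iter_lt_of_path_eq_nil (h : FairRun M F one zero ε k run) {n : ℕ}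
    (hn : (run (n + 1)).path = []) : (run n).iter < (run (n + 1)).iter := by
  obtain ⟨a, -, t, -, hstep⟩ := h.exists_step n
  generalize run (n + 1) = d at hstep hn ⊢
  cases hstep with
  | extend => exact (List.cons_ne_nil _ _ hn).elim
  | timeout => exact Nat.lt_succ_self _
  | update => exact Nat.lt_succ_self _

theorem tendsto_iter (h : FairRun M F one zero ε k run) :
    Tendsto (fun n => (run n).iter) atTop atTop := by
  refine tendsto_atTop_atTop_of_monotone h.monotone_iter fun i => ?_
  induction i with
  | zero => exact ⟨0, Nat.zero_le _⟩
  | succ i ih =>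
    obtain ⟨n, hn⟩ := ih
    obtain ⟨m, hm, -, hpath⟩ :=
      h.exists_path_succ_eq_nil (P := fun _ => True) (n := n) (by simp) trivial
    exact ⟨m + 1, (hn.trans (h.monotone_iter hm)).trans_lt (h.iter_lt_of_path_eq_nil hpath)⟩

theorem mdp_eq_or_card_actions_lt (hS : Setting M F one zero) (hk : ∀ i, 3 ≤ k i)
    (h : FairRun M F one zero ε k run) (n : ℕ) :
    (run (n + 1)).bounds.mdp = (run n).bounds.mdp ∨
      (run (n + 1)).bounds.mdp.actions.card < (run n).bounds.mdp.actions.card := by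
  obtain ⟨a, -, t, -, hstep⟩ := h.exists_step n
  obtain ⟨proj, hb⟩ := (h.isSound n).bounds
  generalize run (n + 1) = d at hstep
  cases hstep with
  | extend => exact .inl rfl
  | timeout hlen =>
    exact ((h.isSound n).onTheFlyEC hS hk hlen).2.imp_left fun hb => congrArg Bounds.mdp hb.2
  | update => exact .inl (hb.refines_foldl_update hS _).mdp_eq

theorem exists_eventually_mdp_eq (hS : Setting M F one zero) (hk : ∀ i, 3 ≤ k i)
    (h : FairRun M F one zero ε k run) : ∃ M', ∀ᶠ n in atTop, (run n).bounds.mdp = M' := by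
  have hanti : Antitone fun n => (run n).bounds.mdp.actions.card :=
    antitone_nat_of_succ_le fun n => (h.mdp_eq_or_card_actions_lt hS hk n).elim
      (fun h => by rw [h]) le_of_lt
  set N := Function.argmin fun n => (run n).bounds.mdp.actions.card
  have hN : ∀ n, (run N).bounds.mdp.actions.card ≤ (run n).bounds.mdp.actions.card :=
    fun n => Function.argmin_le (fun n => (run n).bounds.mdp.actions.card) n
  refine ⟨(run N).bounds.mdp, eventually_atTop.2 ⟨N, fun n hn => ?_⟩⟩
  induction n, hn using Nat.le_induction with
  | base => rfl
  | succ n hn ih =>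
    exact ((h.mdp_eq_or_card_actions_lt hS hk n).resolve_right
      ((hanti hn).trans (hN (n + 1))).not_gt).trans ih

end FairRun

end Runs

section StableRuns

open Filter

variable {S A : Type*} [Countable S] [Countable A]

theorem Bounds.IsSound.best_upper_eq_best_lower {M : MDP S A} {F : Set S} {one zero : S}
    {b : Bounds S A} {proj : S → S} (hS : Setting M F one zero) (hb : b.IsSound M F one zero proj)
    {z : S} (hz : z = one ∨ z = zero) : b.mdp.best b.U z = b.mdp.best b.L z := by
  obtain rfl | rfl := hz
  · rw [hb.best_lower_one]
    exact (hb.best_upper_le_one hb.quot.one_mem).antisymm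
      (hS.value_one ▸ hb.value_le_best hS hb.quot.one_mem)
  · rw [hb.best_upper_zero]
    exact (hb.best_lower_nonneg hb.quot.zero_mem).antisymm
      (hS.value_zero ▸ hb.best_le_value hS.valid hb.quot.zero_mem)

/-- A fair run whose MDP is always `M'`, and whose simulations are long enough to visit all the
states of an end component of `M'`. -/
structure StableRun (M : MDP S A) (F : Set S) (one zero : S) (ε : ℝ) (k : ℕ → ℕ)
    (run : ℕ → Config S A) (M' : MDP S A) : Prop extends FairRun M F one zero ε k run where
  mdp : ∀ n, (run n).bounds.mdp = M'
  long : ∀ n, M'.states.card ^ 2 ≤ k (run n).iter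

variable {M M' : MDP S A} {F : Set S} {one zero s t : S} {a : A} {ε : ℝ} {k : ℕ → ℕ}
  {run : ℕ → Config S A} {ρ : Finset (Move S A)} {p : List (Move S A)} {n : ℕ}

namespace FairRun

theorem exists_stableRun (hS : Setting M F one zero) (hk : ∀ i, 3 ≤ k i)
    (hlarge : ∀ᶠ i in atTop, M.states.card ^ 2 ≤ k i) (h : FairRun M F one zero ε k run) :
    ∃ run' M', StableRun M F one zero ε k run' M' := by
  obtain ⟨M', hM'⟩ := h.exists_eventually_mdp_eq hS hk
  obtain ⟨N, hN⟩ := eventually_atTop.1 (hM'.and (h.tendsto_iter.eventually hlarge))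
  obtain ⟨proj, hb⟩ := (h.isSound N).bounds
  have hcard : M'.states.card ^ 2 ≤ M.states.card ^ 2 :=
    Nat.pow_le_pow_left (Finset.card_le_card ((hN N le_rfl).1 ▸ hb.quot.states_subset)) 2
  exact ⟨_, M', h.shift N, fun n => (hN _ (Nat.le_add_left N n)).1,
    fun n => hcard.trans (hN _ (Nat.le_add_left N n)).2⟩

theorem le_gap_of_update (h : FairRun M F one zero ε k run) {b : Bounds S A} {i : ℕ}
    (hn : run (n + 1) = Config.begin b i (decide (b.gap < ε))) :
    ε ≤ (run (n + 1)).bounds.gap := by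
  have hhalt := h.halted (n + 1)
  rw [hn] at hhalt ⊢
  exact not_lt.1 (of_decide_eq_false hhalt)

end FairRun

namespace StableRun

theorem isQuotient (h : StableRun M F one zero ε k run M') :
    ∃ proj, IsQuotient M F one zero M' proj :=
  let ⟨proj, hb⟩ := (h.isSound 0).bounds
  ⟨proj, h.mdp 0 ▸ hb.quot⟩

theorem isValid (hM : M.IsValid) (h : StableRun M F one zero ε k run M') : M'.IsValid :=
  let ⟨_, hq⟩ := h.isQuotient
  hq.isValid hM

theorem isPolicy_greedyMoves (h : StableRun M F one zero ε k run M') (n : ℕ) :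
    M'.IsPolicy one zero ((run n).greedyMoves one zero) :=
  h.mdp n ▸ (h.isSound n).isPolicy_greedyMoves

theorem last_eq_start (h : StableRun M F one zero ε k run M') (hn : (run n).path = []) :
    (run n).last = M'.start :=
  h.mdp n ▸ (h.isSound n).last_eq_start hn

theorem onTheFlyEC_eq (hS : Setting M F one zero) (hk : ∀ i, 3 ≤ k i)
    (h : StableRun M F one zero ε k run M') (hlen : (run n).path.length + 2 = k (run n).iter) :
    (run n).bounds.mdp.identifyECs (run n).visited = ∅ ∧
      (run n).bounds.onTheFlyEC F one zero (run n).visited = (run n).bounds := by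
  refine ((h.isSound n).onTheFlyEC hS hk hlen).2.resolve_right fun hlt => ?_
  obtain ⟨a, -, t, -, hstep⟩ := h.exists_step n
  have hmdp := h.mdp (n + 1)
  generalize run (n + 1) = d at hstep hmdp
  cases hstep with
  | extend => lia
  | timeout =>
    have heq : ((run n).bounds.onTheFlyEC F one zero (run n).visited).mdp = (run n).bounds.mdp :=
      hmdp.trans (h.mdp n).symm
    exact (congrArg (fun N : MDP S A => N.actions.card) heq).not_lt hlt
  | update => lia

theorem refines_succ (hS : Setting M F one zero) (hk : ∀ i, 3 ≤ k i)
    (h : StableRun M F one zero ε k run M') (n : ℕ) :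
    (run (n + 1)).bounds.Refines (run n).bounds := by
  obtain ⟨a, -, t, -, hstep⟩ := h.exists_step n
  obtain ⟨proj, hb⟩ := (h.isSound n).bounds
  generalize run (n + 1) = d at hstep
  cases hstep with
  | extend => exact .refl _
  | timeout hlen =>
    simpa only [Config.begin, (h.onTheFlyEC_eq hS hk hlen).2] using Bounds.Refines.refl _
  | update => exact hb.refines_foldl_update hS _

theorem start_not_terminal (hS : Setting M F one zero) (hk : ∀ i, 3 ≤ k i) (hε : 0 < ε)
    (h : StableRun M F one zero ε k run M') : M'.start ≠ one ∧ M'.start ≠ zero := by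
  rw [← not_or]
  intro hstart
  obtain ⟨n, hn⟩ := h.frequently_path_eq_nil.exists
  obtain ⟨a, ha, t, ht, hstep⟩ := h.exists_step n
  obtain ⟨proj, hq⟩ := h.isQuotient
  have hterminal : M'.IsTerminal M'.start := by
    obtain hz | hz := hstart <;> rw [hz]
    exacts [hq.one_isTerminal hS, hq.zero_isTerminal hS]
  rw [h.mdp n, h.last_eq_start hn] at ha ht
  obtain rfl := hterminal.eq_of_trans_ne_zero (MDP.mem_bestActions.1 ha).1 ht
  generalize hd : run (n + 1) = d at hstep
  cases hstep with
  | extend hlen h1 h0 => exact hstart.elim h1 h0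
  | timeout hlen => exact Config.path_ne_nil_of_timeout hk hlen hn
  | update hlen _ =>
    obtain ⟨proj', hb⟩ := (h.isSound (n + 1)).bounds
    have hgap := h.le_gap_of_update hd
    rw [Bounds.gap, h.mdp, ← h.mdp (n + 1), hb.best_upper_eq_best_lower hS (h.mdp (n + 1) ▸ hstart),
      sub_self] at hgap
    exact hgap.not_gt hε

theorem three_le_card (hS : Setting M F one zero) (hk : ∀ i, 3 ≤ k i) (hε : 0 < ε)
    (h : StableRun M F one zero ε k run M') : 3 ≤ M'.states.card := by
  obtain ⟨h1, h0⟩ := h.start_not_terminal hS hk hε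
  obtain ⟨proj, hq⟩ := h.isQuotient
  have hsubset : {M'.start, one, zero} ⊆ M'.states := by
    simpa [Finset.insert_subset_iff] using
      ⟨(h.isValid hS.valid).start_mem, hq.one_mem, hq.zero_mem⟩
  exact (Finset.card_eq_three.2 ⟨_, _, _, h1, h0, hS.ne, rfl⟩).symm.trans_le
    (Finset.card_le_card hsubset)

theorem exists_policy (h : StableRun M F one zero ε k run M') :
    ∃ ρ, M'.IsPolicy one zero ρ ∧ ∃ᶠ n in atTop, (run n).IsAt one zero ρ [] M'.start := by
  have hfinite : ∀ n, (run n).greedyMoves one zero ∈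
      (M'.states.biUnion fun s => (M'.enabled s).image (Move.mk s)).powerset := fun n =>
    Finset.mem_powerset.2 fun m hm => Finset.mem_biUnion.2
      ⟨m.state, (h.isPolicy_greedyMoves n).state_mem m hm,
        Finset.mem_image.2 ⟨m.action, (h.isPolicy_greedyMoves n).action_mem m hm, rfl⟩⟩
  obtain ⟨ρ, -, hρ⟩ := (frequently_exists_finset _
    (p := fun ρ n => (run n).IsAt one zero ρ [] M'.start)).1 <|
      h.frequently_path_eq_nil.mono fun n hn => ⟨_, hfinite n, rfl, hn, h.last_eq_start hn⟩
  obtain ⟨n, hn⟩ := hρ.exists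
  exact ⟨ρ, hn.greedyMoves_eq ▸ h.isPolicy_greedyMoves n, hρ⟩

theorem frequently_move (h : StableRun M F one zero ε k run M')
    (hat : ∃ᶠ n in atTop, (run n).IsAt one zero ρ p s) (ha : ⟨s, a⟩ ∈ ρ)
    (ht : M'.trans s a t ≠ 0) :
    ∃ᶠ n in atTop, (run n).IsAt one zero ρ p s ∧
      (run n).Step F one zero ε k a t (run (n + 1)) := by
  have hpos : 0 < (((M'.enabled s).card : ENNReal)⁻¹ * M'.trans s a t).toReal := by
    obtain ⟨n, hn⟩ := hat.exists
    have hcard := Finset.card_pos.2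
      ⟨a, (hn.greedyMoves_eq ▸ h.isPolicy_greedyMoves n).action_mem _ ha⟩
    rw [ENNReal.toReal_mul, ENNReal.toReal_inv, ENNReal.toReal_natCast]
    exact mul_pos (inv_pos.2 (Nat.cast_pos.2 hcard)) (ENNReal.toReal_pos ht (PMF.apply_ne_top _ _))
  refine (h.fair ρ p s a t hpos (hat.mono fun n hn => ⟨hn, ?_⟩)).mono fun n hn =>
    ⟨hn.1, hn.2 ▸ Config.step_advance (h.isSound n).length_lt a t⟩
  have hle := Config.le_next_advance (F := F) (one := one) (zero := zero) (ε := ε) (k := k)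
    (h.halted n) (hn.mem_bestActions ha) t
  rw [h.mdp n, hn.last_eq] at hle
  exact ENNReal.toReal_mono (PMF.apply_ne_top _ _) hle

theorem frequently_path (h : StableRun M F one zero ε k run M') (hρ : M'.IsPolicy one zero ρ)
    (hat : ∃ᶠ n in atTop, (run n).IsAt one zero ρ [] M'.start)
    (hp : M'.IsPath ρ M'.start p s) (hlen : p.length + 1 < M'.states.card ^ 2)
    (hs : p = [] ∨ (s ≠ one ∧ s ≠ zero)) : ∃ᶠ n in atTop, (run n).IsAt one zero ρ p s := by
  induction hp with
  | nil => exact hat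
  | @cons p s t a _ ha ht ih =>
    obtain ⟨h1, h0⟩ := hs.resolve_left (List.cons_ne_nil _ _)
    have hmove := h.frequently_move
      (ih ((Nat.lt_succ_self _).trans hlen) (.inr (hρ.nonterminal _ ha))) ha ht
    refine (tendsto_add_atTop_nat 1).frequently (hmove.mono fun n hn => ?_)
    obtain ⟨hn, hstep⟩ := hn
    have hlong := h.long n
    rw [List.length_cons, ← hn.path_eq] at hlen
    generalize run (n + 1) = d at hstep ⊢
    cases hstep with
    | extend => exact ⟨hn.greedyMoves_eq, by rw [← hn.path_eq, ← hn.last_eq], rfl⟩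
    | timeout => lia
    | update _ hterminal => exact (hterminal.elim h1 h0).elim

theorem frequently_update (h : StableRun M F one zero ε k run M') (hρ : M'.IsPolicy one zero ρ)
    (hat : ∃ᶠ n in atTop, (run n).IsAt one zero ρ [] M'.start)
    (hp : M'.IsPath ρ M'.start p t) (hlen : p.length + 1 < M'.states.card ^ 2) (hne : p ≠ [])
    (ht : t = one ∨ t = zero) :
    ∃ᶠ n in atTop, (run (n + 1)).bounds = p.foldl Bounds.update (run n).bounds ∧
      ε ≤ (run (n + 1)).bounds.gap := by
  cases hp with
  | nil => exact (hne rfl).elim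
  | cons hp ha htrans =>
    have hmove := h.frequently_move (h.frequently_path hρ hat hp ((Nat.lt_succ_self _).trans hlen)
      (.inr (hρ.nonterminal _ ha))) ha htrans
    refine hmove.mono fun n hn => ?_
    obtain ⟨hn, hstep⟩ := hn
    have hlong := h.long n
    rw [List.length_cons, ← hn.path_eq] at hlen
    rw [← hn.path_eq, ← hn.last_eq]
    generalize hd : run (n + 1) = d at hstep
    cases hstep with
    | extend _ h1 h0 => exact (ht.elim h1 h0).elim
    | timeout => lia
    | update => exact ⟨rfl, hd ▸ h.le_gap_of_update hd⟩

theorem exists_timeout (h : StableRun M F one zero ε k run M') {R : Finset S}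
    (hR : ∀ s ∈ R, s ≠ one ∧ s ≠ zero)
    (hclosed : ∀ m ∈ ρ, m.state ∈ R → ∀ t, M'.trans m.state m.action t ≠ 0 → t ∈ R)
    (hn : (run n).greedyMoves one zero = ρ) (hlast : (run n).last ∈ R)
    (hvisited : R ⊆ (run n).visited) :
    ∃ m, (run m).path.length + 2 = k (run m).iter ∧ R ⊆ (run m).visited := by
  have hmove : ∀ m, (run m).greedyMoves one zero = ρ → (run m).last ∈ R →
      ∃ a, ∃ t ∈ R, (run m).Step F one zero ε k a t (run (m + 1)) := fun m hm hlast => by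
    obtain ⟨a, ha, t, ht, hstep⟩ := h.exists_step m
    rw [h.mdp m] at ht
    exact ⟨a, t, hclosed _ (hm ▸ Config.mem_greedyMoves.2
      ⟨(h.isSound m).last_mem, hR _ hlast, ha⟩) hlast t ht, hstep⟩
  obtain ⟨m, -, ⟨hm, hlast, hvisited⟩, hpath⟩ := h.exists_path_succ_eq_nil
    (P := fun m => (run m).greedyMoves one zero = ρ ∧ (run m).last ∈ R ∧ R ⊆ (run m).visited)
    (fun m ⟨hm, hlast, hvisited⟩ hpath => by
      obtain ⟨a, t, ht, hstep⟩ := hmove m hm hlast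
      generalize run (m + 1) = d at hstep hpath ⊢
      cases hstep with
      | extend =>
        refine ⟨hm, ht, hvisited.trans ?_⟩
        simp only [Config.visited, List.map_cons, List.toFinset_cons, Finset.subset_insert]
      | timeout => exact (hpath rfl).elim
      | update => exact (hpath rfl).elim)
    ⟨hn, hlast, hvisited⟩
  refine ⟨m, ?_, hvisited⟩
  obtain ⟨a, t, ht, hstep⟩ := hmove m hm hlast
  generalize run (m + 1) = d at hstep hpath
  cases hstep with
  | extend => exact (List.cons_ne_nil _ _ hpath).elim
  | timeout hlen => exact hlen
  | update _ hterminal => exact (hterminal.elim (hR t ht).1 (hR t ht).2).elim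

/-- Otherwise some simulation would visit a whole end component and then be too long, so that the
end component would be collapsed. -/
theorem reaches_terminal (hS : Setting M F one zero) (hk : ∀ i, 3 ≤ k i)
    (h : StableRun M F one zero ε k run M') (hρ : M'.IsPolicy one zero ρ)
    (hat : ∃ᶠ n in atTop, (run n).IsAt one zero ρ [] M'.start) (hs : M'.Reaches ρ M'.start s) :
    M'.Reaches ρ s one ∨ M'.Reaches ρ s zero := by
  by_contra! hcon
  have hM' := h.isValid hS.valid
  obtain ⟨proj, hq⟩ := h.isQuotient
  obtain ⟨R, B, z, p, hEC, hR, hclosed, hz, hp, hcover, hlen⟩ :=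
    hρ.exists_isEC_cover hM' hq.one_mem hq.zero_mem hS.ne hM'.start_mem hs fun y hy =>
      ⟨fun h1 => hcon.1 (h1 ▸ hy), fun h0 => hcon.2 (h0 ▸ hy)⟩
  obtain ⟨n, hn⟩ := (h.frequently_path hρ hat hp hlen (.inr (hR z hz))).exists
  obtain ⟨m, htimeout, hvisited⟩ := h.exists_timeout hR hclosed hn.greedyMoves_eq
    (hn.last_eq.symm ▸ hz) (by rwa [Config.visited, hn.last_eq, hn.path_eq])
  have hnonempty := hEC.identifyECs_nonempty hvisited
  rw [← h.mdp m, (h.onTheFlyEC_eq hS hk htimeout).1] at hnonempty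
  exact Finset.not_nonempty_empty hnonempty

theorem exists_path_to_terminal (hS : Setting M F one zero) (hk : ∀ i, 3 ≤ k i) (hε : 0 < ε)
    (h : StableRun M F one zero ε k run M') (hρ : M'.IsPolicy one zero ρ)
    (hat : ∃ᶠ n in atTop, (run n).IsAt one zero ρ [] M'.start) (hs : M'.Reaches ρ M'.start s)
    (ha : ⟨s, a⟩ ∈ ρ) :
    ∃ p z, M'.IsPath ρ M'.start p z ∧ (z = one ∨ z = zero) ∧ ⟨s, a⟩ ∈ p ∧
      p.length + 1 < M'.states.card ^ 2 := by
  have hM' := h.isValid hS.valid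
  obtain ⟨t, ht⟩ := (M'.trans s a).support_nonempty
  have hst := hs.tail ha ht
  obtain ⟨z, hz, htz⟩ : ∃ z, (z = one ∨ z = zero) ∧ M'.Reaches ρ t z :=
    (h.reaches_terminal hS hk hρ hat hst).elim (fun h1 => ⟨one, .inl rfl, h1⟩)
      fun h0 => ⟨zero, .inr rfl, h0⟩
  obtain ⟨p, hp, hplen⟩ := hρ.exists_isPath_length_lt hM' hM'.start_mem hs
  obtain ⟨q, hq, hqlen⟩ := hρ.exists_isPath_length_lt hM' (hρ.mem_states hM' hM'.start_mem hst) htz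
  refine ⟨_, z, (hp.cons ha ht).append hq, hz, by simp, ?_⟩
  have hcard := h.three_le_card hS hk hε
  rw [List.length_append, List.length_cons]
  nlinarith

theorem frequently_update_pair (hS : Setting M F one zero) (hk : ∀ i, 3 ≤ k i) (hε : 0 < ε)
    (h : StableRun M F one zero ε k run M') (hρ : M'.IsPolicy one zero ρ)
    (hat : ∃ᶠ n in atTop, (run n).IsAt one zero ρ [] M'.start) (hs : M'.Reaches ρ M'.start s)
    (ha : ⟨s, a⟩ ∈ ρ) :
    ∃ᶠ n in atTop, (run (n + 1)).bounds.U s a ≤ M'.mean s a (M'.best (run n).bounds.U) ∧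
      M'.mean s a (M'.best (run n).bounds.L) ≤ (run (n + 1)).bounds.L s a ∧
      ε ≤ (run (n + 1)).bounds.gap := by
  obtain ⟨p, z, hp, hz, hmem, hlen⟩ := h.exists_path_to_terminal hS hk hε hρ hat hs ha
  refine (h.frequently_update hρ hat hp hlen (List.ne_nil_of_mem hmem) hz).mono fun n hn => ?_
  obtain ⟨hn, hgap⟩ := hn
  obtain ⟨proj, hb⟩ := (h.isSound n).bounds
  have hw : ∀ m ∈ p, m.state ∈ (run n).bounds.mdp.states ∧
      m.action ∈ (run n).bounds.mdp.enabled m.state := fun m hm => by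
    rw [h.mdp n]
    exact ⟨hρ.state_mem m (hp.mem_policy m hm), hρ.action_mem m (hp.mem_policy m hm)⟩
  have hupper := hb.foldl_update_upper_le hS hw _ hmem
  have hlower := hb.le_foldl_update_lower hS hw _ hmem
  rw [← hn, h.mdp n] at hupper hlower
  exact ⟨hupper, hlower, hgap⟩

end StableRun

end StableRuns

section Limit

open Filter Topology

section

variable {S A : Type*}

theorem MDP.tendsto_best (M : MDP S A) {f : ℕ → S → A → ℝ} {g : S → A → ℝ} {s : S}
    (h : ∀ a ∈ M.enabled s, Tendsto (fun n => f n s a) atTop (𝓝 (g s a))) :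
    Tendsto (fun n => M.best (f n) s) atTop (𝓝 (M.best g s)) := by
  by_cases hE : (M.enabled s).Nonempty
  · simp only [best_eq_sup' _ _ hE]
    exact Filter.Tendsto.finset_sup'_nhds_apply hE h
  · simp only [best, dif_neg hE]
    exact tendsto_const_nhds

theorem MDP.tendsto_mean (M : MDP S A) {f : ℕ → S → ℝ} {g : S → ℝ} (s : S) (a : A)
    (h : ∀ t ∈ M.states, Tendsto (fun n => f n t) atTop (𝓝 (g t))) :
    Tendsto (fun n => M.mean s a (f n)) atTop (𝓝 (M.mean s a g)) :=
  tendsto_finsetSum _ fun t ht => (h t ht).const_mul _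

/-- The limit of the upper bounds of a run, provided that they decrease. -/
def upperLimit (run : ℕ → Config S A) (s : S) (a : A) : ℝ :=
  ⨅ n, (run n).bounds.U s a

/-- The limit of the lower bounds of a run, provided that they increase. -/
def lowerLimit (run : ℕ → Config S A) (s : S) (a : A) : ℝ :=
  ⨆ n, (run n).bounds.L s a

/-- The limit of the distance between the bounds at a state, for a run on the fixed MDP `M`. -/
def limitGap (run : ℕ → Config S A) (M : MDP S A) (s : S) : ℝ :=
  M.best (upperLimit run) s - M.best (lowerLimit run) s

end

namespace StableRun

variable {S A : Type*} [Countable S] [Countable A] {M M' : MDP S A} {F : Set S} {one zero s : S}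
  {a : A} {ε : ℝ} {k : ℕ → ℕ} {run : ℕ → Config S A} {ρ : Finset (Move S A)}

theorem bounds_mem_Icc (h : StableRun M F one zero ε k run M') (n : ℕ) (hs : s ∈ M'.states)
    (ha : a ∈ M'.enabled s) :
    (run n).bounds.L s a ∈ Set.Icc 0 1 ∧ (run n).bounds.U s a ∈ Set.Icc 0 1 := by
  obtain ⟨proj, hb⟩ := (h.isSound n).bounds
  rw [← h.mdp n] at hs ha
  have hle := (hb.lower s hs a ha).trans (hb.upper s hs a ha)
  have h0 := hb.lower_nonneg s hs a ha
  have h1 := hb.upper_le_one s hs a ha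
  exact ⟨⟨h0, hle.trans h1⟩, h0.trans hle, h1⟩

theorem tendsto_upper (hS : Setting M F one zero) (hk : ∀ i, 3 ≤ k i)
    (h : StableRun M F one zero ε k run M') (hs : s ∈ M'.states) (ha : a ∈ M'.enabled s) :
    Tendsto (fun n => (run n).bounds.U s a) atTop (𝓝 (upperLimit run s a)) :=
  tendsto_atTop_ciInf
    (antitone_nat_of_succ_le fun n =>
      (h.refines_succ hS hk n).upper_le s (h.mdp n ▸ hs) a (h.mdp n ▸ ha))
    ⟨0, Set.forall_mem_range.2 fun n => (h.bounds_mem_Icc n hs ha).2.1⟩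

theorem tendsto_lower (hS : Setting M F one zero) (hk : ∀ i, 3 ≤ k i)
    (h : StableRun M F one zero ε k run M') (hs : s ∈ M'.states) (ha : a ∈ M'.enabled s) :
    Tendsto (fun n => (run n).bounds.L s a) atTop (𝓝 (lowerLimit run s a)) :=
  tendsto_atTop_ciSup
    (monotone_nat_of_le_succ fun n =>
      (h.refines_succ hS hk n).le_lower s (h.mdp n ▸ hs) a (h.mdp n ▸ ha))
    ⟨1, Set.forall_mem_range.2 fun n => (h.bounds_mem_Icc n hs ha).1.2⟩

theorem tendsto_best_upper (hS : Setting M F one zero) (hk : ∀ i, 3 ≤ k i)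
    (h : StableRun M F one zero ε k run M') (hs : s ∈ M'.states) :
    Tendsto (fun n => M'.best (run n).bounds.U s) atTop (𝓝 (M'.best (upperLimit run) s)) :=
  M'.tendsto_best fun _ ha => h.tendsto_upper hS hk hs ha

theorem tendsto_best_lower (hS : Setting M F one zero) (hk : ∀ i, 3 ≤ k i)
    (h : StableRun M F one zero ε k run M') (hs : s ∈ M'.states) :
    Tendsto (fun n => M'.best (run n).bounds.L s) atTop (𝓝 (M'.best (lowerLimit run) s)) :=
  M'.tendsto_best fun _ ha => h.tendsto_lower hS hk hs ha

theorem limitGap_terminal (hS : Setting M F one zero) (hk : ∀ i, 3 ≤ k i)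
    (h : StableRun M F one zero ε k run M') (hs : s = one ∨ s = zero) :
    limitGap run M' s = 0 := by
  obtain ⟨proj, hq⟩ := h.isQuotient
  have hmem : s ∈ M'.states := by
    obtain rfl | rfl := hs
    exacts [hq.one_mem, hq.zero_mem]
  refine sub_eq_zero.2 (tendsto_nhds_unique (h.tendsto_best_upper hS hk hmem)
    ((h.tendsto_best_lower hS hk hmem).congr fun n => ?_))
  obtain ⟨proj', hb⟩ := (h.isSound n).bounds
  rw [← h.mdp n, hb.best_upper_eq_best_lower hS hs]

theorem best_upperLimit_le (hS : Setting M F one zero) (hk : ∀ i, 3 ≤ k i)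
    (h : StableRun M F one zero ε k run M') (hρ : M'.IsPolicy one zero ρ)
    (hat : ∃ᶠ n in atTop, (run n).IsAt one zero ρ [] M'.start) (ha : ⟨s, a⟩ ∈ ρ) :
    M'.best (upperLimit run) s ≤ upperLimit run s a := by
  refine le_of_tendsto_of_tendsto_of_frequently (h.tendsto_best_upper hS hk (hρ.state_mem _ ha))
    (h.tendsto_upper hS hk (hρ.state_mem _ ha) (hρ.action_mem _ ha)) (hat.mono fun n hn => ?_)
  obtain ⟨-, -, hbest⟩ := Config.mem_greedyMoves.1 (hn.greedyMoves_eq ▸ ha)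
  rw [h.mdp n] at hbest
  exact (MDP.mem_bestActions.1 hbest).2.ge

theorem limitGap_le_mean (hS : Setting M F one zero) (hk : ∀ i, 3 ≤ k i) (hε : 0 < ε)
    (h : StableRun M F one zero ε k run M') (hρ : M'.IsPolicy one zero ρ)
    (hat : ∃ᶠ n in atTop, (run n).IsAt one zero ρ [] M'.start) (hs : M'.Reaches ρ M'.start s)
    (ha : ⟨s, a⟩ ∈ ρ) : limitGap run M' s ≤ M'.mean s a (limitGap run M') := by
  have hmem := hρ.state_mem _ ha
  have henabled := hρ.action_mem _ ha
  have hupdate := h.frequently_update_pair hS hk hε hρ hat hs ha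
  calc limitGap run M' s
    _ ≤ upperLimit run s a - lowerLimit run s a :=
      sub_le_sub (h.best_upperLimit_le hS hk hρ hat ha) (M'.le_best _ henabled)
    _ ≤ M'.mean s a (M'.best (upperLimit run)) - M'.mean s a (M'.best (lowerLimit run)) :=
      sub_le_sub
        (le_of_tendsto_of_tendsto_of_frequently
          ((tendsto_add_atTop_iff_nat 1).2 (h.tendsto_upper hS hk hmem henabled))
          (M'.tendsto_mean s a fun _ => h.tendsto_best_upper hS hk)
          (hupdate.mono fun _ hn => hn.1))
        (le_of_tendsto_of_tendsto_of_frequently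
          (M'.tendsto_mean s a fun _ => h.tendsto_best_lower hS hk)
          ((tendsto_add_atTop_iff_nat 1).2 (h.tendsto_lower hS hk hmem henabled))
          (hupdate.mono fun _ hn => hn.2.1))
    _ = M'.mean s a (limitGap run M') := (M'.mean_sub s a _ _).symm

theorem le_limitGap_start (hS : Setting M F one zero) (hk : ∀ i, 3 ≤ k i) (hε : 0 < ε)
    (h : StableRun M F one zero ε k run M') (hρ : M'.IsPolicy one zero ρ)
    (hat : ∃ᶠ n in atTop, (run n).IsAt one zero ρ [] M'.start) :
    ε ≤ limitGap run M' M'.start := by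
  have hstart := (h.isValid hS.valid).start_mem
  obtain ⟨h1, h0⟩ := h.start_not_terminal hS hk hε
  obtain ⟨a, ha⟩ := hρ.exists_move _ hstart h1 h0
  refine ge_of_tendsto_of_frequently ((tendsto_add_atTop_iff_nat 1).2
    ((h.tendsto_best_upper hS hk hstart).sub (h.tendsto_best_lower hS hk hstart)))
    ((h.frequently_update_pair hS hk hε hρ hat .refl ha).mono fun n hn => ?_)
  simpa only [Bounds.gap, h.mdp (n + 1)] using hn.2.2

/-- By the maximum principle: the gap between the limits of the bounds is a submartingale under a
policy that is used infinitely often, and this policy can always reach a terminal state, where the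
gap vanishes. -/
theorem false (hS : Setting M F one zero) (hk : ∀ i, 3 ≤ k i) (hε : 0 < ε)
    (h : StableRun M F one zero ε k run M') : False := by
  have hM' := h.isValid hS.valid
  obtain ⟨ρ, hρ, hat⟩ := h.exists_policy
  have hmax := hρ.le_or_le_of_le_mean hM' hM'.start_mem
    (fun _ hm hreach => h.limitGap_le_mean hS hk hε hρ hat hreach hm)
    fun _ => h.reaches_terminal hS hk hρ hat
  rw [h.limitGap_terminal hS hk (.inl rfl), h.limitGap_terminal hS hk (.inr rfl), or_self] at hmax
  exact ((h.le_limitGap_start hS hk hε hρ hat).trans hmax).not_gt hε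

end StableRun

end Limit

end

end OBRTDP

theorem mainTheorem1_general {S A : Type*} [Countable S] [Countable A]
    (M : OBRTDP.MDP S A) (hM : M.IsValid)
    (one zero : S) (hone : one ∈ M.states) (hzero : zero ∈ M.states)
    (hone_terminal : M.IsTerminal one) (hzero_terminal : M.IsTerminal zero)
    (F : Set S) (hone_target : one ∈ F) (hzero_target : zero ∉ F)
    (hF : ∀ s ∈ M.states, s ∈ F → ∃ a ∈ M.enabled s, OBRTDP.actionValue M F s a = 1)
    (k : ℕ → ℕ) (hk : ∀ i, 3 ≤ k i) (hk_large : ∀ᶠ i in Filter.atTop, M.states.card ^ 2 ≤ k i)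
    (ε : ℝ) (hε : 0 < ε) :
    ∀ᵐ run ∂(OBRTDP.runMeasure M F one zero ε k),
      ∃ n, (run n).halted = true ∧ (run n).bounds.IsCorrect M F ε := by
  have hS : OBRTDP.Setting M F one zero :=
    ⟨hM, hone, hzero, hone_terminal, hzero_terminal, hone_target, hzero_target, hF⟩
  filter_upwards [OBRTDP.ae_isSound hS hk, OBRTDP.ae_fairRun hS hk] with run hsound hfair
  by_contra! hcon
  have hhalted : ∀ n, (run n).halted = false := fun n =>
    Bool.eq_false_iff.2 fun hn => hcon n hn ((hsound n).isCorrect hS hn)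
  obtain ⟨run', M', hstable⟩ := (hfair hhalted).exists_stableRun hS hk hk_large
  exact hstable.false hS hk hε

theorem mainTheorem1 {S A : Type*} [Finite S] [Finite A]
    (M : OBRTDP.MDP S A) (hM : M.IsValid)
    (one zero : S) (hone : one ∈ M.states) (hzero : zero ∈ M.states) (hne : one ≠ zero)
    (hone_terminal : M.IsTerminal one) (hzero_terminal : M.IsTerminal zero)
    (F : Set S) (hone_target : one ∈ F) (hzero_target : zero ∉ F)
    (hF : ∀ s ∈ M.states, s ∈ F → ∃ a ∈ M.enabled s, OBRTDP.actionValue M F s a = 1)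
    (k : ℕ → ℕ) (hk : ∀ i, 3 ≤ k i) (hk_large : ∀ᶠ i in Filter.atTop, M.states.card ^ 2 ≤ k i)
    (ε : ℝ) (hε : 0 < ε) :
    ∀ᵐ run ∂(OBRTDP.runMeasure M F one zero ε k),
      ∃ n, (run n).halted = true ∧ (run n).bounds.IsCorrect M F ε :=
  mainTheorem1_general M hM one zero hone hzero hone_terminal hzero_terminal F hone_target
    hzero_target hF k hk hk_large ε hε
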